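/- Let $c\in\mathbb C\setminus\{0\}$. For $(m,n)\in\{(2,1),(1,2)\}$ let $[i]=0$ for $i\le m$ and $[i]=1$ for $i>m$ ($1\le i\le 3$), and let $Y(m|n)$ be the super-Yangian: the unital associative algebra generated by modes $T^{(p)}_{ij}$, $p\ge 0$, with $T_{ij}(u)=\delta_{ij}+\sum_{p\ge0}T^{(p)}_{ij}(c/u)^{p+1}$ of degree $[i]+[j]$, subject to $$T_{ij}(z)T_{kl}(w)-(-1)^{([i]+[j])([k]+[l])}T_{kl}(w)T_{ij}(z)=(-1)^{[l]([i]+[j])+[i][j]}g(z,w)\big(T_{il}(z)T_{kj}(w)-T_{il}(w)T_{kj}(z)\big).$$ Here $g(u,v)=\frac{c}{u-v}$, $f(u,v)=1+g(u,v)$, $h(u,v)=\frac{u-v+c}{c}$; a function of one or two variables written with (ordered) sets denotes the product of its values over all elements, resp. pairs of elements. Put $H(\bar w)=\prod_{j>k}h(w_j,w_k)$, let $\bar w^*$ be $\bar w$ in the reverse order, and for $\#\bar v=\#\bar u=\ell$ put $$K_\ell(\bar v|\bar u)=\prod_{j>k}g(v_j,v_k)\;\prod_{j>k}g(u_k,u_j)\;h(\bar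 v,\bar u)\,\det_\ell\Big(\frac{g(v_j,u_k)}{h(v_j,u_k)}\Big).$$ Let $\psi$ be the linear map of $Y(m|n)$ with $\psi(xy)=(-1)^{[x][y]}\psi(y)\psi(x)$ for homogeneous $x,y$ and $\psi(T_{ij}(u))=(-1)^{[i][j]+[i]}T_{ji}(u)$. Let $\Omega$ be a vector of a representation with $T_{ii}(u)\Omega=\lambda_i(u)\Omega$ and $T_{ij}(u)\Omega=0$ for $i>j$, and let $\psi$ also denote a transposition map from this representation to a right module, $\psi(x\Omega)=\Omega^\dagger\psi(x)$ with $\Omega^\dagger=\psi(\Omega)$. For $\bar u=\{u_1,\dots,u_a\}$, $\bar v=\{v_1,\dots,v_b\}$, all independent formal variables, let $$\Phi_{a,b}(\bar u,\bar v)=\varepsilon\,\mathrm{str}_{1\cdots a+b}\Big[T_1(u_1)\cdots T_a(u_a)T_{a+1}(v_1)\cdots T_{a+b}(v_b)\,\mathbb R\,E_{21}^{(1)}\cdots E_{21}^{(a)}E_{32}^{(a+1)}\cdots E_{32}^{(a+b)}\Big]\Omega,$$ with $T_p(u)=\sum_{i,j}E^{(p)}_{ij}\otimes T_{ij}(u)$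 in the graded tensor product of $a+b$ copies of $\mathrm{End}(\mathbb C^{m|n})$ and the algebra, $\mathrm{str}\,E_{ij}=(-1)^{[j]}\delta_{ij}$, $\mathbb R=(R_{a+1,a}\cdots R_{a+1,1})\cdots(R_{a+b,a}\cdots R_{a+b,1})$, $R_{a+j,k}=1+g(v_j,u_k)\sum_{i,l}(-1)^{[l]}E_{il}^{(a+j)}E_{li}^{(k)}$, and $\varepsilon=(-1)^b/H(\bar v)$ for $Y(2|1)$, $\varepsilon=(-1)^a/H(\bar u)$ for $Y(1|2)$. The dual Bethe vectors are $\Psi_{a,b}(\bar u,\bar v)=\psi\big(\Phi_{a,b}(\bar u^*,\bar v^*)\big)$. All quantities for $Y(1|2)$ are written with a tilde. Put $\mathbb T_{ij}(\bar w)=H(\bar w^*)^{-1}\,T_{ij}(w_1)T_{ij}(w_2)\cdots$ (ordered product); without normalisation, $T_{ij}(\bar w)=T_{ij}(w_1)T_{ij}(w_2)\cdots$. Then for all $a,b\ge0$, in $Y(2|1)$, $$\Psi_{a,b}(\bar u,\bar v)=\Omega^\dagger(-1)^{b(b-1)/2}\sum g(\bar v_{\rm I},\bar u_{\rm I})f(\bar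 u_{\rm I},\bar u_{\rm II})g(\bar v_{\rm II},\bar v_{\rm I})h(\bar u_{\rm I},\bar u_{\rm I})\lambda_2(\bar v_{\rm I})\,\mathbb T_{32}(\bar v_{\rm II})T_{21}(\bar u_{\rm II})\mathbb T_{31}(\bar u_{\rm I}),$$ $$\Psi_{a,b}(\bar u,\bar v)=\Omega^\dagger(-1)^{b(b-1)/2}\sum K_\ell(\bar v_{\rm I}|\bar u_{\rm I})f(\bar u_{\rm I},\bar u_{\rm II})g(\bar v_{\rm II},\bar v_{\rm I})\lambda_2(\bar u_{\rm I})\,T_{21}(\bar u_{\rm II})\mathbb T_{32}(\bar v_{\rm II})\mathbb T_{31}(\bar v_{\rm I}),$$ and in $Y(1|2)$, $$\widetilde\Psi_{a,b}(\bar u,\bar v)=\widetilde\Omega^\dagger(-1)^{b+a(a-1)/2}\sum g(\bar u_{\rm I},\bar v_{\rm I})f(\bar v_{\rm I},\bar v_{\rm II})g(\bar u_{\rm II},\bar u_{\rm I})h(\bar v_{\rm I},\bar v_{\rm I})\widetilde\lambda_2(\bar u_{\rm I})\,\widetilde{\mathbb T}_{21}(\bar u_{\rm II})\widetilde T_{32}(\bar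 v_{\rm II})\widetilde{\mathbb T}_{31}(\bar v_{\rm I}),$$ $$\widetilde\Psi_{a,b}(\bar u,\bar v)=\widetilde\Omega^\dagger(-1)^{b+a(a-1)/2}\sum K_\ell(\bar u_{\rm I}|\bar v_{\rm I})f(\bar v_{\rm I},\bar v_{\rm II})g(\bar u_{\rm II},\bar u_{\rm I})\widetilde\lambda_2(\bar v_{\rm I})\,\widetilde T_{32}(\bar v_{\rm II})\widetilde{\mathbb T}_{21}(\bar u_{\rm II})\widetilde{\mathbb T}_{31}(\bar u_{\rm I}).$$ The sums run over all partitions $\bar u\Rightarrow\{\bar u_{\rm I},\bar u_{\rm II}\}$, $\bar v\Rightarrow\{\bar v_{\rm I},\bar v_{\rm II}\}$ into ordered subsets with $\#\bar u_{\rm I}=\#\bar v_{\rm I}=\ell$, $0\le\ell\le\min(a,b)$. -/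

import Mathlib

noncomputable section

namespace SuperYangian

open scoped BigOperators

/-! ### The super-Yangian `Y(m|n)` -/

/-- The distinguished grading: `[i] = 0` for the first `m` indices and `[i] = 1` for the last `n`.
Indices are counted from `0`. -/
def par {m n : ℕ} (i : Fin (m + n)) : ℕ := if (i : ℕ) < m then 0 else 1

/-- `(-1)^k`. -/
def sg (k : ℕ) : ℂ := (-1) ^ k

/-- The free unital algebra on the modes `T_{ij}^{(p)}`, `p = 0, 1, 2, …`. -/
abbrev FreeModes (m n : ℕ) : Type := FreeAlgebra ℂ (Fin (m + n) × Fin (m + n) × ℕ)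

/-- The coefficient of `(c/u)^r` in `T_{ij}(u) = δ_{ij} + ∑_p T_{ij}^{(p)} (c/u)^{p+1}`,
in the free algebra. -/
def freeT {m n : ℕ} (i j : Fin (m + n)) : ℕ → FreeModes m n
  | 0 => if i = j then 1 else 0
  | p + 1 => FreeAlgebra.ι ℂ (i, j, p)

/-- The graded commutator of the coefficient of `(c/u)^r` in `T_{ij}(u)` and the coefficient of
`(c/v)^s` in `T_{kl}(v)`. -/
def freeComm {m n : ℕ} (i j : Fin (m + n)) (r : ℕ) (k l : Fin (m + n)) (s : ℕ) : FreeModes m n :=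
  freeT i j r * freeT k l s
    - sg ((par i + par j) * (par k + par l)) • (freeT k l s * freeT i j r)

/-- The defining relations, projected on matrix units and written mode by mode:
this is the coefficient of `(c/u)^r (c/v)^s` in
`((u - v)/c) [T_{ij}(u), T_{kl}(v)} =
  (-1)^{[l]([i]+[j])+[i][j]} (T_{il}(u) T_{kj}(v) - T_{il}(v) T_{kj}(u))`. -/
inductive Rel (m n : ℕ) : FreeModes m n → FreeModes m n → Prop
  | rtt (i j k l : Fin (m + n)) (r s : ℕ) :
      Rel m n (freeComm i j (r + 1) k l s - freeComm i j r k l (s + 1))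
        (sg (par l * (par i + par j) + par i * par j) •
          (freeT i l r * freeT k j s - freeT i l s * freeT k j r))

/-- The super-Yangian `Y(m|n)`, as an associative unital algebra over `ℂ`. -/
def Yang (m n : ℕ) : Type := RingQuot (Rel m n)

instance (m n : ℕ) : Ring (Yang m n) := inferInstanceAs (Ring (RingQuot (Rel m n)))
instance (m n : ℕ) : Algebra ℂ (Yang m n) := inferInstanceAs (Algebra ℂ (RingQuot (Rel m n)))

/-- The quotient map. -/
def toYang (m n : ℕ) : FreeModes m n →ₐ[ℂ] Yang m n := RingQuot.mkAlgHom ℂ (Rel m n)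

/-- The coefficient of `(c/u)^r` in `T_{ij}(u)`; thus `Tc i j 0 = δ_{ij}` and
`Tc i j (p+1) = T_{ij}^{(p)}`. -/
def Tc {m n : ℕ} (i j : Fin (m + n)) (r : ℕ) : Yang m n := toYang m n (freeT i j r)

/-- Algebra morphisms out of `Y(m|n)`. -/
def liftYang {m n : ℕ} {A : Type*} [Ring A] [Algebra ℂ A] (F : FreeModes m n →ₐ[ℂ] A)
    (hF : ∀ x y, Rel m n x y → F x = F y) : Yang m n →ₐ[ℂ] A :=
  RingQuot.liftAlgHom ℂ ⟨F, fun _ _ h => hF _ _ h⟩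

lemma liftYang_toYang {m n : ℕ} {A : Type*} [Ring A] [Algebra ℂ A] (F : FreeModes m n →ₐ[ℂ] A)
    (hF : ∀ x y, Rel m n x y → F x = F y) (x : FreeModes m n) :
    liftYang F hF (toYang m n x) = F x :=
  RingQuot.liftAlgHom_mkAlgHom_apply (S := ℂ) F (fun _ _ h => hF _ _ h) x

lemma toYang_rel {m n : ℕ} {x y : FreeModes m n} (h : Rel m n x y) :
    toYang m n x = toYang m n y := RingQuot.mkAlgHom_rel ℂ h

lemma yang_hom_ext {m n : ℕ} {A : Type*} [Ring A] [Algebra ℂ A] {F G : Yang m n →ₐ[ℂ] A}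
    (h : ∀ i j p, F (Tc i j (p + 1)) = G (Tc i j (p + 1))) : F = G := by
  apply RingQuot.ringQuot_ext' ℂ
  apply FreeAlgebra.hom_ext
  funext x
  obtain ⟨i, j, p⟩ := x
  exact h i j p

lemma par_cases {m n : ℕ} (i : Fin (m + n)) : par i = 0 ∨ par i = 1 := by
  unfold par; split <;> simp

/-! ### The grading and the transposition antimorphism -/

/-- The grading automorphism on the free algebra. -/
def freeGr (m n : ℕ) : FreeModes m n →ₐ[ℂ] Yang m n :=
  FreeAlgebra.lift ℂ fun x => sg (par x.1 + par x.2.1) • Tc x.1 x.2.1 (x.2.2 + 1)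

lemma freeGr_freeT {m n : ℕ} (i j : Fin (m + n)) (r : ℕ) :
    freeGr m n (freeT i j r) = sg (par i + par j) • Tc i j r := by
  cases r with
  | zero =>
    by_cases h : i = j
    · subst h
      rcases par_cases i with h | h <;> simp [freeT, Tc, sg, h]
    · simp [freeT, Tc, h]
  | succ p => simp [freeT, freeGr]

lemma Tc_rel {m n : ℕ} (i j k l : Fin (m + n)) (r s : ℕ) :
    (Tc i j (r + 1) * Tc k l s
        - sg ((par i + par j) * (par k + par l)) • (Tc k l s * Tc i j (r + 1)))
      - (Tc i j r * Tc k l (s + 1)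
        - sg ((par i + par j) * (par k + par l)) • (Tc k l (s + 1) * Tc i j r))
      = sg (par l * (par i + par j) + par i * par j) •
          (Tc i l r * Tc k j s - Tc i l s * Tc k j r) := by
  have h := toYang_rel (Rel.rtt i j k l r s)
  simpa [freeComm, Tc] using h

/-- The grading automorphism `gr` of `Y(m|n)`, which multiplies `T_{ij}^{(p)}` by
`(-1)^{[i]+[j]}`. An element `x` is even if `gr x = x` and odd if `gr x = -x`. -/
def gr (m n : ℕ) : Yang m n →ₐ[ℂ] Yang m n :=
  liftYang (freeGr m n) (by
    rintro _ _ ⟨i, j, k, l, r, s⟩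
    have h := Tc_rel i j k l r s
    simp only [freeComm, map_sub, map_smul, map_mul, freeGr_freeT]
    rcases par_cases i with hi | hi <;> rcases par_cases j with hj | hj <;>
      rcases par_cases k with hk | hk <;> rcases par_cases l with hl | hl <;>
      norm_num [hi, hj, hk, hl, sg] at h ⊢ <;>
      first
        | exact h
        | (rw [← sub_eq_zero] at h ⊢; rw [← neg_eq_zero, ← h]; abel1))

lemma gr_Tc {m n : ℕ} (i j : Fin (m + n)) (r : ℕ) :
    gr m n (Tc i j r) = sg (par i + par j) • Tc i j r := by
  rw [Tc, gr, liftYang_toYang, freeGr_freeT]; rfl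

lemma gr_gr {m n : ℕ} (x : Yang m n) : gr m n (gr m n x) = x := by
  have h : (gr m n).comp (gr m n) = AlgHom.id ℂ _ := by
    apply yang_hom_ext
    intro i j p
    rcases par_cases i with hi | hi <;> rcases par_cases j with hj | hj <;>
      simp [gr_Tc, sg, hi, hj]
  exact congrArg (fun F => F x) h

/-- The even part of an element of `Y(m|n)`. -/
def evenPart {m n : ℕ} (x : Yang m n) : Yang m n := (2⁻¹ : ℂ) • (x + gr m n x)

/-- The odd part of an element of `Y(m|n)`. -/
def oddPart {m n : ℕ} (x : Yang m n) : Yang m n := (2⁻¹ : ℂ) • (x - gr m n x)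

/-- The graded opposite of `Y(m|n)`: the same vector space with the product
`a ⋆ b = (-1)^{[a][b]} b a`, that is `a ⋆ b = b₀ a + b₁ gr(a)`, where `b₀` and `b₁` are the even
and the odd part of `b`. A graded antimorphism of `Y(m|n)` is an algebra morphism from `Y(m|n)`
to its graded opposite. -/
def GrOp (m n : ℕ) : Type := Yang m n

lemma gr_evenPart {m n : ℕ} (x : Yang m n) : gr m n (evenPart x) = evenPart x := by
  simp only [evenPart, map_smul, map_add, gr_gr]; rw [add_comm]

lemma gr_oddPart {m n : ℕ} (x : Yang m n) : gr m n (oddPart x) = -oddPart x := by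
  simp only [oddPart, map_smul, map_sub, gr_gr]; rw [← smul_neg, neg_sub]

lemma evenPart_add_oddPart {m n : ℕ} (x : Yang m n) : evenPart x + oddPart x = x := by
  simp only [evenPart, oddPart]; module

lemma even_odd_unique {m n : ℕ} {x e o : Yang m n} (h : x = e + o) (he : gr m n e = e)
    (ho : gr m n o = -o) : evenPart x = e ∧ oddPart x = o := by
  subst h
  simp only [evenPart, oddPart, map_add, he, ho]
  constructor <;> module

instance (m n : ℕ) : AddCommGroup (GrOp m n) := inferInstanceAs (AddCommGroup (Yang m n))
instance (m n : ℕ) : Module ℂ (GrOp m n) := inferInstanceAs (Module ℂ (Yang m n))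

/-- The graded opposite product. -/
def grMul {m n : ℕ} (a b : Yang m n) : Yang m n := evenPart b * a + oddPart b * gr m n a

lemma evenPart_grMul {m n : ℕ} (a b : Yang m n) :
    evenPart (grMul a b) = evenPart b * evenPart a - oddPart b * oddPart a ∧
      oddPart (grMul a b) = evenPart b * oddPart a + oddPart b * evenPart a := by
  apply even_odd_unique
  · conv_lhs => rw [grMul, ← evenPart_add_oddPart a]
    simp only [map_add, gr_evenPart, gr_oddPart]
    noncomm_ring
  · simp [gr_evenPart, gr_oddPart]
  · simp [gr_evenPart, gr_oddPart]; abel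

lemma grMul_assoc {m n : ℕ} (a b d : Yang m n) :
    grMul (grMul a b) d = grMul a (grMul b d) := by
  obtain ⟨h₁, h₂⟩ := evenPart_grMul b d
  rw [grMul, grMul, grMul, h₁, h₂]
  simp only [map_add, map_mul, gr_evenPart, gr_oddPart, gr_gr]
  noncomm_ring

lemma evenPart_add {m n : ℕ} (a b : Yang m n) :
    evenPart (a + b) = evenPart a + evenPart b ∧ oddPart (a + b) = oddPart a + oddPart b := by
  simp only [evenPart, oddPart, map_add]
  constructor <;> module

lemma evenPart_smul {m n : ℕ} (t : ℂ) (a : Yang m n) :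
    evenPart (t • a) = t • evenPart a ∧ oddPart (t • a) = t • oddPart a := by
  simp only [evenPart, oddPart, map_smul]
  constructor <;> module

lemma evenPart_one {m n : ℕ} : evenPart (1 : Yang m n) = 1 ∧ oddPart (1 : Yang m n) = 0 := by
  apply even_odd_unique <;> simp

lemma grMul_add {m n : ℕ} (a b d : Yang m n) : grMul a (b + d) = grMul a b + grMul a d := by
  simp only [grMul, evenPart_add]; noncomm_ring

lemma add_grMul {m n : ℕ} (a b d : Yang m n) : grMul (a + b) d = grMul a d + grMul b d := by
  simp only [grMul, map_add]; noncomm_ring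

lemma zero_grMul {m n : ℕ} (a : Yang m n) : grMul 0 a = 0 := by simp [grMul]

lemma grMul_zero {m n : ℕ} (a : Yang m n) : grMul a 0 = 0 := by
  simp [grMul, evenPart, oddPart]

lemma one_grMul {m n : ℕ} (a : Yang m n) : grMul 1 a = a := by
  simp [grMul, evenPart_add_oddPart]

lemma grMul_one {m n : ℕ} (a : Yang m n) : grMul a 1 = a := by simp [grMul, evenPart_one]

lemma smul_grMul {m n : ℕ} (t : ℂ) (a b : Yang m n) : grMul (t • a) b = t • grMul a b := by
  simp [grMul]

lemma grMul_smul {m n : ℕ} (t : ℂ) (a b : Yang m n) : grMul a (t • b) = t • grMul a b := by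
  simp [grMul, evenPart_smul]

instance (m n : ℕ) : Ring (GrOp m n) where
  __ := (inferInstance : AddCommGroup (GrOp m n))
  mul a b := grMul (m := m) (n := n) a b
  one := (1 : Yang m n)
  mul_assoc := grMul_assoc (m := m) (n := n)
  left_distrib := grMul_add (m := m) (n := n)
  right_distrib := add_grMul (m := m) (n := n)
  zero_mul := zero_grMul (m := m) (n := n)
  mul_zero := grMul_zero (m := m) (n := n)
  one_mul := one_grMul (m := m) (n := n)
  mul_one := grMul_one (m := m) (n := n)

instance (m n : ℕ) : Algebra ℂ (GrOp m n) :=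
  Algebra.ofModule (smul_grMul (m := m) (n := n)) (fun t a b => grMul_smul (m := m) (n := n) t a b)

/-- The identity map, from `Y(m|n)` to its graded opposite. -/
def toGrOp (m n : ℕ) : Yang m n ≃ₗ[ℂ] GrOp m n := LinearEquiv.refl ℂ (Yang m n)

lemma toGrOp_mul {m n : ℕ} (a b : Yang m n) :
    toGrOp m n a * toGrOp m n b = toGrOp m n (grMul a b) := rfl

lemma toGrOp_one {m n : ℕ} : toGrOp m n 1 = 1 := rfl

/-- The graded antimorphism on the free algebra, `T_{ij}^{(p)} ↦ (-1)^{[i][j]+[i]} T_{ji}^{(p)}`. -/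
def freePsi (m n : ℕ) : FreeModes m n →ₐ[ℂ] GrOp m n :=
  FreeAlgebra.lift ℂ fun x =>
    toGrOp m n (sg (par x.1 * par x.2.1 + par x.1) • Tc x.2.1 x.1 (x.2.2 + 1))

lemma freePsi_freeT {m n : ℕ} (i j : Fin (m + n)) (r : ℕ) :
    freePsi m n (freeT i j r) = toGrOp m n (sg (par i * par j + par i) • Tc j i r) := by
  cases r with
  | zero =>
    by_cases h : i = j
    · subst h
      rcases par_cases i with h | h <;> simp [freeT, Tc, sg, h, toGrOp_one]
    · simp [freeT, Tc, h, Ne.symm h]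
  | succ p => simp [freeT, freePsi]

lemma grMul_Tc {m n : ℕ} (i j k l : Fin (m + n)) (r s : ℕ) (t t' : ℂ) :
    grMul (t • Tc i j r) (t' • Tc k l s)
      = (t * t' * sg ((par i + par j) * (par k + par l))) • (Tc k l s * Tc i j r) := by
  simp only [grMul, evenPart, oddPart, map_smul, gr_Tc]
  rcases par_cases i with hi | hi <;> rcases par_cases j with hj | hj <;>
    rcases par_cases k with hk | hk <;> rcases par_cases l with hl | hl <;>
    simp only [hi, hj, hk, hl, sg, smul_mul_assoc, mul_smul_comm, add_mul, sub_mul] <;> module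

/-- The transposition map `ψ` of `Y(m|n)`, as an algebra morphism to the graded opposite:
it sends `T_{ij}^{(p)}` to `(-1)^{[i][j]+[i]} T_{ji}^{(p)}`. -/
def psiHom (m n : ℕ) : Yang m n →ₐ[ℂ] GrOp m n :=
  liftYang (freePsi m n) (by
    rintro _ _ ⟨i, j, k, l, r, s⟩
    have h := Tc_rel j i l k r s
    simp only [freeComm, map_sub (freePsi m n), map_smul (freePsi m n), map_mul (freePsi m n),
      freePsi_freeT, toGrOp_mul, grMul_Tc]
    simp only [← map_sub (toGrOp m n), ← map_smul (toGrOp m n)]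
    refine congrArg (toGrOp m n) ?_
    rcases par_cases i with hi | hi <;> rcases par_cases j with hj | hj <;>
      rcases par_cases k with hk | hk <;> rcases par_cases l with hl | hl <;>
      norm_num [hi, hj, hk, hl, sg] at h ⊢ <;>
      (rw [← sub_eq_zero] at h ⊢
       first
         | (rw [← h]; abel1)
         | (rw [← neg_eq_zero, ← h]; abel1)))

/-- The transposition map `ψ : Y(m|n) → Y(m|n)`, a linear map with
`ψ(x y) = (-1)^{[x][y]} ψ(y) ψ(x)` and `ψ(T_{ij}(u)) = (-1)^{[i][j]+[i]} T_{ji}(u)`. -/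
def psi (m n : ℕ) : Yang m n →ₗ[ℂ] Yang m n :=
  (toGrOp m n).symm.toLinearMap ∘ₗ (psiHom m n).toLinearMap

lemma psi_Tc {m n : ℕ} (i j : Fin (m + n)) (r : ℕ) :
    psi m n (Tc i j r) = sg (par i * par j + par i) • Tc j i r := by
  simp [psi, psiHom, Tc, liftYang_toYang, freePsi_freeT]

lemma psi_one (m n : ℕ) : psi m n 1 = 1 := by
  simp [psi, ← toGrOp_one]

lemma psi_mul {m n : ℕ} (x y : Yang m n) :
    psi m n (x * y) = grMul (psi m n x) (psi m n y) := by
  simp only [psi, LinearMap.comp_apply, AlgHom.toLinearMap_apply, map_mul]; rfl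

lemma gr_grMul {m n : ℕ} (a b : Yang m n) :
    gr m n (grMul a b) = grMul (gr m n a) (gr m n b) := by
  simp only [grMul, evenPart, oddPart, map_add, map_sub, map_mul, map_smul, gr_gr]

lemma toYang_surjective (m n : ℕ) : Function.Surjective (toYang m n) :=
  RingQuot.mkAlgHom_surjective ℂ (Rel m n)

lemma psi_gr {m n : ℕ} (x : Yang m n) : psi m n (gr m n x) = gr m n (psi m n x) := by
  obtain ⟨x, rfl⟩ := toYang_surjective m n x
  induction x using FreeAlgebra.induction with
  | grade0 t => simp [Algebra.algebraMap_eq_smul_one, psi_one]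
  | grade1 y =>
    obtain ⟨i, j, p⟩ := y
    change psi m n (gr m n (Tc i j (p + 1))) = gr m n (psi m n (Tc i j (p + 1)))
    simp only [gr_Tc, psi_Tc, map_smul, add_comm (par i) (par j)]
    rw [smul_comm]
  | mul a b ha hb => simp only [map_mul, psi_mul, ha, hb, gr_grMul]
  | add a b ha hb => simp only [map_add, ha, hb]

/-- `ψ(x y) = (-1)^{[x][y]} ψ(y) ψ(x)` for homogeneous `x` and `y`. -/
lemma psi_mul_homogeneous {m n : ℕ} {x y : Yang m n} {d e : ℕ} (hx : gr m n x = sg d • x)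
    (hy : gr m n y = sg e • y) :
    psi m n (x * y) = sg (d * e) • (psi m n y * psi m n x) := by
  rw [psi_mul, grMul, evenPart, oddPart, ← psi_gr, ← psi_gr, hx, hy]
  rcases Nat.even_or_odd d with hd | hd <;> rcases Nat.even_or_odd e with he | he <;>
    simp only [sg, pow_mul, hd.neg_one_pow, he.neg_one_pow, one_pow, map_smul, one_smul,
      smul_mul_assoc, mul_smul_comm, add_mul, sub_mul] <;> module

/-! ### Formal spectral parameters

Spectral parameters are independent formal variables, indexed by a finite linearly ordered set `σ`.
Scalars live in the field of iterated Laurent series in the inverses of the variables, that is, of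
Hahn series with exponents in `σ → ℤ`, ordered lexicographically; this field contains `ℂ(u, u', …)`.
The series `T_{ij}(u)` are Hahn series over `Y(m|n)` in the same variables. -/

/-- Exponents of monomials in the inverses of the variables. -/
abbrev Expo (σ : Type*) : Type _ := Lex (σ → ℤ)

/-- The field of scalars: iterated Laurent series in the inverses of the variables. -/
abbrev KK (σ : Type*) [LinearOrder σ] [Finite σ] : Type _ := HahnSeries (Expo σ) ℂ

/-- Iterated Laurent series with coefficients in `Y(m|n)`. -/
abbrev YY (m n : ℕ) (σ : Type*) [LinearOrder σ] [Finite σ] : Type _ :=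
  HahnSeries (Expo σ) (Yang m n)

section Params

variable {σ : Type*} [LinearOrder σ] [Finite σ] {m n : ℕ}

/-- The exponent of the monomial `u⁻¹`, for a variable `u`. -/
def ee (u : σ) : Expo σ := toLex (Pi.single u 1)

lemma ee_pos (u : σ) : 0 < ee u := by
  rw [ee, ← toLex_zero]
  exact Pi.toLex_strictMono (Pi.single_pos.2 one_pos)

/-- Substitution of `u⁻¹` in a power series with coefficients in a ring `A`, which need not be
commutative. -/
def substInv (A : Type*) [Semiring A] (u : σ) : PowerSeries A →+* HahnSeries (Expo σ) A :=
  (HahnSeries.embDomainRingHom (multiplesHom (Expo σ) (ee u))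
    (fun p q h => by
      simpa using (nsmul_left_strictMono (ee_pos u)).injective (by simpa using h))
    (fun p q => by
      simpa using (nsmul_left_strictMono (ee_pos u)).le_iff_le (a := p) (b := q))).comp
    (HahnSeries.toPowerSeries (R := A)).symm.toRingHom

/-- The variable `u` itself, as a scalar. -/
def spec (u : σ) : KK σ := HahnSeries.single (-(ee u)) 1

/-- `T_{ij}(u) = δ_{ij} + ∑_p T_{ij}^{(p)} (c/u)^{p+1}`. -/
def T (c : ℂ) (i j : Fin (m + n)) (u : σ) : YY m n σ :=
  substInv (Yang m n) u (PowerSeries.mk fun r => c ^ r • Tc i j r)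

/-- The scalar series `∑_r l_r (c/u)^r`. -/
def series (c : ℂ) (l : ℕ → ℂ) (u : σ) : KK σ :=
  substInv ℂ u (PowerSeries.mk fun r => c ^ r * l r)

/-- Multiplication of a series over `Y(m|n)` by a scalar series. -/
def scal (k : KK σ) (X : YY m n σ) : YY m n σ := k.map (algebraMap ℂ (Yang m n)) * X

/-- `g(u,v) = c/(u-v)`. -/
def g (c : ℂ) (u v : σ) : KK σ := HahnSeries.C c / (spec u - spec v)

/-- `f(u,v) = 1 + g(u,v)`. -/
def f (c : ℂ) (u v : σ) : KK σ := 1 + g c u v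

/-- `h(u,v) = (u-v+c)/c`. -/
def h (c : ℂ) (u v : σ) : KK σ := (spec u - spec v + HahnSeries.C c) / HahnSeries.C c

/-- Products of a function of two variables over two ordered sets, such as `f(ū, v̄)`. -/
def prod2 (F : σ → σ → KK σ) (A B : List σ) : KK σ :=
  (A.map fun x => (B.map fun y => F x y).prod).prod

/-- `H(w̄) = ∏_{k<j} h(w_j, w_k)`. -/
def HH (c : ℂ) : List σ → KK σ
  | [] => 1
  | x :: t => prod2 (h c) t [x] * HH c t

/-- `K_ℓ(v̄|ū) = Δ_ℓ(v̄) Δ'_ℓ(ū) h(v̄,ū) det_ℓ (g(v_j,u_k)/h(v_j,u_k))`, where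
`Δ_ℓ(v̄) = ∏_{j>k} g(v_j,v_k)` and `Δ'_ℓ(ū) = ∏_{j>k} g(u_k,u_j)`. -/
def Kfun (c : ℂ) {l : ℕ} (v u : Fin l → σ) : KK σ :=
  (∏ j : Fin l, ∏ k ∈ Finset.Iio j, g c (v j) (v k)) *
  (∏ j : Fin l, ∏ k ∈ Finset.Iio j, g c (u k) (u j)) *
  (∏ j : Fin l, ∏ k : Fin l, h c (v j) (u k)) *
  Matrix.det (Matrix.of fun j k : Fin l => g c (v j) (u k) / h c (v j) (u k))

/-- `K_ℓ` for ordered sets of the same cardinality `ℓ`. -/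
def K (c : ℂ) (v u : List σ) : KK σ :=
  if e : v.length = u.length then Kfun c v.get (fun k => u.get (Fin.cast e k)) else 0

/-- The value of `λ` on an ordered set, `λ(ū) = ∏ λ(u_j)`. -/
def lamProd (c : ℂ) (l : ℕ → ℂ) (A : List σ) : KK σ := (A.map (series c l)).prod

/-! ### The super-trace formula for Bethe vectors -/

/-- Multi-indices for `N` copies of the auxiliary space. -/
abbrev MIdx (m n N : ℕ) : Type := Fin N → Fin (m + n)

/-- Elements `∑_{I,J} E_{IJ} ⊗ A_{IJ}` of the graded tensor product of `N` copies of
`End(ℂ^{m|n})` and of the series over `Y(m|n)`, where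
`E_{IJ} = E_{I₁J₁} ⊗ ⋯ ⊗ E_{I_N J_N}`. -/
abbrev SMat (m n N : ℕ) (σ : Type*) [LinearOrder σ] [Finite σ] : Type _ :=
  MIdx m n N → MIdx m n N → YY m n σ

/-- The degree of `E_{IJ}`. -/
def degE {N : ℕ} (I J : MIdx m n N) : ℕ := ∑ p, (par (I p) + par (J p))

/-- The sign in `E_{IJ} E_{JL} = ± E_{IL}`: for `p < q` the factor `E_{I_q J_q}` moves past
`E_{J_p L_p}`. -/
def signE {N : ℕ} (I J L : MIdx m n N) : ℂ :=
  sg (∑ p : Fin N, ∑ q ∈ Finset.Ioi p,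
    (par (I q) + par (J q)) * (par (J p) + par (L p)))

/-- The grading automorphism, on series. -/
def grY (X : YY m n σ) : YY m n σ := X.map (gr m n)

/-- The product of the graded tensor product:
`(E_{IJ} ⊗ x)(E_{JL} ⊗ y) = (-1)^{[x][E_{JL}]} E_{IJ} E_{JL} ⊗ x y`. -/
def sMul {N : ℕ} (A B : SMat m n N σ) : SMat m n N σ := fun I L =>
  ∑ J : MIdx m n N, signE I J L • (grY^[degE J L] (A I J) * B J L)

/-- The unit. -/
def sOne {N : ℕ} : SMat m n N σ := fun I J => if I = J then 1 else 0

/-- Ordered products. -/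
def sProd {N : ℕ} (l : List (SMat m n N σ)) : SMat m n N σ := l.foldr sMul sOne

/-- The super-trace over all the auxiliary spaces, `str E_{ij} = (-1)^{[j]} δ_{ij}`. -/
def str {N : ℕ} (A : SMat m n N σ) : YY m n σ := ∑ I : MIdx m n N, sg (∑ p, par (I p)) • A I I

/-- `E_{ij}^{(p)}`: the matrix unit `E_{ij}` in the `p`-th auxiliary space. -/
def auxE {N : ℕ} (p : Fin N) (i j : Fin (m + n)) : SMat m n N σ := fun I J =>
  if I p = i ∧ J p = j ∧ ∀ q, q ≠ p → I q = J q then 1 else 0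

/-- `T_p(u) = ∑_{i,j} E_{ij}^{(p)} ⊗ T_{ij}(u)`. -/
def auxT {N : ℕ} (c : ℂ) (p : Fin N) (u : σ) : SMat m n N σ := fun I J =>
  if ∀ q, q ≠ p → I q = J q then T c (I p) (J p) u else 0

/-- The graded permutation `P_{pq} = ∑_{i,j} (-1)^{[j]} E_{ij}^{(p)} E_{ji}^{(q)}`. -/
def perm {N : ℕ} (p q : Fin N) : SMat m n N σ := fun I J =>
  ∑ i : Fin (m + n), ∑ j : Fin (m + n), sg (par j) • sMul (auxE p i j) (auxE q j i) I J

/-- `R_{pq}(z,w) = 1 + g(z,w) P_{pq}`. -/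
def Rmat {N : ℕ} (c : ℂ) (p q : Fin N) (z w : σ) : SMat m n N σ := fun I J =>
  sOne I J + scal (g c z w) (perm p q I J)

/-- The super-trace
`str_{1…a+b} [T_1(u_1)⋯T_a(u_a) T_{a+1}(v_1)⋯T_{a+b}(v_b) ℝ
  E_{21}^{(1)}⋯E_{21}^{(a)} E_{32}^{(a+1)}⋯E_{32}^{(a+b)}]`,
with `ℝ = (R_{a+1,a}⋯R_{a+1,1})⋯(R_{a+b,a}⋯R_{a+b,1})` and `R_{a+j,k} = R_{a+j,k}(v_j,u_k)`.
The indices `1, 2, 3` are the arguments `i₁ i₂ i₃`. -/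
def strFormula (i₁ i₂ i₃ : Fin (m + n)) (c : ℂ) {a b : ℕ} (u : Fin a → σ) (v : Fin b → σ) :
    YY m n σ :=
  str (sProd (N := a + b)
    (List.ofFn (fun k => auxT c (Fin.castAdd b k) (u k)) ++
      List.ofFn (fun j => auxT c (Fin.natAdd a j) (v j)) ++
      (List.ofFn fun j => (List.ofFn fun k =>
        Rmat c (Fin.natAdd a j) (Fin.castAdd b k) (v j) (u k)).reverse).flatten ++
      List.ofFn (fun k => auxE (Fin.castAdd b k) i₂ i₁) ++
      List.ofFn (fun j => auxE (Fin.natAdd a j) i₃ i₂)))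

/-- The operator of the `Y(2|1)` Bethe vector: `Φ_{a,b}(ū,v̄)` is this operator applied to `Ω`. -/
def betheOp21 (c : ℂ) {a b : ℕ} (u : Fin a → σ) (v : Fin b → σ) : YY 2 1 σ :=
  scal ((-1) ^ b / HH c (List.ofFn v)) (strFormula 0 1 2 c u v)

/-- The operator of the `Y(1|2)` Bethe vector. -/
def betheOp12 (c : ℂ) {a b : ℕ} (u : Fin a → σ) (v : Fin b → σ) : YY 1 2 σ :=
  scal ((-1) ^ a / HH c (List.ofFn u)) (strFormula 0 1 2 c u v)

/-! ### Highest weight representations, Bethe vectors and dual Bethe vectors -/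

/-- `Ω` is a singular vector of weight `λ`: `T_{ii}(u) Ω = λ_i(u) Ω` and `T_{ij}(u) Ω = 0` for
`i > j`, where `λ_i(u) = ∑_r λ_{i,r} (c/u)^r`. (Since `T_{ii}(u) = 1 + ⋯`, one has `λ_{i,0} = 1`
as soon as `Ω ≠ 0`.) -/
structure IsSingular (m n : ℕ) {M : Type*} [AddCommGroup M] [Module (Yang m n) M] (Ω : M)
    (lam : Fin (m + n) → ℕ → ℂ) : Prop where
  diag : ∀ i r, Tc i i r • Ω = algebraMap ℂ (Yang m n) (lam i r) • Ω
  lower : ∀ i j r, j < i → (Tc i j r : Yang m n) • Ω = 0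

/-- The transposition map on representations: an additive map `τ` (written `ψ` as well) from a
representation to a right module, with `ψ(x Ω) = ψ(Ω) ψ(x)`; here `Ω† = τ Ω`. -/
def IsTransposition (m n : ℕ) {M W : Type*} [AddCommGroup M] [Module (Yang m n) M] [AddCommGroup W]
    [Module (Yang m n)ᵐᵒᵖ W] (Ω : M) (τ : M →+ W) : Prop :=
  ∀ x : Yang m n, τ (x • Ω) = MulOpposite.op (psi m n x) • τ Ω

/-- The relations imposed on `Ω†` in the universal dual of a representation. -/
def dualRel {M : Type*} [AddCommGroup M] [Module (Yang m n) M] (Ω : M) :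
    Submodule (Yang m n)ᵐᵒᵖ (Yang m n)ᵐᵒᵖ :=
  Submodule.span _ {y | ∃ x : Yang m n, x • Ω = 0 ∧ y = MulOpposite.op (psi m n x)}

/-- Every representation generated by `Ω` has a transposition map, to its universal dual. -/
lemma exists_transposition {M : Type*} [AddCommGroup M] [Module (Yang m n) M] (Ω : M)
    (hΩ : ∀ y : M, ∃ x : Yang m n, x • Ω = y) :
    ∃ τ : M →+ ((Yang m n)ᵐᵒᵖ ⧸ dualRel (m := m) (n := n) Ω), IsTransposition m n Ω τ ∧
      τ Ω = (dualRel (m := m) (n := n) Ω).mkQ 1 := by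
  classical
  choose F hF using hΩ
  have key : ∀ x x' : Yang m n, x • Ω = x' • Ω →
      (dualRel (m := m) (n := n) Ω).mkQ (MulOpposite.op (psi m n x)) =
        (dualRel (m := m) (n := n) Ω).mkQ (MulOpposite.op (psi m n x')) := by
    intro x x' hx
    rw [← sub_eq_zero, ← map_sub, Submodule.mkQ_apply, Submodule.Quotient.mk_eq_zero]
    refine Submodule.subset_span ⟨x - x', by rw [sub_smul, hx, sub_self], by simp⟩
  refine ⟨AddMonoidHom.mk' (fun y => (dualRel (m := m) (n := n) Ω).mkQ
    (MulOpposite.op (psi m n (F y)))) ?_, ?_, ?_⟩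
  · intro y z
    rw [← map_add, ← MulOpposite.op_add, ← map_add]
    exact key _ _ (by rw [hF, add_smul, hF, hF])
  · intro x
    simp only [AddMonoidHom.mk'_apply]
    rw [key (F (x • Ω)) x (hF _), key (F Ω) 1 (by rw [hF, one_smul]), psi_one, ← map_smul]
    simp
  · simp only [AddMonoidHom.mk'_apply]
    rw [key (F Ω) 1 (by rw [hF, one_smul]), psi_one]
    simp

/-- `x ↦ x Ω`. -/
def ketHom {M : Type*} [AddCommGroup M] [Module (Yang m n) M] (Ω : M) : Yang m n →+ M where
  toFun x := x • Ω
  map_zero' := zero_smul _ _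
  map_add' x y := add_smul x y Ω

/-- `x ↦ Ω† x`. -/
def braHom {W : Type*} [AddCommGroup W] [Module (Yang m n)ᵐᵒᵖ W] (ω : W) : Yang m n →+ W where
  toFun x := MulOpposite.op x • ω
  map_zero' := by simp
  map_add' x y := by simp [add_smul]

/-- `X Ω`, coefficient by coefficient. -/
def ket {M : Type*} [AddCommGroup M] [Module (Yang m n) M] (Ω : M) (X : YY m n σ) :
    HahnSeries (Expo σ) M := X.map (ketHom Ω)

/-- `Ω† X`, coefficient by coefficient. -/
def bra {W : Type*} [AddCommGroup W] [Module (Yang m n)ᵐᵒᵖ W] (ω : W) (X : YY m n σ) :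
    HahnSeries (Expo σ) W := X.map (braHom ω)

/-- The `Y(2|1)` Bethe vector `Φ_{a,b}(ū,v̄)`. -/
def Phi21 {M : Type*} [AddCommGroup M] [Module (Yang 2 1) M] (c : ℂ) (Ω : M) {a b : ℕ}
    (u : Fin a → σ) (v : Fin b → σ) : HahnSeries (Expo σ) M := ket Ω (betheOp21 c u v)

/-- The `Y(1|2)` Bethe vector. -/
def Phi12 {M : Type*} [AddCommGroup M] [Module (Yang 1 2) M] (c : ℂ) (Ω : M) {a b : ℕ}
    (u : Fin a → σ) (v : Fin b → σ) : HahnSeries (Expo σ) M := ket Ω (betheOp12 c u v)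

/-- The `Y(2|1)` dual Bethe vector `Ψ_{a,b}(ū,v̄) = ψ(Φ_{a,b}(ū*,v̄*))`, where `w̄*` is `w̄` in the
reverse order. -/
def Psi21 {M W : Type*} [AddCommGroup M] [Module (Yang 2 1) M] [AddCommGroup W] (c : ℂ) (Ω : M)
    (τ : M →+ W) {a b : ℕ} (u : Fin a → σ) (v : Fin b → σ) : HahnSeries (Expo σ) W :=
  (Phi21 c Ω (u ∘ Fin.rev) (v ∘ Fin.rev)).map τ

/-- The `Y(1|2)` dual Bethe vector. -/
def Psi12 {M W : Type*} [AddCommGroup M] [Module (Yang 1 2) M] [AddCommGroup W] (c : ℂ) (Ω : M)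
    (τ : M →+ W) {a b : ℕ} (u : Fin a → σ) (v : Fin b → σ) : HahnSeries (Expo σ) W :=
  (Phi12 c Ω (u ∘ Fin.rev) (v ∘ Fin.rev)).map τ

/-! ### The explicit expressions -/

/-- The ordered product `T_{ij}(w_1) T_{ij}(w_2) ⋯`. -/
def TP (c : ℂ) (i j : Fin (m + n)) (A : List σ) : YY m n σ := (A.map (T c i j)).prod

/-- `𝕋_{ij}(w̄) = H(w̄*)⁻¹ T_{ij}(w_1) T_{ij}(w_2) ⋯`, the normalised product which enters dual
Bethe vectors. -/
def TTdual (c : ℂ) (i j : Fin (m + n)) (A : List σ) : YY m n σ :=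
  scal (HH c A.reverse)⁻¹ (TP c i j A)

/-- The ordered subset of `w̄` with positions in `S`. -/
def subList {a : ℕ} (w : Fin a → σ) (S : Finset (Fin a)) : List σ :=
  ((List.finRange a).filter (· ∈ S)).map w

/-- The sum over partitions `ū ⇒ {ū_I, ū_II}` and `v̄ ⇒ {v̄_I, v̄_II}` with `#ū_I = #v̄_I`. -/
def partSum {a b : ℕ} (u : Fin a → σ) (v : Fin b → σ)
    (F : List σ → List σ → List σ → List σ → YY m n σ) : YY m n σ :=
  ∑ S : Finset (Fin a), ∑ R ∈ Finset.univ.filter (fun R : Finset (Fin b) => R.card = S.card),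
    F (subList u S) (subList u Sᶜ) (subList v R) (subList v Rᶜ)

/-- First expression in `Y(2|1)`, with
`g(v̄_I,ū_I) f(ū_I,ū_II) g(v̄_II,v̄_I) h(ū_I,ū_I) λ₂(v̄_I) 𝕋₃₂(v̄_II) T₂₁(ū_II) 𝕋₃₁(ū_I)`. -/
def dualA21 (c : ℂ) (lam₂ : ℕ → ℂ) {a b : ℕ} (u : Fin a → σ) (v : Fin b → σ) : YY 2 1 σ :=
  sg (b * (b - 1) / 2) • partSum u v fun uI uII vI vII =>
    scal (prod2 (g c) vI uI * prod2 (f c) uI uII * prod2 (g c) vII vI * prod2 (h c) uI uI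
        * lamProd c lam₂ vI)
      (TTdual c 2 1 vII * TP c 1 0 uII * TTdual c 2 0 uI)

/-- Second expression in `Y(2|1)`, with
`K_ℓ(v̄_I|ū_I) f(ū_I,ū_II) g(v̄_II,v̄_I) λ₂(ū_I) T₂₁(ū_II) 𝕋₃₂(v̄_II) 𝕋₃₁(v̄_I)`. -/
def dualB21 (c : ℂ) (lam₂ : ℕ → ℂ) {a b : ℕ} (u : Fin a → σ) (v : Fin b → σ) : YY 2 1 σ :=
  sg (b * (b - 1) / 2) • partSum u v fun uI uII vI vII =>
    scal (K c vI uI * prod2 (f c) uI uII * prod2 (g c) vII vI * lamProd c lam₂ uI)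
      (TP c 1 0 uII * TTdual c 2 1 vII * TTdual c 2 0 vI)

/-- First expression in `Y(1|2)`, with
`g(ū_I,v̄_I) f(v̄_I,v̄_II) g(ū_II,ū_I) h(v̄_I,v̄_I) λ₂(ū_I) 𝕋₂₁(ū_II) T₃₂(v̄_II) 𝕋₃₁(v̄_I)`. -/
def dualA12 (c : ℂ) (lam₂ : ℕ → ℂ) {a b : ℕ} (u : Fin a → σ) (v : Fin b → σ) : YY 1 2 σ :=
  sg (b + a * (a - 1) / 2) • partSum u v fun uI uII vI vII =>
    scal (prod2 (g c) uI vI * prod2 (f c) vI vII * prod2 (g c) uII uI * prod2 (h c) vI vI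
        * lamProd c lam₂ uI)
      (TTdual c 1 0 uII * TP c 2 1 vII * TTdual c 2 0 vI)

/-- Second expression in `Y(1|2)`, with
`K_ℓ(ū_I|v̄_I) f(v̄_I,v̄_II) g(ū_II,ū_I) λ₂(v̄_I) T₃₂(v̄_II) 𝕋₂₁(ū_II) 𝕋₃₁(ū_I)`. -/
def dualB12 (c : ℂ) (lam₂ : ℕ → ℂ) {a b : ℕ} (u : Fin a → σ) (v : Fin b → σ) : YY 1 2 σ :=
  sg (b + a * (a - 1) / 2) • partSum u v fun uI uII vI vII =>
    scal (K c uI vI * prod2 (f c) vI vII * prod2 (g c) uII uI * lamProd c lam₂ vI)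
      (TP c 2 1 vII * TTdual c 1 0 uII * TTdual c 2 0 uI)

end Params

end SuperYangian

end

namespace SuperYangian

/-! ### Ordered words in two kinds of letters -/

section Words

variable {σ F N : Type*} [Field F] [AddCommGroup N] [Module F N]

/-- Exchange weights on a set of parameters: `γ` is antisymmetric and satisfies the three term
relation of `1/(x-y)`, and `a`, `ν` factorise `1 + γ` and `ε + γ`. -/
structure IsWeights (D : Set σ) (γ ν a : σ → σ → F) (ε : F) : Prop where
  anti : ∀ x y, γ x y = -γ y x
  arnold : ∀ {x y z}, x ∈ D → y ∈ D → z ∈ D → x ≠ y → y ≠ z → x ≠ z →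
    γ x y * γ y z = γ x z * (γ x y + γ y z)
  norm_ne : ∀ {x y}, x ∈ D → y ∈ D → x ≠ y → ν x y ≠ 0
  fac : ∀ {x y}, x ∈ D → y ∈ D → x ≠ y → a x y * ν x y = 1 + γ x y
  fac' : ∀ {x y}, x ∈ D → y ∈ D → x ≠ y → a x y * ν y x = ε + γ x y

/-- The word of letters `C` with parameters `v`. -/
def cWord (v : List σ) : List (σ × Bool) := v.map fun x => (x, true)

/-- `∏_{k<j} ν(w_j, w_k)`. -/
def pairNorm (ν : σ → σ → F) : List σ → F
  | [] => 1
  | x :: t => (t.map fun y => ν y x).prod * pairNorm ν t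

/-- Exchange relations of the letters `A(z) = (z, false)` and `C(z) = (z, true)`:
`A(z)C(w) = t((1-γ(z,w)) C(w)A(z) + γ(z,w) C(z)A(w))` and `ν(z,w)C(z)C(w) = ν(w,z)C(w)C(z)`. -/
structure IsExchange (D : Set σ) (γ ν : σ → σ → F) (t : F) (W : List (σ × Bool) → N) : Prop where
  ac : ∀ {z w} (l l'), z ∈ D → w ∈ D → z ≠ w →
    W (l ++ (z, false) :: (w, true) :: l') = (t * (1 - γ z w)) • W (l ++ (w, true) :: (z, false) :: l')
      + (t * γ z w) • W (l ++ (z, true) :: (w, false) :: l')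
  cc : ∀ {z w} (l l'), z ∈ D → w ∈ D → z ≠ w →
    ν z w • W (l ++ (z, true) :: (w, true) :: l') = ν w z • W (l ++ (w, true) :: (z, true) :: l')

lemma IsExchange.cons {D : Set σ} {γ ν : σ → σ → F} {t : F} {W : List (σ × Bool) → N}
    (h : IsExchange D γ ν t W) (p : σ × Bool) : IsExchange D γ ν t fun l => W (p :: l) :=
  ⟨fun l l' => h.ac (p :: l) l', fun l l' => h.cc (p :: l) l'⟩

/-- `ν(z,w)C(z)C(w) = ν(w,z)C(w)C(z)`. -/
def IsTwisted (D : Set σ) (ν : σ → σ → F) (W : List (σ × Bool) → N) : Prop :=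
  ∀ {z w} (l l'), z ∈ D → w ∈ D → z ≠ w →
    ν z w • W (l ++ (z, true) :: (w, true) :: l') = ν w z • W (l ++ (w, true) :: (z, true) :: l')

/-- The normalised value of a word of letters `C`. -/
def normWord (ν : σ → σ → F) (W : List (σ × Bool) → N) (v : List σ) : N :=
  (pairNorm ν v)⁻¹ • W (cWord v)

lemma normWord_cons (ν : σ → σ → F) (W : List (σ × Bool) → N) (x : σ) (v : List σ) :
    normWord ν W (x :: v) =
      (v.map fun y => ν y x).prod⁻¹ • normWord ν (fun l => W ((x, true) :: l)) v := by
  simp only [normWord, pairNorm, cWord, List.map_cons, mul_inv, mul_smul]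

lemma normWord_perm {D : Set σ} {ν : σ → σ → F}
    (hν : ∀ {x y}, x ∈ D → y ∈ D → x ≠ y → ν x y ≠ 0)
    {v v' : List σ} (hp : v.Perm v') (hv : v.Nodup) (hD : ∀ x ∈ v, x ∈ D)
    {W : List (σ × Bool) → N} (h : IsTwisted D ν W) :
    normWord ν W v = normWord ν W v' := by
  induction hp generalizing W with
  | nil => rfl
  | cons x p ih =>
    simp only [List.nodup_cons, List.mem_cons, forall_eq_or_imp] at hv hD
    rw [normWord_cons, normWord_cons, ih hv.2 hD.2 (fun l l' => h ((x, true) :: l) l'),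
      (p.map _).prod_eq]
  | swap x y l =>
    simp only [List.nodup_cons, List.mem_cons, forall_eq_or_imp, not_or] at hv hD
    have h0 := h [] (cWord l) hD.2.1 hD.1 (Ne.symm hv.1.1)
    have h1 := hν hD.1 hD.2.1 hv.1.1
    have h2 := hν hD.2.1 hD.1 (Ne.symm hv.1.1)
    simp only [List.nil_append] at h0
    have h3 : W ((y, true) :: (x, true) :: cWord l) =
        ((ν y x)⁻¹ * ν x y) • W ((x, true) :: (y, true) :: cWord l) := by
      rw [mul_smul, h0, smul_smul, inv_mul_cancel₀ h1, one_smul]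
    simp only [normWord, pairNorm, List.map_cons, List.prod_cons, cWord] at h3 ⊢
    rw [h3, smul_smul]
    congr 1
    field_simp
  | trans p q ih ih' =>
    rw [ih hv hD h, ih' (p.nodup_iff.1 hv) (fun x hx => hD x (p.mem_iff.2 hx)) h]

lemma IsWeights.swap {D : Set σ} {γ ν a : σ → σ → F} {ε : F} (hw : IsWeights D γ ν a ε) {x z : σ}
    (hx : x ∈ D) (hz : z ∈ D) (h : x ≠ z) :
    (1 - γ z x) * ν z x = (ε + γ x z) * ν x z := by
  rw [← hw.fac' hx hz h, hw.anti z x, sub_neg_eq_add, ← hw.fac hx hz h]; ring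

/-- Moving a letter `A` through a word of letters `C`. -/
lemma IsExchange.move [DecidableEq σ] {D : Set σ} {γ ν a : σ → σ → F} {ε t : F}
    (hw : IsWeights D γ ν a ε) {v : List σ} (hv : v.Nodup) (hD : ∀ x ∈ v, x ∈ D) {z : σ}
    (hz : z ∈ D) (hzv : z ∉ v) {W : List (σ × Bool) → N} (h : IsExchange D γ ν t W) :
    (pairNorm ν v)⁻¹ • W ((z, false) :: cWord v) =
      (t ^ v.length * (v.map fun k => 1 + γ k z).prod) •
          (pairNorm ν v)⁻¹ • W (cWord v ++ [(z, false)]) +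
        (v.map fun j => (t ^ v.length * γ z j * ((v.erase j).map fun k => a k j).prod) •
          (pairNorm ν (v.erase j))⁻¹ • W ((z, true) :: (cWord (v.erase j) ++ [(j, false)]))).sum := by
  induction v generalizing z W with
  | nil => simp [cWord, pairNorm]
  | cons x s ih =>
    simp only [List.nodup_cons, List.mem_cons, forall_eq_or_imp, not_or] at hv hD hzv
    obtain ⟨hxs, hs⟩ := hv
    obtain ⟨hx, hD⟩ := hD
    have hac := h.ac [] (cWord s) hz hx hzv.1
    have e1 := ih hs hD hz hzv.2 (h.cons (x, true))
    have e2 := ih hs hD hx hxs (h.cons (z, true))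
    have hn : (s.map fun k => ν k x).prod ≠ 0 := by
      refine List.prod_ne_zero ?_
      simp only [List.mem_map, not_exists, not_and]
      exact fun y hy => hw.norm_ne (hD y hy) hx (by rintro rfl; exact hxs hy)
    have hfac : (s.map fun k => 1 + γ k x).prod =
        (s.map fun k => a k x).prod * (s.map fun k => ν k x).prod := by
      rw [← List.prod_map_mul]
      congr 1
      exact List.map_congr_left fun y hy =>
        (hw.fac (hD y hy) hx (by rintro rfl; exact hxs hy)).symm
    rw [show cWord (x :: s) = (x, true) :: cWord s from rfl]
    simp only [List.nil_append] at hac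
    set n := (s.map fun k => ν k x).prod with hn_def
    have hL : (pairNorm ν (x :: s))⁻¹ • W ((z, false) :: (x, true) :: cWord s) =
        (t * (1 - γ z x) * n⁻¹) • (pairNorm ν s)⁻¹ • W ((x, true) :: (z, false) :: cWord s) +
        (t * γ z x * n⁻¹) • (pairNorm ν s)⁻¹ • W ((z, true) :: (x, false) :: cWord s) := by
      rw [hac, pairNorm, ← hn_def, mul_inv]; module
    have hsum : (s.map fun j => (t ^ (s.length + 1) * γ z j *
          (((x :: s).erase j).map fun k => a k j).prod) • (pairNorm ν ((x :: s).erase j))⁻¹ •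
            W ((z, true) :: (cWord ((x :: s).erase j) ++ [(j, false)]))).sum =
        (t * (1 - γ z x) * n⁻¹) • (s.map fun j => (t ^ s.length * γ z j *
          ((s.erase j).map fun k => a k j).prod) • (pairNorm ν (s.erase j))⁻¹ •
            W ((x, true) :: (z, true) :: (cWord (s.erase j) ++ [(j, false)]))).sum +
        (t * γ z x * n⁻¹) • (s.map fun j => (t ^ s.length * γ x j *
          ((s.erase j).map fun k => a k j).prod) • (pairNorm ν (s.erase j))⁻¹ •
            W ((z, true) :: (x, true) :: (cWord (s.erase j) ++ [(j, false)]))).sum := by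
      rw [List.smul_sum, List.smul_sum, List.map_map, List.map_map, ← List.sum_map_add]
      congr 1
      refine List.map_congr_left fun j hj => ?_
      have hxj : x ≠ j := by rintro rfl; exact hxs hj
      have hzj : z ≠ j := by rintro rfl; exact hzv.2 hj
      have hjD := hD j hj
      have hcc := h.cc [] (cWord (s.erase j) ++ [(j, false)]) hz hx hzv.1
      have n1 := hw.norm_ne hx hz (Ne.symm hzv.1)
      have n2 := hw.norm_ne hjD hx (Ne.symm hxj)
      have hcc' : W ((x, true) :: (z, true) :: (cWord (s.erase j) ++ [(j, false)])) =
          ((ν x z)⁻¹ * ν z x) • W ((z, true) :: (x, true) :: (cWord (s.erase j) ++ [(j, false)])) := by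
        simp only [List.nil_append] at hcc
        rw [mul_smul, hcc, smul_smul, inv_mul_cancel₀ n1, one_smul]
      have hnj : n = ν j x * ((s.erase j).map fun k => ν k x).prod := by
        rw [hn_def, ← List.prod_cons, ← List.map_cons (f := fun k => ν k x)]
        exact ((List.perm_cons_erase hj).map _).prod_eq
      simp only [Function.comp_apply]
      rw [List.erase_cons_tail (by simpa using hxj), hcc', pairNorm, hnj]
      simp only [List.map_cons, List.prod_cons, cWord, List.cons_append, mul_inv]
      rw [hnj] at hn
      have n3 := right_ne_zero_of_mul hn
      have key : γ z j * a x j * ν j x = (1 - γ z x) * ((ν x z)⁻¹ * ν z x) * γ z j + γ z x * γ x j := by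
        have h1 := hw.swap hx hz (Ne.symm hzv.1)
        have h2 := hw.fac' hx hjD hxj
        have h3 := hw.arnold hz hx hjD hzv.1 hxj hzj
        have h4 := hw.anti x z
        have h5 : (1 - γ z x) * ((ν x z)⁻¹ * ν z x) = ε + γ x z := by
          rw [mul_left_comm, h1]; field_simp
        rw [h5, mul_assoc, h2, h3, h4]; ring
      have key' : t ^ (s.length + 1) * γ z j * a x j =
          (t * (1 - γ z x) * ((ν x z)⁻¹ * ν z x) * t ^ s.length * γ z j
            + t * γ z x * t ^ s.length * γ x j) * (ν j x)⁻¹ := by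
        field_simp
        have : (t ^ (s.length + 1) * γ z j * a x j * ν j x) = t ^ (s.length + 1) *
          ((1 - γ z x) * ((ν x z)⁻¹ * ν z x) * γ z j + γ z x * γ x j) := by rw [← key]; ring
        field_simp at this ⊢
        linear_combination this
      simp only [smul_smul, ← add_smul]
      congr 1
      linear_combination (((s.erase j).map fun k => a k j).prod *
        ((s.erase j).map fun k => ν k x).prod⁻¹ * (pairNorm ν (s.erase j))⁻¹) * key'
    rw [hL, e1, e2]
    simp only [List.map_cons, List.prod_cons, List.sum_cons, List.erase_cons_head,
      List.cons_append, List.length_cons] at hsum ⊢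
    rw [hsum, hfac, pairNorm, ← hn_def, mul_inv]
    have e3 : t * γ z x * n⁻¹ * (t ^ s.length * ((s.map fun k => a k x).prod * n)) =
        t ^ (s.length + 1) * γ z x * (s.map fun k => a k x).prod := by
      field_simp
      ring
    rw [smul_add, smul_add, ← e3, hw.anti x z]
    module

end Words
end SuperYangian

namespace SuperYangian

section Lines

variable {σ F N : Type*} [Field F] [AddCommGroup N] [Module F N]

/-- The exchange relations together with `A(z)A(w) = A(w)A(z)`. -/
structure IsRow (D : Set σ) (γ ν : σ → σ → F) (W : List (σ × Bool) → N) : Prop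
    extends IsExchange D γ ν 1 W where
  aa : ∀ {z w} (l l'), z ∈ D → w ∈ D → z ≠ w →
    W (l ++ (z, false) :: (w, false) :: l') = W (l ++ (w, false) :: (z, false) :: l')

/-- A letter `A` at the end of a word acts by an eigenvalue. -/
def IsVacuum (D : Set σ) (χ : σ → F) (W : List (σ × Bool) → N) : Prop :=
  ∀ z ∈ D, ∀ l, W (l ++ [(z, false)]) = χ z • W l

lemma IsRow.cons {D : Set σ} {γ ν : σ → σ → F} {W : List (σ × Bool) → N}
    (h : IsRow D γ ν W) (p : σ × Bool) : IsRow D γ ν fun l => W (p :: l) :=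
  ⟨h.toIsExchange.cons p, fun l l' => h.aa (p :: l) l'⟩

lemma IsRow.add {D : Set σ} {γ ν : σ → σ → F} {W W' : List (σ × Bool) → N}
    (h : IsRow D γ ν W) (h' : IsRow D γ ν W') : IsRow D γ ν fun l => W l + W' l := by
  refine ⟨⟨fun l l' hz hw hne => ?_, fun l l' hz hw hne => ?_⟩, fun l l' hz hw hne => ?_⟩
  · rw [h.ac l l' hz hw hne, h'.ac l l' hz hw hne]; module
  · rw [smul_add, smul_add, h.cc l l' hz hw hne, h'.cc l l' hz hw hne]
  · rw [h.aa l l' hz hw hne, h'.aa l l' hz hw hne]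

lemma IsRow.map {D : Set σ} {γ ν : σ → σ → F} {W : List (σ × Bool) → N}
    (h : IsRow D γ ν W) (P : Module.End F N) : IsRow D γ ν fun l => P (W l) := by
  refine ⟨⟨fun l l' hz hw hne => ?_, fun l l' hz hw hne => ?_⟩, fun l l' hz hw hne => ?_⟩
  · rw [h.ac l l' hz hw hne, map_add, map_smul, map_smul]
  · rw [← map_smul, ← map_smul, h.cc l l' hz hw hne]
  · rw [h.aa l l' hz hw hne]

lemma IsRow.smul {D : Set σ} {γ ν : σ → σ → F} {W : List (σ × Bool) → N}
    (h : IsRow D γ ν W) (r : F) : IsRow D γ ν fun l => r • W l :=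
  h.map (r • LinearMap.id)

/-- A line with parameter `y` crosses the first letter of a word. The Boolean argument is the state
of the line to the left of this letter. -/
def lineStep (γ : σ → σ → F) (ε : F) (y : σ) (V : Bool → List (σ × Bool) → N) (p : σ × Bool) :
    Bool → List (σ × Bool) → N := fun b l =>
  match b, p.2 with
  | false, false => (1 + γ p.1 y) • V false ((p.1, false) :: l)
  | false, true => V false ((p.1, true) :: l) + γ p.1 y • V true ((p.1, false) :: l)
  | true, false => V true ((p.1, false) :: l) + γ p.1 y • V false ((p.1, true) :: l)
  | true, true => (ε + γ p.1 y) • V true ((p.1, true) :: l)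

/-- A line with parameter `y`, which enters a word from the right in the state `false`. -/
def lineWord (γ : σ → σ → F) (ε : F) (y : σ) (V : Bool → List (σ × Bool) → N)
    (l : List (σ × Bool)) : N := l.foldl (lineStep γ ε y) V false []

variable {γ ν a : σ → σ → F} {ε : F} {D E : Set σ} {y : σ} {V : Bool → List (σ × Bool) → N}

lemma lineStep_comb (r r' : F) (V V' : Bool → List (σ × Bool) → N) (p : σ × Bool) :
    lineStep γ ε y (r • V + r' • V') p = r • lineStep γ ε y V p + r' • lineStep γ ε y V' p := by
  funext b l
  obtain ⟨x, s⟩ := p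
  cases b <;> cases s <;> simp only [lineStep, Pi.add_apply, Pi.smul_apply] <;> module

lemma foldl_lineStep_comb (r r' : F) (V V' : Bool → List (σ × Bool) → N) (l : List (σ × Bool)) :
    l.foldl (lineStep γ ε y) (r • V + r' • V') =
      r • l.foldl (lineStep γ ε y) V + r' • l.foldl (lineStep γ ε y) V' := by
  induction l generalizing V V' with
  | nil => rfl
  | cons p l ih => rw [List.foldl_cons, lineStep_comb, ih]; rfl

lemma foldl_lineStep_smul (r : F) (V : Bool → List (σ × Bool) → N) (l : List (σ × Bool)) :
    l.foldl (lineStep γ ε y) (r • V) = r • l.foldl (lineStep γ ε y) V := by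
  simpa using foldl_lineStep_comb (γ := γ) (ε := ε) (y := y) r 0 V V l

lemma isRow_lineStep (h : ∀ b, IsRow D γ ν (V b)) (p : σ × Bool) (b : Bool) :
    IsRow D γ ν (lineStep γ ε y V p b) := by
  obtain ⟨x, s⟩ := p
  cases b <;> cases s
  · exact ((h false).cons _).smul _
  · exact ((h false).cons _).add (((h true).cons _).smul _)
  · exact ((h true).cons _).add (((h false).cons _).smul _)
  · exact ((h true).cons _).smul _

lemma isRow_foldl_lineStep (h : ∀ b, IsRow D γ ν (V b)) (l : List (σ × Bool)) (b : Bool) :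
    IsRow D γ ν (l.foldl (lineStep γ ε y) V b) := by
  induction l generalizing V with
  | nil => exact h b
  | cons p l ih => exact ih (isRow_lineStep h p)

lemma isVacuum_lineStep {χ : σ → F} (h : ∀ b, IsVacuum D χ (V b)) (p : σ × Bool) (b : Bool) :
    IsVacuum D χ (lineStep γ ε y V p b) := by
  intro z hz l
  obtain ⟨x, s⟩ := p
  cases b <;> cases s <;>
    simp only [lineStep, ← List.cons_append, h _ z hz] <;> module

lemma isVacuum_foldl_lineStep {χ : σ → F} (h : ∀ b, IsVacuum D χ (V b)) (l : List (σ × Bool))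
    (b : Bool) : IsVacuum D χ (l.foldl (lineStep γ ε y) V b) := by
  induction l generalizing V with
  | nil => exact h b
  | cons p l ih => exact ih (isVacuum_lineStep h p)

lemma isVacuum_lineWord {χ : σ → F} (h : ∀ b, IsVacuum D χ (V b)) :
    IsVacuum D (fun z => χ z * (1 + γ z y)) (lineWord γ ε y V) := by
  intro z hz l
  have := isVacuum_foldl_lineStep (γ := γ) (ε := ε) (y := y) h l false z hz []
  rw [lineWord, List.foldl_append, List.foldl_cons, List.foldl_nil]
  change (1 + γ z y) • List.foldl (lineStep γ ε y) V l false ([] ++ [(z, false)]) = _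
  rw [this, lineWord]; module

/-- The exchange relations of two neighbouring letters are compatible with a crossing line. -/
lemma isRow_lineWord (hw : IsWeights E γ ν a ε) (hD : D ⊆ E) (hy : y ∈ E) (hyD : y ∉ D)
    (h : ∀ b, IsRow D γ ν (V b)) : IsRow D γ ν (lineWord γ ε y V) := by
  have hne : ∀ {z}, z ∈ D → z ≠ y := by rintro z hz rfl; exact hyD hz
  refine ⟨⟨fun {z w} l l' hz hw' hzw => ?_, fun {z w} l l' hz hw' hzw => ?_⟩,
    fun {z w} l l' hz hw' hzw => ?_⟩
  all_goals
    have h' := isRow_foldl_lineStep (γ := γ) (ε := ε) (y := y) h l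
    simp only [lineWord, List.foldl_append, List.foldl_cons]
    set V' := List.foldl (lineStep γ ε y) V l
    have h1 : ∀ b l, _ := fun b l => (h' b).ac [] l hz hw' hzw
    have h2 : ∀ b l, _ := fun b l => (h' b).ac [] l hw' hz hzw.symm
    have h3 : ∀ b l, _ := fun b l => (h' b).cc [] l hz hw' hzw
    have h4 : ∀ b l, _ := fun b l => (h' b).aa [] l hz hw' hzw
    have h5 := hw.anti w z
    have h6 := hw.arnold (hD hz) (hD hw') hy hzw (hne hw') (hne hz)
    have h7 := hw.swap (hD hw') (hD hz) hzw.symm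
    have h8 := hw.swap (hD hz) (hD hw') hzw
    simp only [List.nil_append, one_mul, h5] at h1 h2 h3 h4 h7 h8
  · have : lineStep γ ε y (lineStep γ ε y V' (z, false)) (w, true) =
        (1 - γ z w) • lineStep γ ε y (lineStep γ ε y V' (w, true)) (z, false) +
          γ z w • lineStep γ ε y (lineStep γ ε y V' (z, true)) (w, false) := by
      funext b l
      have h9 : ((ε + γ w y) * γ z y) • V' false ((z, true) :: (w, true) :: l) =
          (γ z y * (1 - γ z w)) • V' false ((w, true) :: (z, true) :: l) +
            (γ z w * γ w y) • V' false ((z, true) :: (w, true) :: l) := by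
        have f1 := hw.fac (hD hw') (hD hz) hzw.symm
        have f2 := hw.fac' (hD hw') (hD hz) hzw.symm
        rw [h5] at f1 f2
        have := congrArg (fun n => (γ z y * a w z) • n) (h3 false l)
        simp only [smul_smul, mul_assoc, f1, f2] at this
        rw [sub_eq_add_neg, ← this, ← add_smul]
        congr 1
        linear_combination -h6
      cases b <;> simp only [lineStep, Pi.add_apply, Pi.smul_apply, smul_add, h1, h2, h4]
      · match_scalars <;>
        first
          | ring1
          | linear_combination h6
          | linear_combination -h6
      · rw [smul_smul (ε + γ w y) (γ z y), h9]
        match_scalars <;>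
        first
          | ring1
          | linear_combination h6
    simp only [one_mul]
    rw [this, foldl_lineStep_comb]; rfl
  · have : ν z w • lineStep γ ε y (lineStep γ ε y V' (z, true)) (w, true) =
        ν w z • lineStep γ ε y (lineStep γ ε y V' (w, true)) (z, true) := by
      funext b l
      cases b
      · simp only [lineStep, Pi.smul_apply, smul_add, h1, h2, h3]
        match_scalars
        · ring1
        · linear_combination γ z y * h7 + ν w z * h6
        · linear_combination - γ w y * h8 - ν z w * h6
      · simp only [lineStep, Pi.smul_apply]
        rw [smul_comm (ν z w), smul_comm (ν z w), h3]; module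
    rw [← Pi.smul_apply, ← Pi.smul_apply, ← foldl_lineStep_smul, this, foldl_lineStep_smul]; rfl
  · have : lineStep γ ε y (lineStep γ ε y V' (z, false)) (w, false) =
        lineStep γ ε y (lineStep γ ε y V' (w, false)) (z, false) := by
      funext b l
      cases b <;> simp only [lineStep, smul_add, h1, h2, h4] <;> match_scalars <;>
        first
          | ring1
          | linear_combination h6
          | linear_combination -h6
    rw [this]

/-- The normalised value of a word of letters `C` crossed by a line. -/
lemma lineWord_cWord [DecidableEq σ] (hw : IsWeights E γ ν a ε) (hD : D ⊆ E) (hy : y ∈ E)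
    (hyD : y ∉ D) (h : IsExchange D γ ν 1 (V true)) {χ : σ → F} (hχ : IsVacuum D χ (V true))
    {v : List σ} (hv : v.Nodup) (hvD : ∀ x ∈ v, x ∈ D) :
    normWord ν (lineWord γ ε y V) v = normWord ν (V false) v +
      (v.map fun j => (γ j y * ((v.erase j).map fun k => a k j).prod * χ j) •
        normWord ν (V true) (v.erase j)).sum := by
  induction v generalizing V with
  | nil => simp [normWord, lineWord, cWord]
  | cons x s ih =>
    simp only [List.nodup_cons, List.mem_cons, forall_eq_or_imp] at hv hvD
    obtain ⟨hxs, hs⟩ := hv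
    obtain ⟨hx, hsD⟩ := hvD
    have hwD : IsWeights D γ ν a ε := ⟨hw.anti, fun a b c => hw.arnold (hD a) (hD b) (hD c),
      fun a b => hw.norm_ne (hD a) (hD b), fun a b => hw.fac (hD a) (hD b),
      fun a b => hw.fac' (hD a) (hD b)⟩
    have hxy : x ≠ y := by rintro rfl; exact hyD hx
    have hV1 : lineStep γ ε y V (x, true) true = fun l => (ε + γ x y) • V true ((x, true) :: l) :=
      rfl
    have hV1e : IsExchange D γ ν 1 (lineStep γ ε y V (x, true) true) := by
      have h' := h.cons (x, true)
      refine ⟨fun l l' hz hw hne => ?_, fun l l' hz hw hne => ?_⟩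
      · simp only [hV1]; rw [h'.ac l l' hz hw hne]; module
      · simp only [hV1]; rw [smul_comm, h'.cc l l' hz hw hne, smul_comm]
    have hV1v : IsVacuum D χ (lineStep γ ε y V (x, true) true) := by
      intro z hz l
      simp only [hV1]
      rw [← List.cons_append, hχ z hz, smul_comm]
    have e1 := ih hV1e hV1v hs hsD
    have e2 : (pairNorm ν s)⁻¹ • V true ((x, false) :: cWord s) =
        ((s.map fun k => 1 + γ k x).prod * χ x) • normWord ν (V true) s +
          (s.map fun j => (γ x j * ((s.erase j).map fun k => a k j).prod * χ j) •
            (pairNorm ν (s.erase j))⁻¹ • V true ((x, true) :: cWord (s.erase j))).sum := by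
      rw [h.move hwD hs hsD hx hxs, hχ x hx, normWord]
      congr 1
      · simp only [one_pow, one_mul]; module
      · congr 1
        refine List.map_congr_left fun j hj => ?_
        rw [← List.cons_append, hχ j (hsD j hj)]
        simp only [one_pow, one_mul]; module
    set n := (s.map fun k => ν k x).prod with hn_def
    have hn : n ≠ 0 := by
      refine List.prod_ne_zero ?_
      simp only [List.mem_map, not_exists, not_and]
      exact fun y hy => hwD.norm_ne (hsD y hy) hx (by rintro rfl; exact hxs hy)
    have hfac : (s.map fun k => 1 + γ k x).prod = (s.map fun k => a k x).prod * n := by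
      rw [hn_def, ← List.prod_map_mul]
      congr 1
      exact List.map_congr_left fun y hy =>
        (hwD.fac (hsD y hy) hx (by rintro rfl; exact hxs hy)).symm
    have hL : normWord ν (lineWord γ ε y V) (x :: s) =
        n⁻¹ • normWord ν (lineWord γ ε y (lineStep γ ε y V (x, true))) s := by
      rw [normWord_cons]; rfl
    have hV0 : normWord ν (lineStep γ ε y V (x, true) false) s =
        n • normWord ν (V false) (x :: s) +
          γ x y • (pairNorm ν s)⁻¹ • V true ((x, false) :: cWord s) := by
      rw [normWord_cons, ← hn_def, smul_smul, mul_inv_cancel₀ hn, one_smul]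
      simp only [normWord, lineStep]; module
    have hsum : (s.map fun j => (γ j y * (((x :: s).erase j).map fun k => a k j).prod * χ j) •
          normWord ν (V true) ((x :: s).erase j)).sum =
        (n⁻¹ * γ x y) • (s.map fun j => (γ x j * ((s.erase j).map fun k => a k j).prod * χ j) •
            (pairNorm ν (s.erase j))⁻¹ • V true ((x, true) :: cWord (s.erase j))).sum +
        n⁻¹ • (s.map fun j => (γ j y * ((s.erase j).map fun k => a k j).prod * χ j) •
              normWord ν (lineStep γ ε y V (x, true) true) (s.erase j)).sum := by
      rw [List.smul_sum, List.smul_sum, List.map_map, List.map_map, ← List.sum_map_add]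
      congr 1
      refine List.map_congr_left fun j hj => ?_
      have hxj : x ≠ j := by rintro rfl; exact hxs hj
      have hjy : j ≠ y := by rintro rfl; exact hyD (hsD _ hj)
      have n2 := hwD.norm_ne (hsD j hj) hx (Ne.symm hxj)
      have hnj : n = ν j x * ((s.erase j).map fun k => ν k x).prod := by
        rw [hn_def, ← List.prod_cons, ← List.map_cons (f := fun k => ν k x)]
        exact ((List.perm_cons_erase hj).map _).prod_eq
      simp only [Function.comp_apply]
      rw [List.erase_cons_tail (by simpa using hxj), normWord_cons, hnj, normWord, normWord, hV1]
      simp only [List.map_cons, List.prod_cons, mul_inv]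
      have key : γ j y * a x j = (γ x y * γ x j + (ε + γ x y) * γ j y) * (ν j x)⁻¹ := by
        have h2 := hwD.fac' hx (hsD j hj) hxj
        have h3 := hw.arnold (hD hx) (hD (hsD j hj)) hy hxj hjy hxy
        field_simp
        linear_combination γ j y * h2 + h3
      match_scalars
      linear_combination (((s.erase j).map fun k => a k j).prod * χ j *
        ((s.erase j).map fun k => ν k x).prod⁻¹ * (pairNorm ν (s.erase j))⁻¹) * key
    simp only [List.map_cons, List.sum_cons, List.erase_cons_head]
    rw [hL, e1, hV0, e2, hsum, hfac]
    match_scalars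
    all_goals first
      | ring1
      | (field_simp)

end Lines
end SuperYangian

namespace SuperYangian

section Expansion

open Finset

variable {σ F N : Type*} [DecidableEq σ] [Field F] [AddCommGroup N] [Module F N]

lemma IsWeights.sum_erase_prod {D : Set σ} {γ ν a : σ → σ → F} {ε : F} (hw : IsWeights D γ ν a ε)
    (S : Finset σ) {y j : σ} (hS : ∀ x ∈ S, x ∈ D) (hy : y ∈ D) (hj : j ∈ D) (hyS : y ∉ S)
    (hjS : j ∉ S) (hjy : j ≠ y) :
    ∑ w ∈ S, γ y w * γ j w * ∏ x ∈ S.erase w, (1 + γ w x) =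
      γ j y * (∏ x ∈ S, (1 + γ y x) - ∏ x ∈ S, (1 + γ j x)) := by
  induction S using Finset.induction_on generalizing y with
  | empty => simp
  | insert z S hz ih =>
    simp only [mem_insert, not_or, forall_eq_or_imp] at hS hyS hjS
    have e1 := ih hS.2 hy hyS.2 hjS.2 hjy
    have e2 := ih hS.2 hS.1 hz hjS.2 hjS.1
    have e3 : ∀ w ∈ S, γ y w * γ j w * ∏ x ∈ (insert z S).erase w, (1 + γ w x) =
        (1 + γ y z) * (γ y w * γ j w * ∏ x ∈ S.erase w, (1 + γ w x)) -
          γ y z * (γ z w * γ j w * ∏ x ∈ S.erase w, (1 + γ w x)) := by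
      intro w hwS
      have hwz : w ≠ z := by rintro rfl; exact hz hwS
      have hyw : y ≠ w := by rintro rfl; exact hyS.2 hwS
      rw [erase_insert_of_ne hwz.symm, prod_insert (fun h => hz (mem_of_mem_erase h))]
      have := hw.arnold hy (hS.2 w hwS) hS.1 hyw hwz hyS.1
      have h' := hw.anti w z
      linear_combination (γ j w * ∏ x ∈ S.erase w, (1 + γ w x)) * (this + γ y z * h')
    rw [sum_insert hz, sum_congr rfl e3, sum_sub_distrib, ← mul_sum, ← mul_sum, e1, e2,
      erase_insert hz, prod_insert hz, prod_insert hz]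
    have := hw.arnold hj hy hS.1 hjy hyS.1 hjS.1
    linear_combination (-∏ x ∈ S, (1 + γ j x)) * this

lemma sum_powerset_sum_mem (U : Finset σ) (f : Finset σ → σ → N) :
    ∑ I ∈ U.powerset, ∑ w ∈ I, f (I.erase w) w = ∑ I ∈ U.powerset, ∑ w ∈ U \ I, f I w := by
  rw [sum_sigma', sum_sigma']
  refine sum_bij' (fun p _ => ⟨p.1.erase p.2, p.2⟩) (fun p _ => ⟨insert p.2 p.1, p.2⟩) ?_ ?_ ?_ ?_ ?_
  · rintro ⟨I, w⟩ h
    simp only [mem_sigma, mem_powerset, mem_sdiff, mem_erase] at h ⊢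
    exact ⟨(erase_subset _ _).trans h.1, h.1 h.2, by simp⟩
  · rintro ⟨I, w⟩ h
    simp only [mem_sigma, mem_powerset, mem_sdiff] at h ⊢
    exact ⟨insert_subset h.2.1 h.1, mem_insert_self _ _⟩
  · rintro ⟨I, w⟩ h
    simp only [mem_sigma, mem_powerset] at h
    simp [insert_erase h.2]
  · rintro ⟨I, w⟩ h
    simp only [mem_sigma, mem_powerset, mem_sdiff] at h
    simp [erase_insert h.2.2]
  · rintro ⟨I, w⟩ _
    rfl

lemma sum_powersetCard_erase (V : Finset σ) (k : ℕ) (f : σ → Finset σ → N) :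
    ∑ j ∈ V, ∑ J ∈ (V.erase j).powersetCard k, f j J =
      ∑ J ∈ V.powersetCard (k + 1), ∑ j ∈ J, f j (J.erase j) := by
  rw [sum_sigma', sum_sigma']
  refine sum_bij' (fun p _ => ⟨insert p.1 p.2, p.1⟩) (fun p _ => ⟨p.2, p.1.erase p.2⟩) ?_ ?_ ?_ ?_ ?_
  · rintro ⟨j, J⟩ h
    simp only [mem_sigma, mem_powersetCard] at h ⊢
    have hj : j ∉ J := fun hj => notMem_erase j V (h.2.1 hj)
    exact ⟨⟨insert_subset h.1 (h.2.1.trans (erase_subset _ _)), by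
      rw [card_insert_of_notMem hj, h.2.2]⟩, mem_insert_self _ _⟩
  · rintro ⟨J, j⟩ h
    simp only [mem_sigma, mem_powersetCard] at h ⊢
    exact ⟨h.1.1 h.2, erase_subset_erase _ h.1.1, by rw [card_erase_of_mem h.2, h.1.2]; rfl⟩
  · rintro ⟨j, J⟩ h
    simp only [mem_sigma, mem_powersetCard] at h
    have hj : j ∉ J := fun hj => notMem_erase j V (h.2.1 hj)
    simp [erase_insert hj]
  · rintro ⟨J, j⟩ h
    simp only [mem_sigma, mem_powersetCard] at h
    simp [insert_erase h.2]
  · rintro ⟨j, J⟩ h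
    simp only [mem_sigma, mem_powersetCard] at h
    have hj : j ∉ J := fun hj => notMem_erase j V (h.2.1 hj)
    simp [erase_insert hj]

/-- The normalised product of operators over a finite set. -/
noncomputable def normOp (ν : σ → σ → F) (Q : σ → Module.End F N) (S : Finset σ) : Module.End F N :=
  (pairNorm ν S.toList)⁻¹ • (S.toList.map Q).prod

lemma smul_mul_mid {A : Type*} [Ring A] [Algebra F A] {r s : F} {p q p' q' : A}
    (h : r • (p * q) = s • (p' * q')) (x y : A) :
    r • (x * (p * (q * y))) = s • (x * (p' * (q' * y))) := by
  have := congrArg (fun z => x * (z * y)) h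
  simpa only [mul_smul_comm, smul_mul_assoc, mul_assoc] using this

/-- Operators which commute up to the ratio of two values of `ν`. -/
def IsTwistedOp (D : Set σ) (ν : σ → σ → F) (Q : σ → Module.End F N) : Prop :=
  ∀ z ∈ D, ∀ w ∈ D, z ≠ w → ν z w ≠ 0 ∧ ν z w • (Q z * Q w) = ν w z • (Q w * Q z)

omit [DecidableEq σ] in
lemma IsTwistedOp.norm_perm {D : Set σ} {ν : σ → σ → F} {Q : σ → Module.End F N}
    (hQ : IsTwistedOp D ν Q) {v v' : List σ} (hp : v.Perm v') (hv : v.Nodup)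
    (hD : ∀ x ∈ v, x ∈ D) :
    (pairNorm ν v)⁻¹ • (v.map Q).prod = (pairNorm ν v')⁻¹ • (v'.map Q).prod := by
  have := normWord_perm (N := Module.End F N) (W := fun l => (l.map fun p => Q p.1).prod)
    (fun hx hy h => (hQ _ hx _ hy h).1) hp hv hD (fun l l' hz hw h => by
      simp only [List.map_append, List.map_cons, List.prod_append, List.prod_cons]
      exact smul_mul_mid (hQ _ hz _ hw h).2 _ _)
  simpa [normWord, cWord, List.map_map, Function.comp_def] using this

lemma IsTwistedOp.mul_normOp {D : Set σ} {ν : σ → σ → F} {Q : σ → Module.End F N}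
    (hQ : IsTwistedOp D ν Q) {S : Finset σ} {y : σ} (hS : ∀ x ∈ S, x ∈ D) (hy : y ∈ D)
    (hyS : y ∉ S) : Q y * normOp ν Q S = (∏ x ∈ S, ν x y) • normOp ν Q (insert y S) := by
  have h1 := hQ.norm_perm (toList_insert hyS) (nodup_toList _) (by simpa using ⟨hy, hS⟩)
  rw [normOp, normOp, h1, pairNorm, prod_map_toList, mul_inv, smul_smul,
    mul_inv_cancel_left₀ (prod_ne_zero_iff.2 fun x hx =>
      (hQ x (hS x hx) y hy (by rintro rfl; exact hyS hx)).1)]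
  simp

/-- Moving an operator `P₀` through a normalised product of operators `P₁`. -/
lemma mul_normOp_exchange {D : Set σ} {g h : σ → σ → F} (hw : IsWeights D g h g (-1)) {t : F}
    {P₀ P₁ : σ → Module.End F N}
    (h01 : ∀ z ∈ D, ∀ w ∈ D, z ≠ w → P₀ z * P₁ w =
      (t * (1 - g z w)) • (P₁ w * P₀ z) + (t * g z w) • (P₁ z * P₀ w))
    (h11 : IsTwistedOp D h P₁) {I : Finset σ} (hI : ∀ x ∈ I, x ∈ D) {y : σ} (hy : y ∈ D)
    (hyI : y ∉ I) :
    P₀ y * normOp h P₁ I = (t ^ I.card * ∏ k ∈ I, (1 + g k y)) • (normOp h P₁ I * P₀ y) +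
      ∑ w ∈ I, (t ^ I.card * g y w * ∏ k ∈ I.erase w, (g k w * h k y)) •
        (normOp h P₁ (insert y (I.erase w)) * P₀ w) := by
  have hex : IsExchange D g h t
      (fun l : List (σ × Bool) => (l.map fun p => if p.2 then P₁ p.1 else P₀ p.1).prod) := by
    refine ⟨fun {z w} l l' hz hw' hne => ?_, fun {z w} l l' hz hw' hne => ?_⟩
    · have := h01 z hz w hw' hne
      simp only [List.map_append, List.map_cons, List.prod_append, List.prod_cons, if_true,
        Bool.false_eq_true, if_false]
      rw [← mul_assoc (P₀ z), this, add_mul, mul_add, smul_mul_assoc, smul_mul_assoc,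
        mul_smul_comm, mul_smul_comm, mul_assoc (P₁ w), mul_assoc (P₁ z)]
    · simp only [List.map_append, List.map_cons, List.prod_append, List.prod_cons, if_true]
      exact smul_mul_mid (h11 z hz w hw' hne).2 _ _
  have key := hex.move hw (nodup_toList I) (by simpa using hI) hy (by simpa using hyI)
  simp only [cWord, List.map_cons, List.map_append, List.map_map, Function.comp_def, if_true,
    Bool.false_eq_true, if_false, List.prod_cons, List.prod_append, List.map_nil, List.prod_nil,
    mul_one, length_toList, prod_map_toList] at key
  rw [normOp, mul_smul_comm, key, smul_mul_assoc, sum_map_toList]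
  congr 1
  refine sum_congr rfl fun w hwI => ?_
  have hp : (I.toList.erase w).Perm (I.erase w).toList := by
    rw [List.perm_ext_iff_of_nodup ((nodup_toList I).erase w) (nodup_toList _)]
    simp [(nodup_toList I).mem_erase_iff]
  have e1 := h11.norm_perm hp ((nodup_toList I).erase w)
    (fun x hx => hI x (by simpa using List.mem_of_mem_erase hx))
  have e2 := h11.mul_normOp (S := I.erase w) (fun x hx => hI x (mem_of_mem_erase hx)) hy
    (fun h => hyI (mem_of_mem_erase h))
  rw [normOp, ← e1, mul_smul_comm] at e2
  rw [← mul_assoc, ← smul_mul_assoc, e2, smul_mul_assoc, smul_smul, (hp.map _).prod_eq,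
    prod_map_toList, prod_mul_distrib, mul_assoc]

/-- The coefficient of a partition in the expansion of a Bethe vector. -/
def partCoef (κ : Finset σ → Finset σ → F) (b a : σ → σ → F) (χ : σ → F) (I II J JJ : Finset σ) :
    F :=
  κ I J * (∏ x ∈ I, ∏ z ∈ II, b x z) * (∏ k ∈ JJ, ∏ j ∈ J, a k j) * ∏ j ∈ J, χ j

/-- The data which enter the expansion of a Bethe vector over partitions. -/
structure IsExpansionData (D E : Set σ) (γ ν a : σ → σ → F) (ε : F) (g h : σ → σ → F) (t : F)
    (ν₀ b q : σ → σ → F) (κ : Finset σ → Finset σ → F) : Prop where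
  sub : D ⊆ E
  weights : IsWeights E γ ν a ε
  weights' : IsWeights E g h g (-1)
  tg : ∀ x y, t * g x y = γ x y
  b_mul : ∀ {x y}, x ∈ E → y ∈ E → x ≠ y → b x y * ν₀ x y = t * (1 + g x y)
  b_mul' : ∀ {x y}, x ∈ E → y ∈ E → x ≠ y → b x y * ν₀ y x = 1 + γ x y
  q_mul : ∀ {x y}, x ∈ E → y ∈ E → x ≠ y → q x y * ν₀ x y = h x y
  empty : κ ∅ ∅ = 1
  kap_insert : ∀ {z : σ} {I J : Finset σ}, z ∈ E → z ∉ D → (∀ x ∈ I, x ∈ E ∧ x ∉ D) → z ∉ I →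
    (∀ x ∈ J, x ∈ D) → J.card = I.card + 1 →
    κ (insert z I) J = (∏ x ∈ I, q x z) * ∑ j ∈ J, γ j z * ((∏ k ∈ J.erase j, a k j) *
      (∏ x ∈ I, (1 + γ j x)) * κ I (J.erase j))

end Expansion
end SuperYangian

namespace SuperYangian

section Expansion

open Finset

variable {σ F N : Type*} [DecidableEq σ] [Field F] [AddCommGroup N] [Module F N]

variable {D E : Set σ} {γ ν a : σ → σ → F} {ε : F} {g h : σ → σ → F} {t : F}
  {ν₀ b q : σ → σ → F} {κ : Finset σ → Finset σ → F}

lemma partCoef_insert_right (H : IsExpansionData D E γ ν a ε g h t ν₀ b q κ) (χ : σ → F)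
    {I II J JJ : Finset σ} {y : σ} (hI : ∀ x ∈ I, x ∈ E) (hy : y ∈ E) (hyI : y ∉ I) (hyII : y ∉ II) :
    partCoef κ b a χ I II J JJ * (t ^ I.card * ∏ k ∈ I, (1 + g k y)) =
      partCoef κ b a χ I (insert y II) J JJ * ∏ k ∈ I, ν₀ k y := by
  have : t ^ I.card * ∏ k ∈ I, (1 + g k y) = (∏ k ∈ I, b k y) * ∏ k ∈ I, ν₀ k y := by
    rw [← prod_const, ← prod_mul_distrib, ← prod_mul_distrib]
    exact prod_congr rfl fun x hx =>
      (H.b_mul (hI x hx) hy (by rintro rfl; exact hyI hx)).symm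
  have h2 : ∏ x ∈ I, ∏ z ∈ insert y II, b x z = (∏ k ∈ I, b k y) * ∏ x ∈ I, ∏ z ∈ II, b x z := by
    rw [← prod_mul_distrib]
    exact prod_congr rfl fun x _ => prod_insert hyII
  rw [this, partCoef, partCoef, h2]; ring

lemma partCoef_insert_left (H : IsExpansionData D E γ ν a ε g h t ν₀ b q κ) (χ : σ → F)
    {I II J V : Finset σ} {y : σ} (hI : ∀ x ∈ I, x ∈ E ∧ x ∉ D) (hII : ∀ x ∈ II, x ∈ E ∧ x ∉ D)
    (hd : Disjoint I II) (hy : y ∈ E) (hyD : y ∉ D) (hyI : y ∉ I) (hyII : y ∉ II)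
    (hV : ∀ x ∈ V, x ∈ D) (hJ : J ⊆ V) (hc : J.card = I.card + 1) :
    (∑ w ∈ II, partCoef κ b a χ (insert w I) (II.erase w) J (V \ J) *
        (t ^ (I.card + 1) * g y w * ∏ k ∈ I, (g k w * h k y)) * ∏ x ∈ II.erase w, ν₀ x w) +
      ∑ j ∈ J, (γ j y * (∏ k ∈ V.erase j, a k j) * (χ j * ∏ x ∈ I ∪ II, (1 + γ j x))) *
        partCoef κ b a χ I II (J.erase j) (V \ J) * ∏ k ∈ I, h k y =
      partCoef κ b a χ (insert y I) II J (V \ J) * ∏ x ∈ I ∪ II, ν₀ x y := by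
  have hJD : ∀ x ∈ J, x ∈ D := fun x hx => hV x (hJ hx)
  have hne : ∀ {x z : σ}, x ∈ I → z ∈ II → x ≠ z := fun hx hz => disjoint_left.1 hd hx |> fun h e =>
    h (e ▸ hz)
  set ρ : σ → F := fun j => (∏ k ∈ J.erase j, a k j) * (∏ x ∈ I, (1 + γ j x)) * κ I (J.erase j)
  set M : F := (∏ k ∈ I, ν₀ k y) * (∏ x ∈ I, ∏ z ∈ II, b x z) * (∏ k ∈ V \ J, ∏ j ∈ J, a k j) *
    (∏ j ∈ J, χ j) * ∏ k ∈ I, q k y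
  have hh : ∏ k ∈ I, h k y = (∏ k ∈ I, q k y) * ∏ k ∈ I, ν₀ k y := by
    rw [← prod_mul_distrib]
    exact prod_congr rfl fun x hx =>
      (H.q_mul (hI x hx).1 hy (by rintro rfl; exact hyI hx)).symm
  have e1 : ∀ w ∈ II, partCoef κ b a χ (insert w I) (II.erase w) J (V \ J) *
        (t ^ (I.card + 1) * g y w * ∏ k ∈ I, (g k w * h k y)) * ∏ x ∈ II.erase w, ν₀ x w =
      ∑ j ∈ J, M * ρ j * (γ y w * γ j w * ∏ x ∈ II.erase w, (1 + γ w x)) := by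
    intro w hw
    have hwI : w ∉ I := fun hwI => hne hwI hw rfl
    have r1 := H.kap_insert (hII w hw).1 (hII w hw).2 hI hwI hJD hc
    have r2 : t ^ I.card * (∏ k ∈ I, q k w) * ∏ k ∈ I, g k w = ∏ k ∈ I, b k w := by
      rw [← prod_const, ← prod_mul_distrib, ← prod_mul_distrib]
      refine prod_congr rfl fun k hk => ?_
      have hkw : k ≠ w := hne hk hw
      have hkE := (hI k hk).1
      have hwE := (hII w hw).1
      have i1 := H.b_mul hkE hwE hkw
      have i2 := H.q_mul hkE hwE hkw
      have i3 := H.weights'.fac hkE hwE hkw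
      have i4 := H.weights'.norm_ne hkE hwE hkw
      rw [← i2] at i4
      have i5 := right_ne_zero_of_mul i4
      apply mul_right_cancel₀ i5
      rw [i1, ← i3, ← i2]; ring
    have r3 : (∏ z ∈ II.erase w, b w z) * ∏ x ∈ II.erase w, ν₀ x w =
        ∏ x ∈ II.erase w, (1 + γ w x) := by
      rw [← prod_mul_distrib]
      exact prod_congr rfl fun x hx => H.b_mul' (hII w hw).1 (hII x (mem_of_mem_erase hx)).1
        (ne_of_mem_erase hx).symm
    have r4 : ∏ x ∈ I, ∏ z ∈ II, b x z =
        (∏ x ∈ I, b x w) * ∏ x ∈ I, ∏ z ∈ II.erase w, b x z := by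
      rw [← prod_mul_distrib]
      exact prod_congr rfl fun x _ => (mul_prod_erase _ _ hw).symm
    simp only [M]
    rw [r4, ← r2, ← r3, partCoef, r1, prod_insert hwI, prod_mul_distrib, hh, ← H.tg y w]
    simp only [mul_sum, sum_mul]
    refine sum_congr rfl fun j _ => ?_
    simp only [ρ]
    rw [pow_succ]; ring
  have e2 : ∀ j ∈ J, (γ j y * (∏ k ∈ V.erase j, a k j) * (χ j * ∏ x ∈ I ∪ II, (1 + γ j x))) *
        partCoef κ b a χ I II (J.erase j) (V \ J) * ∏ k ∈ I, h k y =
      M * ρ j * (γ j y * ∏ x ∈ II, (1 + γ j x)) := by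
    intro j hj
    have r1 : ∏ k ∈ V.erase j, a k j = (∏ k ∈ J.erase j, a k j) * ∏ k ∈ V \ J, a k j := by
      rw [← prod_union (disjoint_left.2 fun x hx hx' =>
        (mem_sdiff.1 hx').2 (mem_of_mem_erase hx))]
      congr 1
      ext x
      simp only [mem_erase, mem_union, mem_sdiff]
      constructor
      · rintro ⟨h1, h2⟩
        by_cases hx : x ∈ J
        · exact Or.inl ⟨h1, hx⟩
        · exact Or.inr ⟨h2, hx⟩
      · rintro (⟨h1, h2⟩ | ⟨h1, h2⟩)
        · exact ⟨h1, hJ h2⟩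
        · exact ⟨by rintro rfl; exact h2 hj, h1⟩
    have r2 : ∏ k ∈ V \ J, ∏ j ∈ J, a k j =
        (∏ k ∈ V \ J, a k j) * ∏ k ∈ V \ J, ∏ i ∈ J.erase j, a k i := by
      rw [← prod_mul_distrib]
      exact prod_congr rfl fun x _ => (mul_prod_erase _ _ hj).symm
    have r3 := (mul_prod_erase J χ hj).symm
    simp only [M, ρ]
    rw [partCoef, r1, r2, r3, hh, prod_union hd]; ring
  have e3 : partCoef κ b a χ (insert y I) II J (V \ J) * ∏ x ∈ I ∪ II, ν₀ x y =
      ∑ j ∈ J, M * ρ j * (γ j y * ∏ x ∈ II, (1 + γ y x)) := by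
    have r1 := H.kap_insert hy hyD hI hyI hJD hc
    have r3 : (∏ z ∈ II, b y z) * ∏ x ∈ II, ν₀ x y = ∏ x ∈ II, (1 + γ y x) := by
      rw [← prod_mul_distrib]
      exact prod_congr rfl fun x hx => H.b_mul' hy (hII x hx).1 (by rintro rfl; exact hyII hx)
    rw [partCoef, r1, prod_insert hyI, prod_union hd, ← r3]
    simp only [mul_sum, sum_mul, M, ρ]
    exact sum_congr rfl fun j _ => by ring
  rw [sum_congr rfl e1, sum_congr rfl e2, e3, sum_comm, ← sum_add_distrib]
  refine sum_congr rfl fun j hj => ?_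
  have hjD := hJD j hj
  have := H.weights.sum_erase_prod II (fun x hx => (hII x hx).1) hy (H.sub hjD) hyII
    (fun hjI => (hII j hjI).2 hjD) (by rintro rfl; exact hyD hjD)
  rw [← mul_sum, this]; ring

/-- The expansion over partitions which follows from the recursion in the lines. -/
theorem expansion (H : IsExpansionData D E γ ν a ε g h t ν₀ b q κ) {P₀ P₁ : σ → Module.End F N}
    (h01 : ∀ z ∈ E, ∀ w ∈ E, z ≠ w → P₀ z * P₁ w =
      (t * (1 - g z w)) • (P₁ w * P₀ z) + (t * g z w) • (P₁ z * P₀ w))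
    (h11 : IsTwistedOp E h P₁) (h00 : IsTwistedOp E ν₀ P₀) {χ : σ → F}
    {R : List σ → Finset σ → N}
    (hR : ∀ y ys V, y ∈ E → y ∉ D → (∀ x ∈ ys, x ∈ E ∧ x ∉ D) → (y :: ys).Nodup →
      (∀ x ∈ V, x ∈ D) → R (y :: ys) V = P₀ y (R ys V) +
        ∑ j ∈ V, (γ j y * (∏ k ∈ V.erase j, a k j) *
          (χ j * ∏ x ∈ ys.toFinset, (1 + γ j x))) • P₁ y (R ys (V.erase j)))
    (ys : List σ) (hys : ∀ x ∈ ys, x ∈ E ∧ x ∉ D) (hn : ys.Nodup) (V : Finset σ)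
    (hV : ∀ x ∈ V, x ∈ D) :
    R ys V = pairNorm ν₀ ys • ∑ I ∈ ys.toFinset.powerset, ∑ J ∈ V.powersetCard I.card,
      partCoef κ b a χ I (ys.toFinset \ I) J (V \ J) •
        normOp h P₁ I (normOp ν₀ P₀ (ys.toFinset \ I) (R [] (V \ J))) := by
  induction ys generalizing V with
  | nil => simp [pairNorm, partCoef, H.empty, normOp]
  | cons y ys ih =>
    simp only [List.mem_cons, forall_eq_or_imp] at hys
    obtain ⟨⟨hy, hyD⟩, hys⟩ := hys
    have hn' := hn
    rw [List.nodup_cons] at hn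
    obtain ⟨hyy, hn⟩ := hn
    set U := ys.toFinset with hU
    have hUE : ∀ x ∈ U, x ∈ E ∧ x ∉ D := fun x hx => hys x (by simpa [hU] using hx)
    have hyU : y ∉ U := by simpa [hU] using hyy
    have hprod : (ys.map fun x => ν₀ x y).prod = ∏ x ∈ U, ν₀ x y :=
      (List.prod_toFinset _ hn).symm
    rw [hR y ys V hy hyD hys hn' hV, ih hys hn V hV]
    rw [List.toFinset_cons, ← hU, sum_powerset_insert hyU, pairNorm, hprod]
    have hsd : ∀ {I}, I ∈ U.powerset → ∀ x ∈ U \ I, x ∈ E := fun _ x hx => (hUE x (mem_sdiff.1 hx).1).1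
    -- the summands with `y` in the first part, which come from `P₀ y`
    obtain ⟨n, hn_eq⟩ : ∃ n : N, n = ∑ I ∈ U.powerset, ∑ J ∈ V.powersetCard (I.card + 1),
      (∑ w ∈ U \ I, partCoef κ b a χ (insert w I) ((U \ I).erase w) J (V \ J) *
        (t ^ (I.card + 1) * g y w * ∏ k ∈ I, (g k w * h k y)) * ∏ x ∈ (U \ I).erase w, ν₀ x w) •
        normOp h P₁ (insert y I) (normOp ν₀ P₀ (U \ I) (R [] (V \ J))) := ⟨_, rfl⟩
    have A : P₀ y (pairNorm ν₀ ys • ∑ I ∈ U.powerset, ∑ J ∈ V.powersetCard I.card,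
        partCoef κ b a χ I (U \ I) J (V \ J) •
          normOp h P₁ I (normOp ν₀ P₀ (U \ I) (R [] (V \ J)))) =
      ((∏ x ∈ U, ν₀ x y) * pairNorm ν₀ ys) • (∑ I ∈ U.powerset, ∑ J ∈ V.powersetCard I.card,
        partCoef κ b a χ I (insert y U \ I) J (V \ J) •
          normOp h P₁ I (normOp ν₀ P₀ (insert y U \ I) (R [] (V \ J)))) + pairNorm ν₀ ys • n := by
      have e : ∀ I ∈ U.powerset, ∀ J, P₀ y (partCoef κ b a χ I (U \ I) J (V \ J) •
          normOp h P₁ I (normOp ν₀ P₀ (U \ I) (R [] (V \ J)))) =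
          (∏ x ∈ U, ν₀ x y) • (partCoef κ b a χ I (insert y U \ I) J (V \ J) •
            normOp h P₁ I (normOp ν₀ P₀ (insert y U \ I) (R [] (V \ J)))) +
          ∑ w ∈ I, (partCoef κ b a χ (insert w (I.erase w)) ((U \ I.erase w).erase w) J (V \ J) *
            (t ^ ((I.erase w).card + 1) * g y w * ∏ k ∈ I.erase w, (g k w * h k y)) *
              ∏ x ∈ (U \ I.erase w).erase w, ν₀ x w) •
            normOp h P₁ (insert y (I.erase w))
              (normOp ν₀ P₀ (U \ I.erase w) (R [] (V \ J))) := by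
        intro I hI J
        have hIU := mem_powerset.1 hI
        have hIE : ∀ x ∈ I, x ∈ E := fun x hx => (hUE x (hIU hx)).1
        have hyI : y ∉ I := fun h => hyU (hIU h)
        have hyII : y ∉ U \ I := fun h => hyU (mem_sdiff.1 h).1
        have x1 := mul_normOp_exchange H.weights' h01 h11 hIE hy hyI
        have x2 := h00.mul_normOp (hsd hI) hy hyII
        have x3 := partCoef_insert_right H χ (J := J) (JJ := V \ J) (II := U \ I) hIE hy hyI hyII
        have x4 : insert y U \ I = insert y (U \ I) := insert_sdiff_of_notMem U hyI
        have x5 : ∏ x ∈ U, ν₀ x y = (∏ x ∈ I, ν₀ x y) * ∏ x ∈ U \ I, ν₀ x y := by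
          rw [mul_comm, prod_sdiff hIU]
        rw [map_smul, ← Module.End.mul_apply, x1, LinearMap.add_apply, smul_add]
        congr 1
        · rw [LinearMap.smul_apply, Module.End.mul_apply, ← Module.End.mul_apply (P₀ y), x2,
            LinearMap.smul_apply, map_smul, smul_smul, smul_smul, smul_smul, x3, x4, x5]
          congr 1; ring
        · rw [LinearMap.sum_apply, smul_sum]
          refine sum_congr rfl fun w hw => ?_
          have hwII : w ∉ U \ I := fun h => (mem_sdiff.1 h).2 hw
          have x6 := h00.mul_normOp (hsd hI) (hIE w hw) hwII
          have x7 : insert w (U \ I) = U \ I.erase w := by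
            rw [sdiff_erase (hIU hw)]
          have x8 : (U \ I.erase w).erase w = U \ I := by rw [← x7, erase_insert hwII]
          rw [LinearMap.smul_apply, Module.End.mul_apply, ← Module.End.mul_apply (P₀ w), x6,
            LinearMap.smul_apply, map_smul, smul_smul, smul_smul, x7, x8, insert_erase hw,
            card_erase_add_one hw]
      rw [map_smul, map_sum]
      simp only [map_sum]
      rw [sum_congr rfl fun I hI => sum_congr rfl fun J _ => e I hI J]
      simp only [sum_add_distrib]
      simp only [← smul_sum]
      rw [smul_add, smul_smul, mul_comm, hn_eq]
      congr 2
      rw [sum_congr rfl fun I _ => sum_comm]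
      have := sum_powerset_sum_mem U (fun I w => ∑ J ∈ V.powersetCard (I.card + 1),
        (partCoef κ b a χ (insert w I) ((U \ I).erase w) J (V \ J) *
        (t ^ (I.card + 1) * g y w * ∏ k ∈ I, (g k w * h k y)) * ∏ x ∈ (U \ I).erase w, ν₀ x w) •
        normOp h P₁ (insert y I) (normOp ν₀ P₀ (U \ I) (R [] (V \ J))))
      rw [sum_congr rfl fun I _ => sum_congr rfl fun w hw => by
        rw [card_erase_add_one hw]] at this
      rw [sum_congr rfl fun I _ => sum_congr rfl fun w hw => by
        rw [card_erase_add_one hw], this]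
      refine sum_congr rfl fun I _ => ?_
      rw [sum_comm]
      exact sum_congr rfl fun J _ => (sum_smul).symm
    have B : ∑ j ∈ V, (γ j y * (∏ k ∈ V.erase j, a k j) * (χ j * ∏ x ∈ U, (1 + γ j x))) •
        P₁ y (R ys (V.erase j)) =
      pairNorm ν₀ ys • ∑ I ∈ U.powerset, ∑ J ∈ V.powersetCard (I.card + 1),
        (∑ j ∈ J, (γ j y * (∏ k ∈ V.erase j, a k j) * (χ j * ∏ x ∈ I ∪ U \ I, (1 + γ j x))) *
          partCoef κ b a χ I (U \ I) (J.erase j) (V \ J) * ∏ k ∈ I, h k y) •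
          normOp h P₁ (insert y I) (normOp ν₀ P₀ (U \ I) (R [] (V \ J))) := by
      have e : ∀ j ∈ V, (γ j y * (∏ k ∈ V.erase j, a k j) * (χ j * ∏ x ∈ U, (1 + γ j x))) •
          P₁ y (R ys (V.erase j)) = ∑ I ∈ U.powerset, ∑ J ∈ (V.erase j).powersetCard I.card,
          pairNorm ν₀ ys • ((γ j y * (∏ k ∈ V.erase j, a k j) *
            (χ j * ∏ x ∈ I ∪ U \ I, (1 + γ j x))) *
            partCoef κ b a χ I (U \ I) J (V.erase j \ J) * ∏ k ∈ I, h k y) •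
            normOp h P₁ (insert y I) (normOp ν₀ P₀ (U \ I) (R [] (V.erase j \ J))) := by
        intro j _
        rw [ih hys hn (V.erase j) fun x hx => hV x (mem_of_mem_erase hx), map_smul, map_sum,
          smul_sum, smul_sum]
        refine sum_congr rfl fun I hI => ?_
        have hIU := mem_powerset.1 hI
        have hyI : y ∉ I := fun h => hyU (hIU h)
        rw [map_sum, smul_sum, smul_sum]
        refine sum_congr rfl fun J _ => ?_
        have x1 := h11.mul_normOp (fun x hx => (hUE x (hIU hx)).1) hy hyI
        rw [map_smul, ← Module.End.mul_apply, x1, LinearMap.smul_apply, union_sdiff_of_subset hIU]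
        simp only [smul_smul]
        congr 1; ring
      rw [sum_congr rfl e, sum_comm, smul_sum]
      refine sum_congr rfl fun I _ => ?_
      rw [sum_powersetCard_erase V I.card, smul_sum]
      refine sum_congr rfl fun J hJ => ?_
      rw [sum_smul, smul_sum]
      refine sum_congr rfl fun j hj => ?_
      have : V.erase j \ J.erase j = V \ J := by
        ext x
        simp only [mem_sdiff, mem_erase]
        constructor
        · rintro ⟨⟨h1, h2⟩, h3⟩
          exact ⟨h2, fun h => h3 ⟨h1, h⟩⟩
        · rintro ⟨h1, h2⟩
          exact ⟨⟨by rintro rfl; exact h2 hj, h1⟩, fun h => h2 h.2⟩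
      rw [this]
    have C : pairNorm ν₀ ys • n + pairNorm ν₀ ys • ∑ I ∈ U.powerset,
        ∑ J ∈ V.powersetCard (I.card + 1),
        (∑ j ∈ J, (γ j y * (∏ k ∈ V.erase j, a k j) * (χ j * ∏ x ∈ I ∪ U \ I, (1 + γ j x))) *
          partCoef κ b a χ I (U \ I) (J.erase j) (V \ J) * ∏ k ∈ I, h k y) •
          normOp h P₁ (insert y I) (normOp ν₀ P₀ (U \ I) (R [] (V \ J))) =
      ((∏ x ∈ U, ν₀ x y) * pairNorm ν₀ ys) • ∑ I ∈ U.powerset,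
        ∑ J ∈ V.powersetCard (insert y I).card,
        partCoef κ b a χ (insert y I) (insert y U \ insert y I) J (V \ J) •
          normOp h P₁ (insert y I)
            (normOp ν₀ P₀ (insert y U \ insert y I) (R [] (V \ J))) := by
      rw [hn_eq, ← smul_add, ← sum_add_distrib, mul_comm, mul_smul, smul_sum (r := ∏ x ∈ U, ν₀ x y)]
      congr 1
      refine sum_congr rfl fun I hI => ?_
      have hIU := mem_powerset.1 hI
      have hyI : y ∉ I := fun h => hyU (hIU h)
      rw [← sum_add_distrib, card_insert_of_notMem hyI, smul_sum]
      refine sum_congr rfl fun J hJ => ?_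
      have hJ' := mem_powersetCard.1 hJ
      have x1 : insert y U \ insert y I = U \ I := by
        ext x
        simp only [mem_sdiff, mem_insert, not_or]
        constructor
        · rintro ⟨h1 | h1, h2, h3⟩
          · exact absurd h1 h2
          · exact ⟨h1, h3⟩
        · rintro ⟨h1, h2⟩
          exact ⟨Or.inr h1, by rintro rfl; exact hyU h1, h2⟩
      have x2 := partCoef_insert_left H χ (fun x hx => hUE x (hIU hx))
        (fun x hx => hUE x (mem_sdiff.1 hx).1) disjoint_sdiff hy hyD hyI
        (fun h => hyU (mem_sdiff.1 h).1) hV hJ'.1 hJ'.2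
      rw [← add_smul, x2, x1, union_sdiff_of_subset hIU, smul_smul, mul_comm]
    rw [A, B, add_assoc, C, smul_add]

end Expansion
end SuperYangian

namespace SuperYangian

section Rational

open Finset Polynomial

variable {σ F : Type*} [Field F]

/-- The functions `g(x,y) = c/(x-y)` and `h(x,y) = (x-y+c)/c` of parameters in general position. -/
structure IsRational (s : σ → F) (c : F) (g h : σ → σ → F) : Prop where
  inj : Function.Injective s
  c_ne : c ≠ 0
  g_def : ∀ x y, g x y = c / (s x - s y)
  h_def : ∀ x y, h x y = (s x - s y + c) / c
  h_ne : ∀ x y, h x y ≠ 0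

/-- `K_ℓ(v̄|ū)`. -/
def izergin (g h : σ → σ → F) {l : ℕ} (v u : Fin l → σ) : F :=
  (∏ j : Fin l, ∏ k ∈ Finset.Iio j, g (v j) (v k)) *
  (∏ j : Fin l, ∏ k ∈ Finset.Iio j, g (u k) (u j)) *
  (∏ j : Fin l, ∏ k : Fin l, h (v j) (u k)) *
  Matrix.det (Matrix.of fun j k : Fin l => g (v j) (u k) / h (v j) (u k))

variable {s : σ → F} {c : F} {g h : σ → σ → F} (H : IsRational s c g h)
include H

lemma IsRational.anti (x y : σ) : g x y = -g y x := by
  rw [H.g_def, H.g_def, ← neg_sub (s y), div_neg]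

lemma IsRational.sub_ne {x y : σ} (hxy : x ≠ y) : s x - s y ≠ 0 :=
  sub_ne_zero.2 fun e => hxy (H.inj e)

lemma IsRational.g_ne {x y : σ} (hxy : x ≠ y) : g x y ≠ 0 := by
  rw [H.g_def]; exact div_ne_zero H.c_ne (H.sub_ne hxy)

lemma IsRational.g_mul_h {x y : σ} (hxy : x ≠ y) : g x y * h x y = 1 + g x y := by
  have := H.sub_ne hxy
  have := H.c_ne
  rw [H.g_def, H.h_def]; field_simp

lemma IsRational.arnold {x y z : σ} (hxy : x ≠ y) (hyz : y ≠ z) (hxz : x ≠ z) :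
    g x y * g y z = g x z * (g x y + g y z) := by
  have := H.sub_ne hxy
  have := H.sub_ne hyz
  have := H.sub_ne hxz
  rw [H.g_def, H.g_def, H.g_def]; field_simp; ring

lemma IsRational.isWeights (E : Set σ) : IsWeights E g h g (-1) where
  anti := H.anti
  arnold _ _ _ := H.arnold
  norm_ne _ _ _ := H.h_ne _ _
  fac _ _ h := H.g_mul_h h
  fac' _ _ h := by rw [H.anti, neg_mul, H.g_mul_h h.symm, H.anti]; ring

lemma IsRational.isWeights' (E : Set σ) :
    IsWeights E (fun x y => g y x) (fun _ _ => 1) (fun x y => 1 + g y x) 1 where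
  anti x y := H.anti y x
  arnold _ _ _ h1 h2 h3 := by
    rw [mul_comm, H.arnold h2.symm h1.symm h3.symm, add_comm]
  norm_ne _ _ _ := one_ne_zero
  fac _ _ h := mul_one _
  fac' _ _ h := mul_one _

/-- Lagrange interpolation. -/
lemma IsRational.interpolate [DecidableEq σ] (p : F[X]) (S : Finset σ) (hp : p.degree < S.card)
    {z : σ} (hz : z ∉ S) :
    p.eval (s z) * ∏ k ∈ S, g k z =
      ∑ j ∈ S, g j z * (∏ k ∈ S.erase j, g k j) * p.eval (s j) := by
  have hne : ∀ i ∈ S, s z ≠ s i := fun i hi e => hz (H.inj e ▸ hi)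
  rw [Lagrange.eq_interpolate (s := S) (v := s) H.inj.injOn hp,
    Lagrange.eval_interpolate_not_at_node _ hne, Lagrange.eval_nodal]
  rw [← Lagrange.eq_interpolate (s := S) (v := s) H.inj.injOn hp, mul_right_comm, mul_sum,
    ← prod_mul_distrib]
  have e : ∏ i ∈ S, (s z - s i) * g i z = ∏ i ∈ S, (-c) := by
    refine prod_congr rfl fun i hi => ?_
    have := H.sub_ne (x := z) (y := i) (fun e => hne i hi (e ▸ rfl))
    rw [H.anti, H.g_def]; field_simp
  rw [e]
  refine sum_congr rfl fun j hj => ?_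
  have e2 : ∏ k ∈ S.erase j, g k j = (∏ k ∈ S.erase j, (-c)) * Lagrange.nodalWeight S s j := by
    rw [Lagrange.nodalWeight, ← prod_mul_distrib]
    exact prod_congr rfl fun k _ => by rw [H.anti, H.g_def]; ring
  rw [e2, ← mul_prod_erase S (fun _ => -c) hj, H.anti j z, H.g_def]; ring

lemma IsRational.izergin_comp {l : ℕ} (v u : Fin l → σ) (π ρ : Equiv.Perm (Fin l)) :
    izergin g h (v ∘ π) (u ∘ ρ) = izergin g h v u := by
  have e1 := π.prod_Iio_comp_eq_sign_mul_prod (f := fun i j => g (v j) (v i))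
    (fun i j => H.anti _ _)
  have e2 := ρ.prod_Iio_comp_eq_sign_mul_prod (f := fun i j => g (u i) (u j))
    (fun i j => H.anti _ _)
  have e3 : ∏ j, ∏ k, h (v (π j)) (u (ρ k)) = ∏ j, ∏ k, h (v j) (u k) := by
    rw [Equiv.prod_comp π (fun j => ∏ k, h (v j) (u (ρ k)))]
    exact prod_congr rfl fun j _ => Equiv.prod_comp ρ (fun k => h (v j) (u k))
  have e4 : (Matrix.of fun j k : Fin l => g (v (π j)) (u (ρ k)) / h (v (π j)) (u (ρ k))).det =
      Equiv.Perm.sign π * (Equiv.Perm.sign ρ *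
        (Matrix.of fun j k : Fin l => g (v j) (u k) / h (v j) (u k)).det) := by
    rw [← Matrix.det_permute', ← Matrix.det_permute]; rfl
  have s1 : ((Equiv.Perm.sign π : ℤ) : F) * (Equiv.Perm.sign π : ℤ) = 1 := by
    rw [← Int.cast_mul, Int.units_coe_mul_self, Int.cast_one]
  have s2 : ((Equiv.Perm.sign ρ : ℤ) : F) * (Equiv.Perm.sign ρ : ℤ) = 1 := by
    rw [← Int.cast_mul, Int.units_coe_mul_self, Int.cast_one]
  simp only [izergin, Function.comp_apply]
  rw [e1, e2, e3, e4]
  linear_combination ((∏ j : Fin l, ∏ k ∈ Finset.Iio j, g (v j) (v k)) *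
    (∏ j : Fin l, ∏ k ∈ Finset.Iio j, g (u k) (u j)) * (∏ j : Fin l, ∏ k : Fin l, h (v j) (u k)) *
    Matrix.det (Matrix.of fun j k : Fin l => g (v j) (u k) / h (v j) (u k))) * (s1 * (Equiv.Perm.sign ρ : ℤ) * (Equiv.Perm.sign ρ : ℤ) + s2)

lemma IsRational.izergin_congr {l l' : ℕ} {v u : Fin l → σ} {v' u' : Fin l' → σ}
    (hv : Function.Injective v) (hv' : Function.Injective v') (hu : Function.Injective u)
    (hu' : Function.Injective u') (hvv : Set.range v = Set.range v')
    (huu : Set.range u = Set.range u') : izergin g h v u = izergin g h v' u' := by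
  have key : ∀ {l l' : ℕ} {v : Fin l → σ} {v' : Fin l' → σ}, Function.Injective v →
      Function.Injective v' → Set.range v = Set.range v' →
        ∃ π : Fin l ≃ Fin l', v = v' ∘ π := by
    intro l l' v v' hv hv' e
    refine ⟨((Equiv.ofInjective v hv).trans (Equiv.setCongr e)).trans
      (Equiv.ofInjective v' hv').symm, funext fun i => ?_⟩
    have := Equiv.apply_ofInjective_symm hv' (Equiv.setCongr e (Equiv.ofInjective v hv i))
    simpa using this.symm
  obtain ⟨π, hπ⟩ := key hv hv' hvv
  obtain ⟨ρ, hρ⟩ := key hu hu' huu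
  obtain rfl : l = l' := by simpa using Fintype.card_congr π
  rw [hπ, hρ, H.izergin_comp]

omit H in
lemma prod_Iio_fin_succ {l : ℕ} (w : Fin (l + 1) → F) (i : Fin l) :
    ∏ k ∈ Iio i.succ, w k = w 0 * ∏ k ∈ Iio i, w k.succ := by
  have : Iio i.succ = Finset.cons 0 ((Iio i).map (Fin.succEmb l)) (by simp) := by
    ext k
    refine Fin.cases ?_ (fun k => ?_) k
    · simp
    · simp
  rw [this, prod_cons, prod_map]; rfl

/-- The expansion of the determinant along the first row. -/
lemma IsRational.izergin_row {l : ℕ} (z : σ) (x : Fin l → σ) (u : Fin (l + 1) → σ) :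
    (∏ j : Fin l, ∏ k ∈ Iio j, g (x j) (x k)) *
      (∏ j : Fin (l + 1), ∏ k ∈ Finset.Iio j, g (u k) (u j)) *
      (∏ j : Fin (l + 1), ∏ k : Fin (l + 1), h ((Fin.cons z x : Fin (l + 1) → σ) j) (u k)) *
      Matrix.det (Matrix.of fun j k : Fin (l + 1) => g ((Fin.cons z x : Fin (l + 1) → σ) j) (u k) /
        h ((Fin.cons z x : Fin (l + 1) → σ) j) (u k)) = ∑ j, g z (u j) *
      ((∏ k, h z (u (j.succAbove k))) * ((∏ i, h (x i) (u j)) *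
        (∏ k, g (u j) (u (j.succAbove k))) * izergin g h x (u ∘ j.succAbove))) := by
  have e2 : ∀ w : Fin (l + 1) → σ, ∏ j : Fin (l + 1), ∏ k ∈ Iio j, g (w k) (w j) =
      (∏ i, g (w 0) (w (Fin.succ i))) * ∏ j : Fin l, ∏ k ∈ Iio j, g (w k.succ) (w j.succ) := by
    intro w
    rw [Fin.prod_univ_succ, ← prod_mul_distrib]
    have h0 : Iio (0 : Fin (l + 1)) = ∅ := by ext; simp
    simp [prod_Iio_fin_succ, prod_mul_distrib, h0]
  have e3 : ∀ j : Fin (l + 1), (∏ j : Fin (l + 1), ∏ k ∈ Iio j, g (u k) (u j)) * (-1) ^ (j : ℕ) =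
      (∏ i, g (u j) (u (j.succAbove i))) *
        ∏ i : Fin l, ∏ k ∈ Iio i, g (u (j.succAbove k)) (u (j.succAbove i)) := by
    intro j
    have := Equiv.Perm.prod_Iio_comp_eq_sign_mul_prod (Fin.cycleRange j).symm
      (f := fun i j => g (u i) (u j)) (fun i j => H.anti _ _)
    rw [e2 (fun i => u ((Fin.cycleRange j).symm i))] at this
    simp only [Fin.cycleRange_symm_zero, Fin.cycleRange_symm_succ, Equiv.Perm.sign_symm,
      Fin.sign_cycleRange] at this
    rw [this]
    push_cast
    ring
  rw [Matrix.det_succ_row_zero, mul_sum]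
  refine sum_congr rfl fun j _ => ?_
  have e4 : (∏ i : Fin (l + 1), ∏ k : Fin (l + 1), h ((Fin.cons z x : Fin (l + 1) → σ) i) (u k)) =
      h z (u j) * (∏ k, h z (u (j.succAbove k))) * ((∏ i, h (x i) (u j)) *
        ∏ i, ∏ k, h (x i) (u (j.succAbove k))) := by
    rw [Fin.prod_univ_succ, ← prod_mul_distrib]
    simp only [Fin.cons_zero, Fin.cons_succ]
    simp only [Fin.prod_univ_succAbove _ j]
  have e5 : (Matrix.of fun j k : Fin (l + 1) => g ((Fin.cons z x : Fin (l + 1) → σ) j) (u k) /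
      h ((Fin.cons z x : Fin (l + 1) → σ) j) (u k)).submatrix Fin.succ j.succAbove =
      Matrix.of fun i k : Fin l => g (x i) (u (j.succAbove k)) / h (x i) (u (j.succAbove k)) := by
    ext i k
    simp
  have e6 := e3 j
  have e7 := H.h_ne z (u j)
  rw [e4, e5, izergin]
  simp only [Matrix.of_apply, Fin.cons_zero, Function.comp_apply]
  generalize (Matrix.of fun i k : Fin l => g (x i) (u (j.succAbove k)) /
    h (x i) (u (j.succAbove k))).det = d
  have e8 : g z (u j) / h z (u j) * h z (u j) = g z (u j) := div_mul_cancel₀ _ e7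
  linear_combination (norm := ring1) ((∏ j : Fin l, ∏ k ∈ Iio j, g (x j) (x k)) *
    (∏ k, h z (u (j.succAbove k))) * (∏ i, h (x i) (u j)) *
        (∏ i, ∏ k, h (x i) (u (j.succAbove k))) * d) * (e6 * g z (u j) +
     (∏ j : Fin (l + 1), ∏ k ∈ Iio j, g (u k) (u j)) * (-1) ^ (j : ℕ) * e8)

lemma IsRational.izergin_cons {l : ℕ} (z : σ) (x : Fin l → σ) (u : Fin (l + 1) → σ) :
    izergin g h (Fin.cons z x : Fin (l + 1) → σ) u = (∏ i, g (x i) z) * ∑ j, g z (u j) *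
      ((∏ k, h z (u (j.succAbove k))) * ((∏ i, h (x i) (u j)) *
        (∏ k, g (u j) (u (j.succAbove k))) * izergin g h x (u ∘ j.succAbove))) := by
  have e1 : ∏ j : Fin (l + 1), ∏ k ∈ Iio j, g ((Fin.cons z x : Fin (l + 1) → σ) j)
      ((Fin.cons z x : Fin (l + 1) → σ) k) =
      (∏ i, g (x i) z) * ∏ j : Fin l, ∏ k ∈ Iio j, g (x j) (x k) := by
    rw [Fin.prod_univ_succ, ← prod_mul_distrib]
    have h0 : Iio (0 : Fin (l + 1)) = ∅ := by ext; simp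
    simp [prod_Iio_fin_succ, prod_mul_distrib, h0]
  rw [← H.izergin_row, izergin, e1]; ring

lemma IsRational.izergin_recursion {l : ℕ} {z : σ} {x : Fin l → σ} {u : Fin (l + 1) → σ}
    (hx : Function.Injective x) (hu : Function.Injective u) (hxz : ∀ i, x i ≠ z)
    (huz : ∀ j, u j ≠ z) (hxu : ∀ i j, x i ≠ u j) :
    izergin g h (Fin.cons z x : Fin (l + 1) → σ) u = ∑ j, g z (u j) *
      ((∏ k, (1 + g (u j) (u (j.succAbove k)))) * (∏ i, (1 + g (x i) (u j))) *
        izergin g h x (u ∘ j.succAbove)) := by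
  classical
  have hc := H.c_ne
  set A : Fin (l + 1) → F := fun j => (∏ i, h (x i) (u j)) *
        (∏ k, g (u j) (u (j.succAbove k))) * izergin g h x (u ∘ j.succAbove) with hA
  set p : F[X] := ∑ j, C (A j) *
    ∏ k, (C c⁻¹ * (X - C (s (u (j.succAbove k)))) *
      (C c⁻¹ * (X - C (s (u (j.succAbove k))) + C c))) with hp
  have hpe : ∀ y, p.eval (s y) = ∑ j, A j *
      ∏ k, (c⁻¹ * (s y - s (u (j.succAbove k))) * h y (u (j.succAbove k))) := by
    intro y
    simp only [hp, eval_finsetSum, eval_mul, eval_C, eval_prod, eval_sub, eval_X, eval_add, H.h_def]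
    refine sum_congr rfl fun j _ => ?_
    congr 1
    exact prod_congr rfl fun k _ => by ring
  have hg : ∀ {y w}, y ≠ w → c⁻¹ * (s y - s w) * g y w = 1 := by
    intro y w hyw
    have := H.sub_ne hyw
    rw [H.g_def]; field_simp
  have hpz : ∀ y, (∀ j, u j ≠ y) → p.eval (s y) * ∏ k, g y (u k) =
      ∑ j, g y (u j) * ((∏ k, h y (u (j.succAbove k))) * A j) := by
    intro y hy
    rw [hpe, sum_mul]
    refine sum_congr rfl fun j _ => ?_
    rw [Fin.prod_univ_succAbove _ j]
    have : ∏ k, (c⁻¹ * (s y - s (u (j.succAbove k))) * h y (u (j.succAbove k))) *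
      g y (u (j.succAbove k)) = ∏ k, h y (u (j.succAbove k)) :=
      prod_congr rfl fun k _ => by rw [mul_right_comm, hg (hy _).symm, one_mul]
    rw [← this, prod_mul_distrib (f := fun k => c⁻¹ * (s y - s (u (j.succAbove k))) *
      h y (u (j.succAbove k)))]; ring
  have hpx : ∀ i, p.eval (s (x i)) = 0 := by
    intro i
    have h1 := hpz (x i) (fun j => (hxu i j).symm)
    have hne : ∏ k, g (x i) (u k) ≠ 0 := prod_ne_zero_iff.2 fun k _ => H.g_ne (hxu i k)
    have h2 : (Matrix.of fun j k : Fin (l + 1) => g ((Fin.cons (x i) x : Fin (l + 1) → σ) j) (u k) /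
      h ((Fin.cons (x i) x : Fin (l + 1) → σ) j) (u k)).det = 0 :=
      Matrix.det_zero_of_row_eq (i := 0) (j := i.succ) (Fin.succ_ne_zero i).symm
        (by funext k; simp)
    have h3 := H.izergin_row (x i) x u
    rw [h2, mul_zero] at h3
    rw [← h3] at h1
    exact (mul_eq_zero.1 h1).resolve_right hne
  have hdeg : p.degree < ((univ.image u ∪ univ.image x).card : ℕ) := by
    have hd : Disjoint (univ.image u) (univ.image x) := by
      simp only [disjoint_left, mem_image, mem_univ, true_and]
      rintro _ ⟨j, rfl⟩ ⟨i, hi⟩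
      exact hxu i j hi
    rw [card_union_of_disjoint hd, card_image_of_injective _ hu, card_image_of_injective _ hx,
      card_univ, card_univ, Fintype.card_fin, Fintype.card_fin, hp]
    have hlt : ((l + l : ℕ) : WithBot ℕ) < ((l + 1 + l : ℕ) : WithBot ℕ) := by
      exact_mod_cast (by omega : l + l < l + 1 + l)
    refine lt_of_le_of_lt (degree_sum_le _ _) ((Finset.sup_lt_iff (by simp)).2 fun j _ => ?_)
    refine lt_of_le_of_lt (degree_mul_le _ _) (lt_of_le_of_lt (add_le_add degree_C_le
      (degree_prod_le _ _)) ?_)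
    rw [zero_add]
    refine lt_of_le_of_lt (sum_le_sum (g := fun _ => ((2 : ℕ) : WithBot ℕ)) fun k _ => ?_) ?_
    · compute_degree
      exact le_rfl
    · rw [sum_const, card_univ, Fintype.card_fin, nsmul_eq_mul, ← Nat.cast_mul]
      refine lt_of_le_of_lt (le_of_eq ?_) hlt
      congr 1; omega
  have hzm : z ∉ univ.image u ∪ univ.image x := by
    simp only [mem_union, mem_image, mem_univ, true_and, not_or, not_exists]
    exact ⟨huz, hxz⟩
  have hd : Disjoint (univ.image u) (univ.image x) := by
    simp only [disjoint_left, mem_image, mem_univ, true_and]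
    rintro _ ⟨j, rfl⟩ ⟨i, hi⟩
    exact hxu i j hi
  have hL := H.interpolate p _ hdeg hzm
  rw [sum_union hd, prod_union hd, prod_image hu.injOn, prod_image hx.injOn,
    sum_image hu.injOn, sum_image hx.injOn] at hL
  simp only [hpx, mul_zero, sum_const_zero, add_zero] at hL
  have hgz : ∏ k, g (u k) z = (-1) ^ (l + 1) * ∏ k, g z (u k) := by
    have : ((-1 : F)) ^ (l + 1) = ∏ _k : Fin (l + 1), (-1 : F) := by simp
    rw [this, ← prod_mul_distrib]
    exact prod_congr rfl fun k _ => by rw [H.anti, neg_one_mul]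
  have hK : izergin g h (Fin.cons z x : Fin (l + 1) → σ) u =
      (-1) ^ (l + 1) * (p.eval (s z) * ((∏ k, g (u k) z) * ∏ i, g (x i) z)) := by
    have e1 : ((-1 : F)) ^ (l + 1) * (-1) ^ (l + 1) = 1 := by
      rw [← mul_pow]; simp
    rw [H.izergin_cons, ← hpz z huz, hgz]
    linear_combination (-(∏ i, g (x i) z) * p.eval (s z) * ∏ k, g z (u k)) * e1
  rw [hK, hL, mul_sum]
  refine sum_congr rfl fun j _ => ?_
  have e1 : (univ.image u ∪ univ.image x).erase (u j) =
      univ.image (u ∘ j.succAbove) ∪ univ.image x := by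
    ext y
    simp only [mem_erase, mem_union, mem_image, mem_univ, true_and, Function.comp_apply]
    constructor
    · rintro ⟨hy, ⟨k, rfl⟩ | hk⟩
      · obtain ⟨k, rfl⟩ := Fin.exists_succAbove_eq (x := k) (y := j) (by rintro rfl; exact hy rfl)
        exact Or.inl ⟨k, rfl⟩
      · exact Or.inr hk
    · rintro (⟨k, rfl⟩ | ⟨k, rfl⟩)
      · exact ⟨fun e => Fin.succAbove_ne j k (hu e), Or.inl ⟨_, rfl⟩⟩
      · exact ⟨hxu k j, Or.inr ⟨k, rfl⟩⟩
  have hd' : Disjoint (univ.image (u ∘ j.succAbove)) (univ.image x) := by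
    refine disjoint_of_subset_left ?_ hd
    intro y
    simp only [mem_image, mem_univ, true_and, Function.comp_apply]
    rintro ⟨k, rfl⟩
    exact ⟨_, rfl⟩
  have e2 : p.eval (s (u j)) = A j * ∏ k, (c⁻¹ * (s (u j) - s (u (j.succAbove k))) *
      h (u j) (u (j.succAbove k))) := by
    rw [hpe]
    refine sum_eq_single j (fun i _ hij => ?_) (by simp)
    obtain ⟨k, hk⟩ := Fin.exists_succAbove_eq (x := j) (y := i) hij.symm
    rw [prod_eq_zero (mem_univ k) (by rw [hk]; ring), mul_zero]
  have hju : ∀ k, u j ≠ u (j.succAbove k) := fun k e => Fin.succAbove_ne j k (hu e).symm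
  have e3 : (∏ k, g (u (j.succAbove k)) (u j)) *
      ∏ k, (c⁻¹ * (s (u j) - s (u (j.succAbove k))) * h (u j) (u (j.succAbove k))) =
      (-1) ^ l * ∏ k, h (u j) (u (j.succAbove k)) := by
    have : ((-1 : F)) ^ l = ∏ _k : Fin l, (-1 : F) := by simp
    rw [this, ← prod_mul_distrib, ← prod_mul_distrib]
    refine prod_congr rfl fun k _ => ?_
    have := hg (hju k)
    rw [H.anti]
    linear_combination (-h (u j) (u (j.succAbove k))) * this
  have e4 : ∏ k, (1 + g (u j) (u (j.succAbove k))) =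
      (∏ k, g (u j) (u (j.succAbove k))) * ∏ k, h (u j) (u (j.succAbove k)) := by
    rw [← prod_mul_distrib]
    exact prod_congr rfl fun k _ => (H.g_mul_h (hju k)).symm
  have e5 : ∏ i, (1 + g (x i) (u j)) = (∏ i, g (x i) (u j)) * ∏ i, h (x i) (u j) := by
    rw [← prod_mul_distrib]
    exact prod_congr rfl fun k _ => (H.g_mul_h (hxu k j)).symm
  have e6 : ((-1 : F)) ^ (l + 1) * (-1) ^ l = -1 := by
    rw [pow_succ, mul_right_comm, ← mul_pow]; simp
  rw [e1, prod_union hd', prod_image (hu.comp Fin.succAbove_right_injective).injOn,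
    prod_image hx.injOn, e2, e4, e5, H.anti (u j) z]
  simp only [Function.comp_apply, hA]
  generalize izergin g h x (u ∘ j.succAbove) = κ at *
  linear_combination (norm := ring1) (-(-1) ^ (l + 1) * g z (u j) * (∏ i, g (x i) (u j)) *
    ((∏ i, h (x i) (u j)) * (∏ k, g (u j) (u (j.succAbove k))) * κ)) * e3 -
    g z (u j) * (∏ i, g (x i) (u j)) * (∏ k, h (u j) (u (j.succAbove k))) *
    ((∏ i, h (x i) (u j)) * (∏ k, g (u j) (u (j.succAbove k))) * κ) * e6

omit H in
/-- `K(I|J)` for sets of parameters. -/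
noncomputable def izerginSet (g h : σ → σ → F) (I J : Finset σ) : F :=
  if e : I.card = J.card then
    izergin g h (fun i : Fin I.card => (I.equivFin.symm i : σ))
      (fun i => (J.equivFin.symm (Fin.cast e i) : σ))
  else 0

omit H in
lemma range_equivFin_symm (I : Finset σ) :
    Set.range (fun i : Fin I.card => (I.equivFin.symm i : σ)) = I := by
  ext x
  simp only [Set.mem_range, mem_coe]
  exact ⟨by rintro ⟨i, rfl⟩; exact (I.equivFin.symm i).2, fun hx => ⟨I.equivFin ⟨x, hx⟩, by simp⟩⟩

lemma IsRational.izerginSet_eq {l : ℕ} {v u : Fin l → σ} (hv : Function.Injective v)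
    (hu : Function.Injective u) {I J : Finset σ} (hI : Set.range v = I) (hJ : Set.range u = J) :
    izerginSet g h I J = izergin g h v u := by
  classical
  have c1 : I.card = l := by
    rw [← Set.ncard_coe_finset, ← hI, ← Set.image_univ, Set.ncard_image_of_injective _ hv]
    simp [Set.ncard_univ]
  have c2 : J.card = l := by
    rw [← Set.ncard_coe_finset, ← hJ, ← Set.image_univ, Set.ncard_image_of_injective _ hu]
    simp [Set.ncard_univ]
  have e : I.card = J.card := c1.trans c2.symm
  rw [izerginSet, dif_pos e]
  refine H.izergin_congr (Subtype.val_injective.comp I.equivFin.symm.injective) hv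
    ((Subtype.val_injective.comp J.equivFin.symm.injective).comp (Fin.cast_injective e)) hu
    (by rw [range_equivFin_symm, hI]) ?_
  rw [hJ, ← range_equivFin_symm J]
  ext x
  simp only [Set.mem_range]
  exact ⟨fun ⟨i, hi⟩ => ⟨Fin.cast e i, hi⟩, fun ⟨i, hi⟩ => ⟨Fin.cast e.symm i, by simpa using hi⟩⟩

variable [DecidableEq σ] {D E : Set σ}

lemma IsRational.expansionData (hDE : D ⊆ E) :
    IsExpansionData D E g h g (-1) g h 1 (fun _ _ => 1) (fun x y => 1 + g x y) h
      (fun I J => (∏ x ∈ I, ∏ j ∈ J, g j x) * ∏ x ∈ I, ∏ y ∈ I, h x y) where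
  sub := hDE
  weights := H.isWeights E
  weights' := H.isWeights E
  tg _ _ := one_mul _
  b_mul _ _ _ := by ring
  b_mul' _ _ _ := by ring
  q_mul _ _ _ := mul_one _
  empty := by simp
  kap_insert {z I J} hz hzD hI hzI hJ hc := by
    have hcc := H.c_ne
    have hzJ : z ∉ J := fun h => hzD (hJ z h)
    have hL := H.interpolate (∏ x ∈ I, C c⁻¹ * (X - C (s x) + C c)) J (by
      rw [hc]
      refine lt_of_le_of_lt (degree_prod_le _ _) ?_
      refine lt_of_le_of_lt (sum_le_sum (g := fun _ => ((1 : ℕ) : WithBot ℕ)) fun k _ => ?_) ?_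
      · compute_degree
        exact le_rfl
      · rw [sum_const, nsmul_eq_mul, ← Nat.cast_mul, mul_one]
        exact_mod_cast Nat.lt_succ_self _) hzJ
    have he : ∀ y, (∏ x ∈ I, C c⁻¹ * (X - C (s x) + C c)).eval (s y) = ∏ x ∈ I, h y x := by
      intro y
      simp only [eval_mul, eval_C, eval_prod, eval_sub, eval_X, eval_add, H.h_def]
      exact prod_congr rfl fun k _ => by ring
    simp only [he] at hL
    have hzz : h z z = 1 := by rw [H.h_def]; field_simp; ring
    have e1 : ∀ x ∈ I, ∏ y ∈ insert z I, h x y = h x z * ∏ y ∈ I, h x y := fun x _ =>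
      prod_insert hzI
    have e2 : ∀ j ∈ J, (∏ x ∈ I, (1 + g j x)) * ∏ x ∈ I, ∏ j ∈ J.erase j, g j x =
        (∏ x ∈ I, h j x) * ∏ x ∈ I, ∏ j ∈ J, g j x := by
      intro j hj
      rw [← prod_mul_distrib, ← prod_mul_distrib]
      refine prod_congr rfl fun x hx => ?_
      rw [← mul_prod_erase J _ hj, ← H.g_mul_h (by rintro rfl; exact (hI _ hx).2 (hJ _ hj))]
      ring
    rw [prod_insert hzI, prod_insert hzI, prod_congr rfl e1, prod_insert hzI, prod_mul_distrib, hzz]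
    have e3 : ∑ j ∈ J, g j z * ((∏ k ∈ J.erase j, g k j) * (∏ x ∈ I, (1 + g j x)) *
        ((∏ x ∈ I, ∏ j ∈ J.erase j, g j x) * ∏ x ∈ I, ∏ y ∈ I, h x y)) =
        (∑ j ∈ J, g j z * (∏ k ∈ J.erase j, g k j) * ∏ x ∈ I, h j x) *
          ((∏ x ∈ I, ∏ j ∈ J, g j x) * ∏ x ∈ I, ∏ y ∈ I, h x y) := by
      rw [sum_mul]
      refine sum_congr rfl fun j hj => ?_
      linear_combination (g j z * (∏ k ∈ J.erase j, g k j) * ∏ x ∈ I, ∏ y ∈ I, h x y) * e2 j hj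
    rw [e3, ← hL]; ring

lemma IsRational.expansionData' (hDE : D ⊆ E) :
    IsExpansionData D E (fun x y => g y x) (fun _ _ => 1) (fun x y => 1 + g y x) 1 g h (-1) h
      (fun x y => g y x) (fun _ _ => 1) (izerginSet g h) where
  sub := hDE
  weights := H.isWeights' E
  weights' := H.isWeights E
  tg x y := by rw [H.anti y x, neg_one_mul]
  b_mul _ _ hxy := by rw [← H.g_mul_h hxy, H.anti]; ring
  b_mul' _ _ hxy := H.g_mul_h hxy.symm
  q_mul _ _ _ := one_mul _
  empty := by
    rw [H.izerginSet_eq (l := 0) (v := Fin.elim0) (u := Fin.elim0) (fun i => i.elim0)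
      (fun i => i.elim0) (by simp) (by simp)]
    simp [izergin]
  kap_insert {z I J} hz hzD hI hzI hJ hc := by
    set x : Fin I.card → σ := fun i => (I.equivFin.symm i : σ) with hx
    set u : Fin (I.card + 1) → σ := fun i => (J.equivFin.symm (Fin.cast hc.symm i) : σ) with hu
    have xi : Function.Injective x := Subtype.val_injective.comp I.equivFin.symm.injective
    have ui : Function.Injective u :=
      (Subtype.val_injective.comp J.equivFin.symm.injective).comp (Fin.cast_injective hc.symm)
    have xr : Set.range x = I := range_equivFin_symm I
    have ur : Set.range u = J := by
      rw [← range_equivFin_symm J]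
      ext y
      simp only [Set.mem_range, hu]
      exact ⟨fun ⟨i, hi⟩ => ⟨Fin.cast hc.symm i, hi⟩,
        fun ⟨i, hi⟩ => ⟨Fin.cast hc i, by simpa using hi⟩⟩
    have xm : ∀ i, x i ∈ I := fun i => (I.equivFin.symm i).2
    have um : ∀ i, u i ∈ J := fun i => (J.equivFin.symm _).2
    have xI : univ.image x = I := by rw [← Finset.coe_inj, coe_image, coe_univ, Set.image_univ, xr]
    have uJ : univ.image u = J := by rw [← Finset.coe_inj, coe_image, coe_univ, Set.image_univ, ur]
    have xz : ∀ i, x i ≠ z := fun i e => hzI (e ▸ xm i)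
    have sJ : ∀ f : σ → F, ∑ j ∈ J, f j = ∑ i, f (u i) := fun f => by
      rw [← uJ, sum_image ui.injOn]
    have pI : ∀ f : σ → F, ∏ j ∈ I, f j = ∏ i, f (x i) := fun f => by
      conv_lhs => rw [← xI, prod_image xi.injOn]
    have eJ : ∀ j, J.erase (u j) = univ.image (u ∘ j.succAbove) := by
      intro j
      ext y
      simp only [← uJ, mem_erase, mem_image, mem_univ, true_and, Function.comp_apply]
      constructor
      · rintro ⟨hy, k, rfl⟩
        obtain ⟨k, rfl⟩ := Fin.exists_succAbove_eq (x := k) (y := j) (by rintro rfl; exact hy rfl)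
        exact ⟨k, rfl⟩
      · rintro ⟨k, rfl⟩
        exact ⟨fun e => Fin.succAbove_ne j k (ui e), _, rfl⟩
    have usi : ∀ j, Function.Injective (u ∘ Fin.succAbove j) := fun j =>
      ui.comp Fin.succAbove_right_injective
    have ci : Function.Injective (Fin.cons z x : Fin (I.card + 1) → σ) :=
      Fin.cons_injective_iff.2 ⟨by rintro ⟨i, hi⟩; exact xz i hi, xi⟩
    have k1 := H.izerginSet_eq (I := insert z I) ci ui
      (by rw [Fin.range_cons, xr, coe_insert]) ur
    have k2 : ∀ j, izerginSet g h I (J.erase (u j)) = izergin g h x (u ∘ j.succAbove) := fun j =>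
      H.izerginSet_eq xi (usi j) xr (by rw [eJ, coe_image, coe_univ, Set.image_univ])
    rw [k1, H.izergin_recursion xi ui xz (fun j e => hzD (hJ _ (e ▸ um j)))
      (fun i j e => (hI _ (xm i)).2 (e ▸ hJ _ (um j))), prod_const_one, one_mul, sJ]
    refine sum_congr rfl fun j _ => ?_
    rw [k2, pI, eJ, prod_image (usi j).injOn]
    rfl

end Rational
end SuperYangian

noncomputable section
namespace SuperYangian
open scoped BigOperators

section Series

variable {σ : Type*} [LinearOrder σ] [Finite σ] {m n : ℕ}

lemma sg_add (k l : ℕ) : sg (k + l) = sg k * sg l := pow_add _ _ _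

lemma sg_mul_self (k : ℕ) : sg k * sg k = 1 := by
  rw [sg, ← mul_pow]; simp

lemma sg_congr {k l : ℕ} (h : (k : ZMod 2) = (l : ZMod 2)) : sg k = sg l := by
  rw [sg, sg, neg_one_pow_eq_pow_mod_two (n := k), neg_one_pow_eq_pow_mod_two (n := l),
    (ZMod.natCast_eq_natCast_iff' k l 2).1 h]

/-- Scalar series as series over `Y(m|n)`. -/
def scalHom (m n : ℕ) (σ : Type*) [LinearOrder σ] [Finite σ] : KK σ →+* YY m n σ where
  toFun k := k.map (algebraMap ℂ (Yang m n))
  map_one' := HahnSeries.map_one (algebraMap ℂ (Yang m n)).toMonoidWithZeroHom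
  map_zero' := by ext; simp
  map_mul' _ _ := HahnSeries.map_mul (algebraMap ℂ (Yang m n)).toNonUnitalRingHom
  map_add' x y := by ext; simp

lemma scalHom_commute (k : KK σ) (X : YY m n σ) : scalHom m n σ k * X = X * scalHom m n σ k := by
  have h1 : (scalHom m n σ k).support ⊆ k.support := by
    intro a ha hk
    refine ha ?_
    change algebraMap ℂ (Yang m n) (k.coeff a) = 0
    rw [hk, map_zero]
  ext a
  rw [HahnSeries.coeff_mul_left' k.isPWO_support h1, HahnSeries.coeff_mul_right' k.isPWO_support h1]
  refine Finset.sum_bij' (fun p _ => p.swap) (fun p _ => p.swap) ?_ ?_ ?_ ?_ ?_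
  · rintro ⟨i, j⟩ h
    simp only [Finset.mem_antidiagonal, Prod.swap] at h ⊢
    exact ⟨h.2.1, h.1, by rw [add_comm]; exact h.2.2⟩
  · rintro ⟨i, j⟩ h
    simp only [Finset.mem_antidiagonal, Prod.swap] at h ⊢
    exact ⟨h.2.1, h.1, by rw [add_comm]; exact h.2.2⟩
  · intros; simp
  · intros; simp
  · rintro ⟨i, j⟩ _
    exact Algebra.commutes (R := ℂ) (A := Yang m n) (k.coeff i) (X.coeff j)

instance : Algebra (KK σ) (YY m n σ) := (scalHom m n σ).toAlgebra' scalHom_commute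

lemma scal_eq_smul (k : KK σ) (X : YY m n σ) : scal k X = k • X := rfl

lemma sg_smul {V : Type*} [AddCommGroup V] [Module ℂ V] {R : Type*} [Ring R] [Module R V] (k : ℕ)
    (X : V) : sg k • X = ((-1 : R) ^ k) • X := by
  rcases Nat.even_or_odd k with h | h <;> simp [sg, h.neg_one_pow]

instance : IsScalarTower ℂ (KK σ) (YY m n σ) := by
  constructor
  intro x y z
  rw [← scal_eq_smul, ← scal_eq_smul, scal, scal, ← smul_mul_assoc]
  congr 1
  ext a
  rw [HahnSeries.map_coeff, HahnSeries.coeff_smul, HahnSeries.coeff_smul, HahnSeries.map_coeff,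
    smul_eq_mul, map_mul, Algebra.smul_def]

lemma spec_injective : Function.Injective (spec : σ → KK σ) := by
  intro x y hxy
  by_contra hne
  have h1 := congrArg (fun k : KK σ => k.coeff (-(ee x))) hxy
  simp only [spec, HahnSeries.coeff_single_same] at h1
  rw [HahnSeries.coeff_single_of_ne] at h1
  · exact one_ne_zero h1
  · intro h
    have := congrFun (congrArg ofLex (neg_injective h)) x
    simp [ee, hne] at this

lemma spec_sub_ne_C (c : ℂ) {x y : σ} (hxy : x ≠ y) : spec x - spec y + HahnSeries.C c ≠ 0 := by
  intro h0
  have h1 := congrArg (fun k : KK σ => k.coeff (-(ee x))) h0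
  have hne : -ee x ≠ -ee y := by
    intro h
    have := congrFun (congrArg ofLex (neg_injective h)) x
    simp [ee, hxy] at this
  have hne' : -ee x ≠ 0 := neg_ne_zero.2 (ee_pos x).ne'
  simp [spec, HahnSeries.coeff_single_of_ne hne, HahnSeries.C_apply,
    HahnSeries.coeff_single_of_ne hne'] at h1

lemma isRational_spec {c : ℂ} (hc : c ≠ 0) :
    IsRational (spec : σ → KK σ) (HahnSeries.C c) (g c) (h c) where
  inj := spec_injective
  c_ne := HahnSeries.C_ne_zero hc
  g_def _ _ := rfl
  h_def _ _ := rfl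
  h_ne x y := by
    refine div_ne_zero ?_ (HahnSeries.C_ne_zero hc)
    by_cases hxy : x = y
    · rw [hxy, sub_self, zero_add]; exact HahnSeries.C_ne_zero hc
    · exact spec_sub_ne_C c hxy

/-- The coefficient of `u^{-k}` in `T_{ij}(u)`. -/
def tCoeff (c : ℂ) (i j : Fin (m + n)) (k : ℤ) : Yang m n :=
  if 0 ≤ k then c ^ k.toNat • Tc i j k.toNat else 0

lemma substInv_coeff {A : Type*} [Semiring A] (u : σ) (p : PowerSeries A) (r : ℕ) :
    (substInv A u p).coeff (r • ee u) = PowerSeries.coeff r p := by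
  have : ∀ x : HahnSeries ℕ A, ∀ hi hf,
      ((HahnSeries.embDomainRingHom (multiplesHom (Expo σ) (ee u)) hi hf) x).coeff
        (r • ee u) = x.coeff r := fun x hi hf => HahnSeries.embDomain_coeff
  exact (this _ _ _).trans HahnSeries.coeff_toPowerSeries_symm

lemma substInv_coeff_of_ne {A : Type*} [Semiring A] (u : σ) (p : PowerSeries A) {a : Expo σ}
    (ha : ∀ r : ℕ, a ≠ r • ee u) : (substInv A u p).coeff a = 0 := by
  rw [substInv, RingHom.comp_apply]
  refine HahnSeries.embDomain_of_notMem_range ?_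
  rintro ⟨r, hr⟩
  exact ha r hr.symm

omit [Finite σ] in
lemma ofLex_zsmul_ee (k : ℤ) (u v : σ) : ofLex (k • ee u) v = if v = u then k else 0 := by
  change k • (Pi.single u (1 : ℤ) : σ → ℤ) v = _
  by_cases h : v = u
  · subst h; simp
  · simp [h]

lemma T_coeff (c : ℂ) (i j : Fin (m + n)) (u : σ) (a : Expo σ) :
    (T c i j u).coeff a = if a = ofLex a u • ee u then tCoeff c i j (ofLex a u) else 0 := by
  by_cases ha : ∃ r : ℕ, a = r • ee u
  · obtain ⟨r, rfl⟩ := ha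
    have h1 : ofLex (r • ee u) u = (r : ℤ) := by
      rw [← natCast_zsmul, ofLex_zsmul_ee, if_pos rfl]
    rw [h1, natCast_zsmul, if_pos rfl, T, substInv_coeff]
    simp [tCoeff]
  · push Not at ha
    rw [T, substInv_coeff_of_ne u _ ha]
    split_ifs with h
    · rw [tCoeff, if_neg]
      intro h0
      refine ha (ofLex a u).toNat ?_
      conv_lhs => rw [h]
      rw [← natCast_zsmul, Int.toNat_of_nonneg h0]
    · rfl

lemma T_mul_T_coeff (c : ℂ) (i j k l : Fin (m + n)) {z w : σ} (hzw : z ≠ w) (a : Expo σ) :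
    (T c i j z * T c k l w).coeff a =
      if a = ofLex a z • ee z + ofLex a w • ee w then
        tCoeff c i j (ofLex a z) * tCoeff c k l (ofLex a w) else 0 := by
  have key : ∀ p q : Expo σ, p = ofLex p z • ee z → q = ofLex q w • ee w → p + q = a →
      p = ofLex a z • ee z ∧ q = ofLex a w • ee w := by
    intro p q hp hq hpq
    have h1 : ofLex a z = ofLex p z := by
      rw [← hpq, hq, ofLex_add, Pi.add_apply, ofLex_zsmul_ee, if_neg hzw, add_zero]
    have h2 : ofLex a w = ofLex q w := by
      rw [← hpq, hp, ofLex_add, Pi.add_apply, ofLex_zsmul_ee, if_neg hzw.symm, zero_add]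
    rw [h1, h2]; exact ⟨hp, hq⟩
  have hs : ∀ {u : σ} {i j : Fin (m + n)} {p : Expo σ}, (T c i j u).coeff p ≠ 0 →
      p = ofLex p u • ee u := by
    intro u i j p hp
    by_contra h
    exact hp (by rw [T_coeff, if_neg h])
  have hc : ∀ (u : σ) (k : ℤ) (i j : Fin (m + n)), (T c i j u).coeff (k • ee u) = tCoeff c i j k := by
    intro u k i j
    have : ofLex (k • ee u) u = k := by rw [ofLex_zsmul_ee, if_pos rfl]
    rw [T_coeff, this, if_pos rfl]
  rw [HahnSeries.coeff_mul]
  split_ifs with h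
  · rw [Finset.sum_eq_single (ofLex a z • ee z, ofLex a w • ee w)]
    · rw [hc, hc]
    · rintro ⟨p, q⟩ hpq hne
      simp only [Finset.mem_antidiagonal] at hpq
      obtain ⟨h1, h2⟩ := key p q (hs hpq.1) (hs hpq.2.1) hpq.2.2
      exact absurd (by rw [h1, h2]) hne
    · intro hn
      simp only [Finset.mem_antidiagonal, not_and, HahnSeries.mem_support] at hn
      by_contra h0
      exact hn (left_ne_zero_of_mul h0) (right_ne_zero_of_mul h0) h.symm
  · refine Finset.sum_eq_zero ?_
    rintro ⟨p, q⟩ hpq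
    simp only [Finset.mem_antidiagonal] at hpq
    obtain ⟨h1, h2⟩ := key p q (hs hpq.1) (hs hpq.2.1) hpq.2.2
    exact absurd (by rw [← h1, ← h2, hpq.2.2]) h

lemma tCoeff_zero_comm (c : ℂ) (i j k l : Fin (m + n)) (r : ℤ) :
    tCoeff c i j 0 * tCoeff c k l r =
      sg ((par i + par j) * (par k + par l)) • (tCoeff c k l r * tCoeff c i j 0) := by
  by_cases hij : i = j
  · subst hij
    have : sg ((par i + par i) * (par k + par l)) = 1 := by
      rw [← two_mul, mul_assoc, sg, pow_mul]; simp
    simp [tCoeff, Tc, freeT, this]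
  · simp [tCoeff, Tc, freeT, hij]

lemma tCoeff_rel (c : ℂ) (i j k l : Fin (m + n)) (r s : ℤ) :
    (tCoeff c i j (r + 1) * tCoeff c k l s
        - sg ((par i + par j) * (par k + par l)) • (tCoeff c k l s * tCoeff c i j (r + 1)))
      - (tCoeff c i j r * tCoeff c k l (s + 1)
        - sg ((par i + par j) * (par k + par l)) • (tCoeff c k l (s + 1) * tCoeff c i j r))
      = c • sg (par l * (par i + par j) + par i * par j) •
          (tCoeff c i l r * tCoeff c k j s - tCoeff c i l s * tCoeff c k j r) := by
  have neg : ∀ {i j : Fin (m + n)} {t : ℤ}, t < 0 → tCoeff c i j t = 0 := fun ht => by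
    rw [tCoeff, if_neg (by omega)]
  have zero' : ∀ r : ℤ, tCoeff c i j r * tCoeff c k l 0 =
      sg ((par i + par j) * (par k + par l)) • (tCoeff c k l 0 * tCoeff c i j r) := by
    intro r
    rw [tCoeff_zero_comm, smul_smul, mul_comm (par k + par l), sg_mul_self, one_smul]
  rcases lt_trichotomy r (-1) with hr | hr | hr
  · simp [neg (show r < 0 by omega), neg (show r + 1 < 0 by omega)]
  · subst hr
    rw [neg_add_cancel, tCoeff_zero_comm]
    simp [neg (show (-1 : ℤ) < 0 by omega)]
  · rcases lt_trichotomy s (-1) with hs | hs | hs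
    · simp [neg (show s < 0 by omega), neg (show s + 1 < 0 by omega)]
    · subst hs
      rw [neg_add_cancel, zero']
      simp [neg (show (-1 : ℤ) < 0 by omega)]
    · obtain ⟨r, rfl⟩ := Int.eq_ofNat_of_zero_le (show 0 ≤ r by omega)
      obtain ⟨s, rfl⟩ := Int.eq_ofNat_of_zero_le (show 0 ≤ s by omega)
      have hn : ∀ (t : ℕ) (i j : Fin (m + n)), tCoeff c i j (t : ℤ) = c ^ t • Tc i j t := by
        intro t i j; simp [tCoeff]
      have hn' : ∀ (t : ℕ) (i j : Fin (m + n)),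
          tCoeff c i j ((t : ℤ) + 1) = c ^ (t + 1) • Tc i j (t + 1) := fun t i j => hn (t + 1) i j
      have := congrArg (fun x => (c ^ (r + s + 1)) • x) (Tc_rel i j k l r s)
      simp only [hn, hn', smul_mul_smul_comm]
      simp only [smul_sub, smul_smul] at this ⊢
      convert this using 2
      · congr 2 <;> ring_nf
      · congr 2 <;> ring_nf
      · ring_nf
      · ring_nf

/-- The commutation relations. -/
lemma T_comm (c : ℂ) (i j k l : Fin (m + n)) {z w : σ} (hzw : z ≠ w) :
    T c i j z * T c k l w - sg ((par i + par j) * (par k + par l)) • (T c k l w * T c i j z) =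
      sg (par l * (par i + par j) + par i * par j) •
        g c z w • (T c i l z * T c k j w - T c i l w * T c k j z) := by
  have hne : spec z - spec w ≠ 0 := sub_ne_zero.2 fun e => hzw (spec_injective e)
  have hsp : ∀ (u : σ) (X : YY m n σ) a, (spec u • X).coeff a = X.coeff (a + ee u) := by
    intro u X a
    have : (spec u).map (algebraMap ℂ (Yang m n)) = HahnSeries.single (-(ee u)) (1 : Yang m n) := by
      ext b
      simp only [spec, HahnSeries.map_coeff, HahnSeries.coeff_single]
      split_ifs <;> simp
    rw [← scal_eq_smul, scal, this, HahnSeries.coeff_single_mul, one_mul, sub_neg_eq_add]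
  have hC : ∀ X : YY m n σ, (HahnSeries.C c : KK σ) • X = c • X := by
    intro X
    rw [← one_smul (KK σ) X, ← smul_assoc c (1 : KK σ) X, smul_smul, mul_one]
    congr 1
    ext a
    simp [HahnSeries.C_apply, HahnSeries.coeff_single, HahnSeries.coeff_one]
  have main : (spec z - spec w) •
      (T c i j z * T c k l w - sg ((par i + par j) * (par k + par l)) • (T c k l w * T c i j z)) =
      c • sg (par l * (par i + par j) + par i * par j) •
        (T c i l z * T c k j w - T c i l w * T c k j z) := by
    ext a
    have s1 : ofLex (a + ee z) z = ofLex a z + 1 := by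
      rw [ofLex_add, Pi.add_apply]; simp [ee]
    have s2 : ofLex (a + ee z) w = ofLex a w := by
      rw [ofLex_add, Pi.add_apply]; simp [ee, hzw.symm]
    have s3 : ofLex (a + ee w) z = ofLex a z := by
      rw [ofLex_add, Pi.add_apply]; simp [ee, hzw]
    have s4 : ofLex (a + ee w) w = ofLex a w + 1 := by
      rw [ofLex_add, Pi.add_apply]; simp [ee]
    have e1 : a + ee z = (ofLex a z + 1) • ee z + ofLex a w • ee w ↔
        a = ofLex a z • ee z + ofLex a w • ee w := by
      rw [add_smul, one_smul, add_right_comm, add_left_inj]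
    have e2 : a + ee w = ofLex a z • ee z + (ofLex a w + 1) • ee w ↔
        a = ofLex a z • ee z + ofLex a w • ee w := by
      rw [add_smul, one_smul, ← add_assoc, add_left_inj]
    have e0 : ∀ X : YY m n σ, (spec z - spec w) • X = spec z • X - spec w • X :=
      fun X => sub_smul (spec z) (spec w) X
    rw [e0, HahnSeries.coeff_sub, hsp, hsp]
    simp only [HahnSeries.coeff_sub, HahnSeries.coeff_smul, T_mul_T_coeff c _ _ _ _ hzw,
      T_mul_T_coeff c _ _ _ _ hzw.symm, s1, s2, s3, s4,
      add_comm (ofLex a w • ee w), add_comm ((ofLex a w + 1) • ee w), e1, e2]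
    by_cases ha : a = ofLex a z • ee z + ofLex a w • ee w
    · simp only [if_pos ha]
      exact tCoeff_rel c i j k l _ _
    · simp only [if_neg ha]
      simp
  have e1 : ∀ X : YY m n σ, (spec z - spec w)⁻¹ • (spec z - spec w) • X = X :=
    fun X => inv_smul_smul₀ hne X
  have e2 : ∀ X : YY m n σ, g c z w • X = (spec z - spec w)⁻¹ • c • X := fun X => by
    rw [g, div_eq_mul_inv, mul_comm, ← hC]
    exact mul_smul (spec z - spec w)⁻¹ (HahnSeries.C c : KK σ) X
  rw [← e1 (_ - _), main, e2, smul_comm c (sg _)]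
  exact smul_comm _ _ _

end Series
end SuperYangian
end

namespace SuperYangian

section Graded

open Finset

variable {F A Q σ : Type*} [Field F] [Ring A] [Algebra F A] {N : ℕ}

lemma neg_one_pow_congr {k l : ℕ} (h : (k : ZMod 2) = (l : ZMod 2)) : (-1 : F) ^ k = (-1) ^ l := by
  rw [neg_one_pow_eq_pow_mod_two (n := k), neg_one_pow_eq_pow_mod_two (n := l),
    (ZMod.natCast_eq_natCast_iff' k l 2).1 h]

lemma two_eq_zero_zmod : (2 : ZMod 2) = 0 := rfl

/-- The degree of the matrix unit `E_{IJ}`. -/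
def gDeg (par : Q → ℕ) (I J : Fin N → Q) : ℕ := ∑ p, (par (I p) + par (J p))

/-- The exponent of the sign in `E_{IJ} E_{JL} = ± E_{IL}`. -/
def gExp (par : Q → ℕ) (I J L : Fin N → Q) : ℕ :=
  ∑ p : Fin N, ∑ q ∈ Ioi p, (par (I q) + par (J q)) * (par (J p) + par (L p))

/-- The graded tensor product of `N` matrix superalgebras and a superalgebra `A`, where the
involution `τ` of `A` is the grading automorphism. -/
def GMat (_par : Q → ℕ) (_τ : A →ₐ[F] A) (N : ℕ) : Type _ := (Fin N → Q) → (Fin N → Q) → A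

variable {par : Q → ℕ} {τ : A →ₐ[F] A}

lemma gDeg_add (I J L : Fin N → Q) :
    ((gDeg par I J + gDeg par J L : ℕ) : ZMod 2) = (gDeg par I L : ℕ) := by
  simp only [gDeg]
  push_cast
  rw [← sum_add_distrib]
  refine sum_congr rfl fun p _ => ?_
  linear_combination (par (J p) : ZMod 2) * two_eq_zero_zmod

lemma gExp_cocycle (I J K L : Fin N → Q) :
    ((gExp par I K L + gExp par I J K : ℕ) : ZMod 2) = (gExp par I J L + gExp par J K L : ℕ) := by
  simp only [gExp]
  push_cast
  simp only [← sum_add_distrib]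
  refine sum_congr rfl fun p _ => sum_congr rfl fun q _ => ?_
  linear_combination ((par (I q) : ZMod 2) * par (K p) - par (J q) * par (L p)) * two_eq_zero_zmod

lemma gExp_cast (I J L : Fin N → Q) : ((gExp par I J L : ℕ) : ZMod 2) =
    ∑ q, ((par (I q) : ZMod 2) + par (J q)) * ∑ p ∈ Iio q, ((par (J p) : ZMod 2) + par (L p)) := by
  simp only [gExp]
  push_cast
  rw [sum_comm' (t' := univ) (s' := fun q => Iio q) (by simp)]
  simp only [mul_sum]

lemma gExp_cast' (I J L : Fin N → Q) : ((gExp par I J L : ℕ) : ZMod 2) =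
    ∑ p, ((par (J p) : ZMod 2) + par (L p)) * ∑ q ∈ Ioi p, ((par (I q) : ZMod 2) + par (J q)) := by
  simp only [gExp]
  push_cast
  simp only [mul_sum]
  exact sum_congr rfl fun p _ => sum_congr rfl fun q _ => mul_comm _ _

lemma pow_congr_of_sq (hτ : τ * τ = 1) {k l : ℕ} (h : (k : ZMod 2) = (l : ZMod 2)) :
    τ ^ k = τ ^ l := by
  have key : ∀ k : ℕ, τ ^ k = τ ^ (k % 2) := fun k => by
    conv_lhs => rw [← Nat.div_add_mod k 2, pow_add, pow_mul, pow_two, hτ, one_pow, one_mul]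
  rw [key k, key l, (ZMod.natCast_eq_natCast_iff' k l 2).1 h]

variable [Fintype Q] [DecidableEq Q]

instance : Mul (GMat par τ N) where
  mul X Y I L := ∑ J, ((-1 : F) ^ gExp par I J L) • ((τ ^ gDeg par J L) (X I J) * Y J L)

instance : One (GMat par τ N) where
  one I J := if I = J then 1 else 0

omit [DecidableEq Q] in
lemma GMat.mul_apply (X Y : GMat par τ N) (I L : Fin N → Q) : (X * Y) I L =
    ∑ J, ((-1 : F) ^ gExp par I J L) • ((τ ^ gDeg par J L) (X I J) * Y J L) := rfl

omit [Fintype Q] in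
lemma GMat.one_apply (I J : Fin N → Q) : (1 : GMat par τ N) I J = if I = J then 1 else 0 := rfl

instance [hτ : Fact (τ * τ = 1)] : Monoid (GMat par τ N) where
  mul_assoc X Y Z := by
    funext I L
    simp only [GMat.mul_apply, map_sum, map_mul, map_smul, sum_mul, mul_sum, smul_sum]
    rw [sum_comm]
    refine sum_congr rfl fun J _ => sum_congr rfl fun K _ => ?_
    rw [smul_mul_assoc, mul_smul_comm, smul_smul, smul_smul, ← pow_add, ← pow_add,
      neg_one_pow_congr (gExp_cocycle I J K L), ← AlgHom.mul_apply, ← pow_add,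
      pow_congr_of_sq hτ.out (k := gDeg par K L + gDeg par J K) (l := gDeg par J L)
        (by rw [add_comm]; exact gDeg_add J K L), mul_assoc]
  one_mul X := by
    funext I L
    rw [GMat.mul_apply, sum_eq_single I]
    · have : gExp par I I L = 0 + gExp par I I L := (zero_add _).symm
      rw [neg_one_pow_congr (l := 0), pow_zero, one_smul, GMat.one_apply, if_pos rfl, map_one,
        one_mul]
      rw [gExp_cast]
      simp only [CharTwo.add_self_eq_zero, zero_mul, sum_const_zero, Nat.cast_zero]
    · intro J _ hJ
      rw [GMat.one_apply, if_neg hJ.symm, map_zero, zero_mul, smul_zero]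
    · simp
  mul_one X := by
    funext I L
    rw [GMat.mul_apply, sum_eq_single L]
    · rw [neg_one_pow_congr (l := 0), pow_zero, one_smul, GMat.one_apply, if_pos rfl,
        mul_one, pow_congr_of_sq hτ.out (l := 0), pow_zero, AlgHom.one_apply]
      · simp only [gDeg]
        push_cast
        simp only [CharTwo.add_self_eq_zero, sum_const_zero]
      · rw [gExp_cast']
        simp only [CharTwo.add_self_eq_zero, zero_mul, sum_const_zero, Nat.cast_zero]
    · intro J _ hJ
      rw [GMat.one_apply, if_neg hJ, mul_zero, smul_zero]
    · simp

lemma sum_eq_sum_update {M : Type*} [AddCommMonoid M] (I : Fin N → Q) (p : Fin N)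
    (f : (Fin N → Q) → M) (h : ∀ J, (∃ q, q ≠ p ∧ I q ≠ J q) → f J = 0) :
    ∑ J, f J = ∑ x, f (Function.update I p x) := by
  rw [← sum_image (s := univ) (g := Function.update I p) (f := f)
    (Function.update_injective I p).injOn]
  refine (sum_subset (subset_univ _) fun J _ hJ => h J ?_).symm
  by_contra hc
  push Not at hc
  refine hJ (mem_image.2 ⟨J p, mem_univ _, ?_⟩)
  funext q
  by_cases hq : q = p
  · subst hq; simp
  · rw [Function.update_of_ne hq, hc q hq]

omit [Fintype Q] [DecidableEq Q] in
lemma sum_update_cast (S : Finset (Fin N)) (I : Fin N → Q) (p : Fin N) (x : Q) :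
    ∑ t ∈ S, (par (Function.update I p x t) : ZMod 2) =
      ∑ t ∈ S, (par (I t) : ZMod 2) + if p ∈ S then (par (I p) : ZMod 2) + par x else 0 := by
  have : ∀ t ∈ S, (par (Function.update I p x t) : ZMod 2) = par (I t) +
      if t = p then (par (I p) : ZMod 2) + par x else 0 := by
    intro t _
    by_cases ht : t = p
    · subst ht
      simp only [Function.update_self, if_true]
      linear_combination -(par (I t) : ZMod 2) * two_eq_zero_zmod
    · rw [Function.update_of_ne ht, if_neg ht, add_zero]
  rw [sum_congr rfl this, sum_add_distrib, sum_ite_eq' S p]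

/-- `T_p(u)`. -/
def gT (par : Q → ℕ) (τ : A →ₐ[F] A) (T : Q → Q → A) (p : Fin N) : GMat par τ N := fun I J =>
  if ∀ q, q ≠ p → I q = J q then T (I p) (J p) else 0

/-- `1 + r P_{pq}`, for `p < q`. -/
def gR (par : Q → ℕ) (τ : A →ₐ[F] A) (r : F) (p q : Fin N) : GMat par τ N := fun I J =>
  (if I = J then 1 else 0) +
    r • if J = I ∘ Equiv.swap p q then algebraMap F A ((-1) ^ par (I q)) else 0

lemma gT_mul_apply {T : Q → Q → A} (hT : ∀ i j, τ (T i j) = ((-1 : F) ^ (par i + par j)) • T i j)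
    (p : Fin N) (Y : GMat par τ N) (I L : Fin N → Q) : (gT par τ T p * Y) I L =
      ∑ x, ((-1 : F) ^ ((par (I p) + par x) * (par x + par (L p) +
        ∑ t ∈ Ioi p, (par (I t) + par (L t))))) • (T (I p) x * Y (Function.update I p x) L) := by
  have hTk : ∀ (k : ℕ) i j, (τ ^ k) (T i j) = ((-1 : F) ^ ((par i + par j) * k)) • T i j := by
    intro k i j
    induction k with
    | zero => simp
    | succ k ih =>
      rw [pow_succ, AlgHom.mul_apply, hT, map_smul, ih, smul_smul, ← pow_add]
      congr 2; ring
  rw [GMat.mul_apply, sum_eq_sum_update I p]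
  · refine sum_congr rfl fun x _ => ?_
    rw [gT, if_pos (fun q hq => (Function.update_of_ne hq _ _).symm), Function.update_self, hTk,
      smul_mul_assoc, smul_smul, ← pow_add]
    congr 1
    refine neg_one_pow_congr ?_
    push_cast
    have h1 : ((gExp par I (Function.update I p x) L : ℕ) : ZMod 2) = (par (I p) + par x) *
        ∑ t ∈ Iio p, ((par (I t) : ZMod 2) + par (L t)) := by
      rw [gExp_cast, sum_eq_single p]
      · rw [Function.update_self, sum_add_distrib, sum_add_distrib, sum_update_cast]
        simp
      · intro q _ hq
        rw [Function.update_of_ne hq, CharTwo.add_self_eq_zero, zero_mul]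
      · simp
    have h2 : ((gDeg par (Function.update I p x) L : ℕ) : ZMod 2) = par x + par (L p) +
        (∑ t ∈ Iio p, ((par (I t) : ZMod 2) + par (L t)) +
          ∑ t ∈ Ioi p, ((par (I t) : ZMod 2) + par (L t))) := by
      simp only [gDeg]
      push_cast
      rw [sum_add_distrib, sum_update_cast, if_pos (mem_univ _)]
      have h3 : ∀ f : Fin N → ZMod 2, ∑ t, f t = f p + (∑ t ∈ Iio p, f t + ∑ t ∈ Ioi p, f t) := by
        intro f
        rw [← sum_erase_add univ f (mem_univ p), add_comm (f p)]
        congr 1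
        rw [← sum_union (disjoint_left.2 fun t h1 h2 => by
          rw [mem_Iio] at h1; rw [mem_Ioi] at h2; exact lt_asymm h1 h2)]
        congr 1
        ext t
        simp
      rw [h3 (fun t => (par (I t) : ZMod 2)), h3 (fun t => (par (L t) : ZMod 2)),
        sum_add_distrib, sum_add_distrib]
      linear_combination (par (I p) : ZMod 2) * two_eq_zero_zmod
    rw [h1, h2]
    linear_combination ((par (I p) + par x : ZMod 2) *
        ∑ t ∈ Iio p, ((par (I t) : ZMod 2) + par (L t))) * two_eq_zero_zmod
  · rintro J ⟨q, hq, hne⟩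
    rw [gT, if_neg (fun h => hne (h q hq)), map_zero, zero_mul, smul_zero]

omit [Fintype Q] [DecidableEq Q] in
lemma comp_swap_update (I : Fin N → Q) (p q : Fin N) :
    I ∘ Equiv.swap p q = Function.update (Function.update I q (I p)) p (I q) := Equiv.comp_swap_eq_update p q I

omit [Fintype Q] [DecidableEq Q] in
lemma comp_swap_comp_swap (I : Fin N → Q) (p q : Fin N) :
    (I ∘ Equiv.swap p q) ∘ Equiv.swap p q = I := by
  funext t; simp

lemma sum_Ioi_split {M : Type*} [AddCommMonoid M] {p q : Fin N} (hpq : p < q) (f : Fin N → M) :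
    ∑ t ∈ Ioi p, f t = ∑ t ∈ Ioo p q, f t + (f q + ∑ t ∈ Ioi q, f t) := by
  have h1 : Ioi p = Ioo p q ∪ insert q (Ioi q) := by
    ext t
    simp only [mem_Ioi, mem_union, mem_Ioo, mem_insert]
    constructor
    · intro h
      rcases lt_trichotomy t q with h' | h' | h'
      · exact Or.inl ⟨h, h'⟩
      · exact Or.inr (Or.inl h')
      · exact Or.inr (Or.inr h')
    · rintro (h | rfl | h)
      · exact h.1
      · exact hpq
      · exact hpq.trans h
  rw [h1, sum_union, sum_insert (by simp)]
  rw [disjoint_left]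
  intro t h2 h3
  simp only [mem_Ioo, mem_insert, mem_Ioi] at h2 h3
  rcases h3 with rfl | h3
  · exact lt_irrefl _ h2.2
  · exact lt_asymm h2.2 h3

lemma sum_Iio_split {M : Type*} [AddCommMonoid M] {p q : Fin N} (hpq : p < q) (f : Fin N → M) :
    ∑ t ∈ Iio q, f t = ∑ t ∈ Ioo p q, f t + (f p + ∑ t ∈ Iio p, f t) := by
  have h1 : Iio q = Ioo p q ∪ insert p (Iio p) := by
    ext t
    simp only [mem_Iio, mem_union, mem_Ioo, mem_insert]
    constructor
    · intro h
      rcases lt_trichotomy t p with h' | h' | h'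
      · exact Or.inr (Or.inr h')
      · exact Or.inr (Or.inl h')
      · exact Or.inl ⟨h', h⟩
    · rintro (h | rfl | h)
      · exact h.2
      · exact hpq
      · exact h.trans hpq
  rw [h1, sum_union, sum_insert (by simp)]
  rw [disjoint_left]
  intro t h2 h3
  simp only [mem_Ioo, mem_insert, mem_Iio] at h2 h3
  rcases h3 with rfl | h3
  · exact lt_irrefl _ h2.1
  · exact lt_asymm h2.1 h3

lemma gR_mul_apply [hτ : Fact (τ * τ = 1)] (r : F) {p q : Fin N} (hpq : p < q) (Y : GMat par τ N)
    (I L : Fin N → Q) : (gR par τ r p q * Y) I L = Y I L +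
      (r * (-1) ^ (par (I p) * par (I q) + (par (I p) + par (I q)) *
        (par (L p) + ∑ t ∈ Ioo p q, (par (I t) + par (L t))))) • Y (I ∘ Equiv.swap p q) L := by
  have e : (gR par τ r p q * Y) I L = ((1 : GMat par τ N) * Y) I L + ∑ J, ((-1 : F) ^ gExp par I J L) •
      ((r • if J = I ∘ Equiv.swap p q then algebraMap F A ((-1) ^ par (I q)) else 0) * Y J L) := by
    rw [GMat.mul_apply, GMat.mul_apply, ← sum_add_distrib]
    refine sum_congr rfl fun J _ => ?_
    rw [gR, GMat.one_apply, map_add, add_mul, smul_add, map_smul]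
    congr 3
    split_ifs
    · rw [AlgHom.commutes]
    · rw [map_zero]
  rw [e, one_mul]
  congr 1
  rw [sum_eq_single (I ∘ Equiv.swap p q)]
  · rw [if_pos rfl, smul_mul_assoc, ← Algebra.smul_def, smul_smul, smul_smul]
    congr 1
    rw [mul_comm _ r, mul_assoc, ← pow_add]
    congr 1
    refine neg_one_pow_congr ?_
    push_cast
    rw [gExp_cast]
    have hsw : ∀ t, t ≠ p → t ≠ q → (I ∘ Equiv.swap p q) t = I t := fun t h1 h2 => by
      rw [Function.comp_apply, Equiv.swap_apply_of_ne_of_ne h1 h2]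
    have hp : (I ∘ Equiv.swap p q) p = I q := by simp
    have hq : (I ∘ Equiv.swap p q) q = I p := by simp
    rw [sum_eq_add_of_mem p q (mem_univ _) (mem_univ _) hpq.ne, hp, hq, sum_Iio_split hpq, hp]
    · have : ∑ t ∈ Ioo p q, ((par ((I ∘ Equiv.swap p q) t) : ZMod 2) + par (L t)) =
          ∑ t ∈ Ioo p q, ((par (I t) : ZMod 2) + par (L t)) :=
        sum_congr rfl fun t ht => by
          rw [mem_Ioo] at ht; rw [hsw t ht.1.ne' ht.2.ne]
      rw [this]
      have h2 : (par (I q) : ZMod 2) * par (I q) = par (I q) := by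
        generalize (par (I q) : ZMod 2) = x; revert x; decide
      linear_combination ((par (I q) + par (I p) : ZMod 2) *
        (∑ t ∈ Iio p, ((par ((I ∘ Equiv.swap p q) t) : ZMod 2) + par (L t))) + par (I q)) *
          two_eq_zero_zmod + h2
    · rintro t _ ⟨h1, h2⟩
      rw [hsw t h1 h2, CharTwo.add_self_eq_zero, zero_mul]
  · intro J _ hJ
    rw [if_neg hJ, smul_zero, zero_mul, smul_zero]
  · simp

lemma mul_gR_apply [hτ : Fact (τ * τ = 1)] (r : F) {p q : Fin N} (hpq : p < q) (Y : GMat par τ N)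
    (I L : Fin N → Q) : (Y * gR par τ r p q) I L = Y I L +
      (r * (-1) ^ (par (L p) * par (L q) + (par (L p) + par (L q)) *
        (par (I q) + ∑ t ∈ Ioo p q, (par (I t) + par (L t))))) • Y I (L ∘ Equiv.swap p q) := by
  have e : (Y * gR par τ r p q) I L = (Y * (1 : GMat par τ N)) I L + ∑ J, ((-1 : F) ^ gExp par I J L) •
      ((τ ^ gDeg par J L) (Y I J) *
        (r • if L = J ∘ Equiv.swap p q then algebraMap F A ((-1) ^ par (J q)) else 0)) := by
    rw [GMat.mul_apply, GMat.mul_apply, ← sum_add_distrib]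
    refine sum_congr rfl fun J _ => ?_
    rw [gR, GMat.one_apply, mul_add, smul_add]
  rw [e, mul_one]
  congr 1
  have hsw : ∀ t, t ≠ p → t ≠ q → (L ∘ Equiv.swap p q) t = L t := fun t h1 h2 => by
    rw [Function.comp_apply, Equiv.swap_apply_of_ne_of_ne h1 h2]
  have hp : (L ∘ Equiv.swap p q) p = L q := by simp
  have hq : (L ∘ Equiv.swap p q) q = L p := by simp
  rw [sum_eq_single (L ∘ Equiv.swap p q)]
  · have hd : ((gDeg par (L ∘ Equiv.swap p q) L : ℕ) : ZMod 2) = ((0 : ℕ) : ZMod 2) := by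
      simp only [gDeg, sum_add_distrib]
      push_cast
      simp only [Function.comp_apply]
      rw [Equiv.sum_comp (Equiv.swap p q) (fun t => (par (L t) : ZMod 2)),
        CharTwo.add_self_eq_zero]
    rw [if_pos (comp_swap_comp_swap L p q).symm, mul_smul_comm, ← Algebra.commutes,
      ← Algebra.smul_def, smul_smul, smul_smul, pow_congr_of_sq hτ.out hd, pow_zero,
      AlgHom.one_apply, hq]
    congr 1
    rw [mul_comm _ r, mul_assoc, ← pow_add]
    congr 1
    refine neg_one_pow_congr ?_
    push_cast
    rw [gExp_cast']
    rw [sum_eq_add_of_mem p q (mem_univ _) (mem_univ _) hpq.ne, hp, hq, sum_Ioi_split hpq, hq]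
    · have : ∑ t ∈ Ioo p q, ((par (I t) : ZMod 2) + par ((L ∘ Equiv.swap p q) t)) =
          ∑ t ∈ Ioo p q, ((par (I t) : ZMod 2) + par (L t)) :=
        sum_congr rfl fun t ht => by
          rw [mem_Ioo] at ht; rw [hsw t ht.1.ne' ht.2.ne]
      rw [this]
      have h2 : (par (L p) : ZMod 2) * par (L p) = par (L p) := by
        generalize (par (L p) : ZMod 2) = x; revert x; decide
      linear_combination ((par (L q) + par (L p) : ZMod 2) *
        (∑ t ∈ Ioi q, ((par (I t) : ZMod 2) + par ((L ∘ Equiv.swap p q) t))) + par (L p)) *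
          two_eq_zero_zmod + h2
    · rintro t _ ⟨h1, h2⟩
      rw [hsw t h1 h2, CharTwo.add_self_eq_zero, zero_mul]
  · intro J _ hJ
    rw [if_neg (fun h => hJ (by rw [h, comp_swap_comp_swap])), smul_zero, mul_zero, smul_zero]
  · simp

end Graded
end SuperYangian

namespace SuperYangian

section GradedRelations

open Finset

variable {F A Q σ : Type*} [Field F] [Ring A] [Algebra F A] {N : ℕ}

/-- `(-1)^k`. -/
def zs (F : Type*) [Field F] (k : ZMod 2) : F := (-1) ^ k.val

lemma zs_natCast (k : ℕ) : zs F (k : ZMod 2) = (-1) ^ k := neg_one_pow_congr (by simp)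

lemma zs_add (k l : ZMod 2) : zs F (k + l) = zs F k * zs F l := by
  rw [zs, zs, zs, ← pow_add]
  exact neg_one_pow_congr (by simp)

lemma zs_zero : zs F 0 = 1 := by simp [zs]

lemma zs_mul_self (k : ZMod 2) : zs F k * zs F k = 1 := by
  rw [← zs_add, CharTwo.add_self_eq_zero, zs_zero]

variable {par : Q → ℕ} {τ : A →ₐ[F] A} [Fintype Q] [DecidableEq Q]

/-- The parities, modulo two. -/
def zp (par : Q → ℕ) (I : Fin N → Q) (t : Fin N) : ZMod 2 := par (I t)

omit [Fintype Q] [DecidableEq Q] in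
lemma sum_zp_update (S : Finset (Fin N)) (I : Fin N → Q) (p : Fin N) (x : Q) :
    ∑ t ∈ S, zp par (Function.update I p x) t =
      ∑ t ∈ S, zp par I t + if p ∈ S then zp par I p + par x else 0 := sum_update_cast S I p x

omit [Fintype Q] [DecidableEq Q] in
lemma sum_zp_swap (S : Finset (Fin N)) (I : Fin N → Q) {p q : Fin N} (hpq : p ≠ q) :
    ∑ t ∈ S, zp par (I ∘ Equiv.swap p q) t = ∑ t ∈ S, zp par I t +
      ((if p ∈ S then zp par I p + zp par I q else 0) +
        if q ∈ S then zp par I p + zp par I q else 0) := by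
  rw [comp_swap_update, sum_zp_update, sum_zp_update]
  have : zp par (Function.update I q (I p)) p = zp par I p := by
    rw [zp, Function.update_of_ne hpq]; rfl
  rw [this]
  simp only [zp]
  rw [add_comm (par (I q) : ZMod 2) (par (I p))]
  ring

lemma gT_mul {T : Q → Q → A} (hT : ∀ i j, τ (T i j) = ((-1 : F) ^ (par i + par j)) • T i j)
    (p : Fin N) (Y : GMat par τ N) (I L : Fin N → Q) : (gT par τ T p * Y) I L =
      ∑ x, zs F ((zp par I p + par x) * (par x + zp par L p +
        (∑ t ∈ Ioi p, zp par I t + ∑ t ∈ Ioi p, zp par L t))) •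
          (T (I p) x * Y (Function.update I p x) L) := by
  rw [gT_mul_apply hT]
  refine sum_congr rfl fun x _ => ?_
  rw [← zs_natCast]
  congr 2
  push_cast
  rw [sum_add_distrib]; rfl

lemma gR_mul [hτ : Fact (τ * τ = 1)] (r : F) {p q : Fin N} (hpq : p < q) (Y : GMat par τ N)
    (I L : Fin N → Q) : (gR par τ r p q * Y) I L = Y I L +
      (r * zs F (zp par I p * zp par I q + (zp par I p + zp par I q) *
        (zp par L p + (∑ t ∈ Ioo p q, zp par I t + ∑ t ∈ Ioo p q, zp par L t)))) •
          Y (I ∘ Equiv.swap p q) L := by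
  rw [gR_mul_apply r hpq, ← zs_natCast]
  congr 4
  push_cast
  rw [sum_add_distrib]; rfl

lemma mul_gR [hτ : Fact (τ * τ = 1)] (r : F) {p q : Fin N} (hpq : p < q) (Y : GMat par τ N)
    (I L : Fin N → Q) : (Y * gR par τ r p q) I L = Y I L +
      (r * zs F (zp par L p * zp par L q + (zp par L p + zp par L q) *
        (zp par I q + (∑ t ∈ Ioo p q, zp par I t + ∑ t ∈ Ioo p q, zp par L t)))) •
          Y I (L ∘ Equiv.swap p q) := by
  rw [mul_gR_apply r hpq, ← zs_natCast]
  congr 4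
  push_cast
  rw [sum_add_distrib]; rfl

/-- The relations of `T_{ij}(u)`. -/
structure IsRTT (par : Q → ℕ) (τ : A →ₐ[F] A) (g : σ → σ → F) (T : σ → Q → Q → A) : Prop where
  hom : ∀ u i j, τ (T u i j) = ((-1 : F) ^ (par i + par j)) • T u i j
  comm : ∀ i j k l {z w : σ}, z ≠ w →
    T z i j * T w k l - ((-1 : F) ^ ((par i + par j) * (par k + par l))) • (T w k l * T z i j) =
      ((-1) ^ (par l * (par i + par j) + par i * par j) * g z w) •
        (T z i l * T w k j - T w i l * T z k j)
  anti : ∀ z w, g z w = -g w z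

omit [Fintype Q] [DecidableEq Q] in
lemma IsRTT.comm_zs {g : σ → σ → F} {T : σ → Q → Q → A} (H : IsRTT par τ g T) (i j k l : Q)
    {z w : σ} (h : z ≠ w) :
    T z i j * T w k l - zs F (((par i : ZMod 2) + par j) * (par k + par l)) • (T w k l * T z i j) =
      (zs F ((par l : ZMod 2) * (par i + par j) + par i * par j) * g z w) •
        (T z i l * T w k j - T w i l * T z k j) := by
  have := H.comm i j k l h
  rw [← zs_natCast, ← zs_natCast] at this
  push_cast at this
  exact this

variable {g : σ → σ → F} {T : σ → Q → Q → A} [hτ : Fact (τ * τ = 1)]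

lemma IsRTT.rtt (H : IsRTT par τ g T) {p q : Fin N} (hpq : p < q) {z w : σ} (hzw : z ≠ w) :
    gT par τ (T z) p * gT par τ (T w) q * gR par τ (g w z) p q =
      gR par τ (g w z) p q * (gT par τ (T w) q * gT par τ (T z) p) := by
  rw [← mul_one (gR par τ (g w z) p q), mul_assoc, mul_assoc _ (1 : GMat par τ N), one_mul,
    ← mul_one (gT par τ (T z) p)]
  rw [mul_assoc, one_mul]
  funext I L
  have hne := hpq.ne
  have hup : ∀ x y, (Function.update (Function.update I p x) q y) ∘ Equiv.swap p q =
      Function.update (Function.update I p y) q x := by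
    intro x y
    funext t
    by_cases h1 : t = p
    · subst h1; simp [hne]
    · by_cases h2 : t = q
      · subst h2; simp [hne]
      · simp [Equiv.swap_apply_of_ne_of_ne h1 h2, h1, h2]
  have hsu : ∀ x y, Function.update (Function.update (I ∘ Equiv.swap p q) q y) p x =
      Function.update (Function.update I p x) q y := by
    intro x y
    funext t
    by_cases h1 : t = p
    · subst h1; simp [hne]
    · by_cases h2 : t = q
      · subst h2; simp [h1]
      · simp [Equiv.swap_apply_of_ne_of_ne h1 h2, h1, h2]
  have hcomm : ∀ x y, Function.update (Function.update I q y) p x =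
      Function.update (Function.update I p x) q y := fun x y => Function.update_comm hne.symm _ _ _
  have hmem : p ∉ Ioi q := by simp [hpq.le]
  obtain ⟨E, hE⟩ : ∃ E : (Fin N → Q) → A, ∀ K, (1 : GMat par τ N) K L = E K := ⟨_, fun _ => rfl⟩
  rw [gT_mul (H.hom z), gR_mul _ hpq]
  simp only [gT_mul (H.hom w), gR_mul _ hpq, gT_mul (H.hom z), hE, hup, hsu, hcomm, sum_zp_update,
    sum_zp_swap _ _ hne, sum_Ioi_split hpq]
  have v1 : ∀ x, Function.update I p x q = I q := fun x => Function.update_of_ne hne.symm _ _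
  have v2 : ∀ y, Function.update I q y p = I p := fun x => Function.update_of_ne hne _ _
  have v3 : (I ∘ Equiv.swap p q) q = I p := by simp
  have v4 : ∀ y, Function.update (I ∘ Equiv.swap p q) q y p = I q := fun y => by
    rw [Function.update_of_ne hne]; simp
  have w1 : ∀ x, zp par (Function.update I p x) q = zp par I q := fun x => by rw [zp, v1]; rfl
  have w2 : ∀ y, zp par (Function.update I q y) p = zp par I p := fun x => by rw [zp, v2]; rfl
  have w3 : zp par (I ∘ Equiv.swap p q) q = zp par I p := by rw [zp, v3]; rfl
  have w4 : ∀ y, zp par (Function.update (I ∘ Equiv.swap p q) q y) p = zp par I q := fun y => by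
    rw [zp, v4]; rfl
  have w5 : ∀ (J : Fin N → Q) y, zp par (Function.update J q y) q = par y := fun J y => by simp [zp]
  have w6 : ∀ x y, zp par (Function.update (Function.update I p x) q y) p = par x := fun x y => by
    simp [zp, hne]
  simp only [v1, v2, v3, v4, w1, w2, w3, w4, w5, w6, hmem, if_false, mem_Ioo, lt_irrefl, false_and,
    and_false, mem_Ioi, add_zero]
  set S := ∑ t ∈ Ioo p q, zp par I t
  set S' := ∑ t ∈ Ioo p q, zp par L t
  set U := ∑ t ∈ Ioi q, zp par I t
  set U' := ∑ t ∈ Ioi q, zp par L t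
  simp only [mul_sum, smul_sum, mul_add, smul_add, sum_add_distrib, mul_smul_comm, smul_smul]
  conv_lhs => arg 2; rw [sum_comm]
  conv_rhs => arg 1; rw [sum_comm]
  conv_rhs => arg 2; rw [sum_comm]
  rw [← sum_add_distrib, ← sum_add_distrib]
  refine sum_congr rfl fun x _ => ?_
  rw [← sum_add_distrib, ← sum_add_distrib]
  refine sum_congr rfl fun y _ => ?_
  have k := congrArg (fun X => X * E (Function.update (Function.update I p x) q y))
    (H.comm_zs (I p) x (I q) y hzw)
  rw [H.anti z w] at k
  simp only [sub_mul, smul_mul_assoc, mul_assoc] at k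
  have i1 : zp par I p = (par (I p) : ZMod 2) := rfl
  have i2 : zp par I q = (par (I q) : ZMod 2) := rfl
  generalize E (Function.update (Function.update I p x) q y) = e at *
  generalize T z (I p) x * (T w (I q) y * e) = a1 at *
  generalize T z (I p) y * (T w (I q) x * e) = a2 at *
  generalize T w (I q) y * (T z (I p) x * e) = a3 at *
  generalize T w (I p) y * (T z (I q) x * e) = a4 at *
  rw [i1, i2]
  generalize (par (I p) : ZMod 2) = i at *
  generalize (par (I q) : ZMod 2) = j at *
  generalize (par x : ZMod 2) = x at *
  generalize (par y : ZMod 2) = y at *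
  generalize zp par L p = lp at *
  generalize zp par L q = lq at *
  generalize S = S at *
  generalize S' = S' at *
  generalize U = U at *
  generalize U' = U' at *
  generalize g w z = r at *
  have sq : ∀ a : ZMod 2, a * a = a := by decide
  have e2 : ∀ a b d e k : ZMod 2, a + b = d + e + k → zs F a * zs F b = zs F d * zs F e * zs F k :=
    fun a b d e k h => by rw [← zs_add, ← zs_add, ← zs_add, h]
  have e3 : ∀ a b f d e k : ZMod 2, a + b + f = d + e + k →
      zs F a * (zs F b * (r * zs F f)) = zs F d * zs F e * zs F k * r := fun a b f d e k h => by
    rw [← zs_add d, ← zs_add, ← h, zs_add, zs_add]; ring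
  rw [e2 ((j + y) * y + (j + y) * lq + ((j + y) * U + (j + y) * U')) _
      ((i + x) * x + (i + x) * lp +
        ((i + x) * S + ((i + x) * j + (i + x) * U) + ((i + x) * S' + ((i + x) * lq + (i + x) * U'))))
      ((j + y) * y + (j + y) * lq + ((j + y) * U + (j + y) * U')) ((i + x) * (j + y)) (by grind),
    e3 _ _ _ ((i + x) * x + (i + x) * lp +
        ((i + x) * S + ((i + x) * j + (i + x) * U) + ((i + x) * S' + ((i + x) * lq + (i + x) * U'))))
      ((j + y) * y + (j + y) * lq + ((j + y) * U + (j + y) * U')) (y * (i + x) + i * x)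
      (by grind),
    mul_comm (r * _), mul_assoc (zs F _) (zs F _) (r * _), e3 _ _ _ ((i + x) * x + (i + x) * lp +
        ((i + x) * S + ((i + x) * j + (i + x) * U) + ((i + x) * S' + ((i + x) * lq + (i + x) * U'))))
      ((j + y) * y + (j + y) * lq + ((j + y) * U + (j + y) * U')) (y * (i + x) + i * x)
      (by grind)]
  linear_combination (norm := module) (zs F ((i + x) * x + (i + x) * lp +
        ((i + x) * S + ((i + x) * j + (i + x) * U) + ((i + x) * S' + ((i + x) * lq + (i + x) * U')))) *
      zs F ((j + y) * y + (j + y) * lq + ((j + y) * U + (j + y) * U'))) • k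

end GradedRelations
end SuperYangian

namespace SuperYangian

section GradedCommutation

open Finset

variable {F A Q σ : Type*} [Field F] [Ring A] [Algebra F A] {N : ℕ}
  {par : Q → ℕ} {τ : A →ₐ[F] A} [Fintype Q] [DecidableEq Q] [hτ : Fact (τ * τ = 1)]

lemma gT_comm_gR {T : Q → Q → A} (hT : ∀ i j, τ (T i j) = ((-1 : F) ^ (par i + par j)) • T i j)
    (r : F) {p q t : Fin N} (hpq : p < q) (hp : t ≠ p) (hq : t ≠ q) :
    Commute (gT par τ T t) (gR par τ r p q) := by
  rw [Commute, SemiconjBy, ← mul_one (gR par τ r p q), mul_assoc _ (1 : GMat par τ N), one_mul,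
    ← mul_one (gT par τ T t), mul_assoc, one_mul]
  funext I L
  have hne := hpq.ne
  have hup : ∀ x, Function.update (I ∘ Equiv.swap p q) t x =
      Function.update I t x ∘ Equiv.swap p q := by
    intro x
    funext t'
    by_cases h1 : t' = t
    · subst h1; simp [Equiv.swap_apply_of_ne_of_ne hp hq]
    · rw [Function.update_of_ne h1, Function.comp_apply, Function.comp_apply, Function.update_of_ne]
      rw [Ne, Equiv.swap_apply_eq_iff, Equiv.swap_apply_of_ne_of_ne hp hq]; exact h1
  obtain ⟨E, hE⟩ : ∃ E : (Fin N → Q) → A, ∀ K, (1 : GMat par τ N) K L = E K := ⟨_, fun _ => rfl⟩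
  have v1 : ∀ x, zp par (Function.update I t x) p = zp par I p := fun x => by
    rw [zp, Function.update_of_ne hp.symm]; rfl
  have v2 : ∀ x, zp par (Function.update I t x) q = zp par I q := fun x => by
    rw [zp, Function.update_of_ne hq.symm]; rfl
  have v3 : (I ∘ Equiv.swap p q) t = I t := by simp [Equiv.swap_apply_of_ne_of_ne hp hq]
  have v4 : zp par (I ∘ Equiv.swap p q) t = zp par I t := by rw [zp, v3]; rfl
  have sq : ∀ a : ZMod 2, a * a = a := by decide
  rw [gT_mul hT, gR_mul _ hpq]
  simp only [gR_mul _ hpq, gT_mul hT, hE, hup, sum_zp_update, sum_zp_swap _ _ hne, v1, v2, v3, v4,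
    mul_add, smul_add, sum_add_distrib, smul_sum]
  congr 1
  refine sum_congr rfl fun x _ => ?_
  rw [mul_smul_comm, smul_smul, smul_smul]
  congr 1
  rw [mul_left_comm, mul_assoc, ← zs_add, ← zs_add]
  congr 2
  generalize (par x : ZMod 2) = x
  rcases lt_trichotomy t p with h | h | h
  · have : t < q := h.trans hpq
    simp only [mem_Ioi, mem_Ioo, h, this, h.not_gt, if_true, if_false, false_and]
    grind
  · exact absurd h hp
  · rcases lt_trichotomy t q with h' | h' | h'
    · simp only [mem_Ioi, mem_Ioo, h, h', h.not_gt, if_true, if_false, and_self]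
      grind
    · exact absurd h' hq
    · simp only [mem_Ioi, mem_Ioo, h.not_gt, h'.not_gt, if_false, and_false]
      grind

lemma gR_comm_gR (r r' : F) {p q p' q' : Fin N} (h1 : p < p') (h2 : p' < q) (h3 : q < q') :
    Commute (gR par τ r p q) (gR par τ r' p' q') := by
  have hpq := h1.trans h2
  have hpq' := h2.trans h3
  rw [Commute, SemiconjBy, ← mul_one (gR par τ r' p' q'), mul_assoc _ (1 : GMat par τ N), one_mul,
    ← mul_one (gR par τ r p q), mul_assoc, one_mul]
  funext I L
  have n1 := h1.ne
  have n2 := h2.ne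
  have n3 := h3.ne
  have n4 := hpq.ne
  have n5 := hpq'.ne
  have n6 := (hpq.trans h3).ne
  obtain ⟨E, hE⟩ : ∃ E : (Fin N → Q) → A, ∀ K, (1 : GMat par τ N) K L = E K := ⟨_, fun _ => rfl⟩
  have hd : (I ∘ Equiv.swap p' q') ∘ Equiv.swap p q = (I ∘ Equiv.swap p q) ∘ Equiv.swap p' q' := by
    rw [Function.comp_assoc, Function.comp_assoc]
    congr 1
    funext t
    simp only [Function.comp_apply, Equiv.swap_apply_def]
    split_ifs <;> simp_all
  have w : ∀ (t a b : Fin N), t ≠ a → t ≠ b → zp par (I ∘ Equiv.swap a b) t = zp par I t :=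
    fun t a b ha hb => by simp [zp, Equiv.swap_apply_of_ne_of_ne ha hb]
  have sq : ∀ a : ZMod 2, a * a = a := by decide
  rw [gR_mul _ hpq, gR_mul _ hpq']
  simp only [gR_mul _ hpq, gR_mul _ hpq', hE, sum_zp_swap _ _ n4, sum_zp_swap _ _ n5, hd,
    w p p' q' n1 n6, w q p' q' n2.symm n3, w p' p q n1.symm n2, w q' p q n6.symm n3.symm, smul_add,
    smul_smul]
  rw [add_add_add_comm]
  congr 3
  rw [mul_mul_mul_comm, mul_mul_mul_comm r', ← zs_add, ← zs_add, mul_comm r']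
  congr 2
  simp only [mem_Ioo, h1, h2, h3, h1.not_gt, h3.not_gt, if_true, if_false, and_self,
    false_and, and_false]
  grind

/-- The matrix has no entries which change the index of the site `k`. -/
def IsDiagAt (k : Fin N) (M : GMat par τ N) : Prop := ∀ I L, I k ≠ L k → M I L = 0

omit hτ in
lemma IsDiagAt.mul {k : Fin N} {X Y : GMat par τ N} (hX : IsDiagAt k X) (hY : IsDiagAt k Y) :
    IsDiagAt k (X * Y) := by
  intro I L h
  rw [GMat.mul_apply]
  refine sum_eq_zero fun J _ => ?_
  by_cases hJ : I k = J k
  · rw [hY J L (hJ ▸ h), mul_zero, smul_zero]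
  · rw [hX I J hJ, map_zero, zero_mul, smul_zero]

omit [Fintype Q] hτ in
lemma isDiagAt_one (k : Fin N) : IsDiagAt k (1 : GMat par τ N) := fun I L h => by
  rw [GMat.one_apply, if_neg (fun e => h (by rw [e]))]

omit hτ in
lemma isDiagAt_list_prod {k : Fin N} {l : List (GMat par τ N)} (h : ∀ M ∈ l, IsDiagAt k M) :
    IsDiagAt k l.prod := by
  induction l with
  | nil => exact isDiagAt_one k
  | cons M l ih =>
    rw [List.prod_cons]
    exact (h M (by simp)).mul (ih fun M hM => h M (by simp [hM]))

omit [Fintype Q] hτ in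
lemma isDiagAt_gT (T : Q → Q → A) {k p : Fin N} (h : k ≠ p) : IsDiagAt k (gT par τ T p) :=
  fun _ _ hI => if_neg fun hq => hI (hq k h)

omit [Fintype Q] hτ in
lemma isDiagAt_gR (r : F) {k p q : Fin N} (hp : k ≠ p) (hq : k ≠ q) :
    IsDiagAt k (gR par τ r p q) := fun I L hI => by
  rw [gR, if_neg (fun e => hI (by rw [e])), if_neg (fun e => hI (by
    rw [e, Function.comp_apply, Equiv.swap_apply_of_ne_of_ne hp hq])), smul_zero, add_zero]

/-- The matrix is even. -/
def IsEvenMat (M : GMat par τ N) : Prop :=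
  ∀ I L, τ (M I L) = ((-1 : F) ^ gDeg par I L) • M I L

omit [DecidableEq Q] hτ in
lemma IsEvenMat.mul {X Y : GMat par τ N} (hX : IsEvenMat X) (hY : IsEvenMat Y) :
    IsEvenMat (X * Y) := by
  have hk : ∀ (k : ℕ) I L, τ ((τ ^ k) (X I L)) = ((-1 : F) ^ gDeg par I L) • (τ ^ k) (X I L) := by
    intro k I L
    rw [← AlgHom.mul_apply, ← pow_succ', pow_succ, AlgHom.mul_apply, hX, map_smul]
  intro I L
  rw [GMat.mul_apply, map_sum, smul_sum]
  refine sum_congr rfl fun J _ => ?_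
  rw [map_smul, map_mul, hk, hY, smul_mul_smul_comm, smul_comm, ← pow_add,
    neg_one_pow_congr (gDeg_add I J L)]

omit [Fintype Q] hτ in
lemma isEvenMat_one : IsEvenMat (1 : GMat par τ N) := fun I L => by
  rw [GMat.one_apply]
  split_ifs with h
  · subst h
    rw [neg_one_pow_congr (l := 0), pow_zero, one_smul, map_one]
    simp only [gDeg]
    push_cast
    simp only [CharTwo.add_self_eq_zero, sum_const_zero]
  · rw [map_zero, smul_zero]

omit hτ in
lemma isEvenMat_list_prod {l : List (GMat par τ N)} (h : ∀ M ∈ l, IsEvenMat M) :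
    IsEvenMat l.prod := by
  induction l with
  | nil => exact isEvenMat_one
  | cons M l ih =>
    rw [List.prod_cons]
    exact (h M (by simp)).mul (ih fun M hM => h M (by simp [hM]))

omit [Fintype Q] hτ in
lemma isEvenMat_gT {T : Q → Q → A}
    (hT : ∀ i j, τ (T i j) = ((-1 : F) ^ (par i + par j)) • T i j) (p : Fin N) :
    IsEvenMat (gT par τ T p) := fun I L => by
  rw [gT]
  split_ifs with h
  · rw [hT, neg_one_pow_congr]
    simp only [gDeg]
    push_cast
    rw [sum_eq_single p]
    · intro q _ hq
      rw [h q hq, CharTwo.add_self_eq_zero]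
    · simp
  · rw [map_zero, smul_zero]

omit [Fintype Q] hτ in
lemma isEvenMat_gR (r : F) (p q : Fin N) : IsEvenMat (gR par τ r p q) := fun I L => by
  rw [gR, map_add, map_smul, smul_add]
  congr 1
  · exact isEvenMat_one I L
  · split_ifs with h
    · subst h
      rw [AlgHom.commutes, neg_one_pow_congr (l := 0) (k := gDeg par _ _), pow_zero, one_smul]
      simp only [gDeg, sum_add_distrib]
      push_cast
      simp only [Function.comp_apply]
      rw [Equiv.sum_comp (Equiv.swap p q) (fun t => (par (I t) : ZMod 2)),
        CharTwo.add_self_eq_zero]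
    · simp

end GradedCommutation
end SuperYangian

namespace SuperYangian

section Reordering

variable {M ι : Type*} [Monoid M] {t : ι → M} {r : ι → ι → M}

/-- `r(k_a, q) ⋯ r(k_1, q)`. -/
def rRow (r : ι → ι → M) (us : List ι) (q : ι) : M := (us.reverse.map fun k => r k q).prod

/-- The product of the rows. -/
def rAll (r : ι → ι → M) (us vs : List ι) : M := (vs.map (rRow r us)).prod

lemma rRow_cons (k : ι) (us : List ι) (q : ι) : rRow r (k :: us) q = rRow r us q * r k q := by
  simp [rRow]

lemma rAll_cons (us : List ι) (q : ι) (vs : List ι) :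
    rAll r us (q :: vs) = rRow r us q * rAll r us vs := by
  simp [rAll]

lemma commute_rRow {x : M} {us : List ι} {q : ι} (h : ∀ k ∈ us, Commute x (r k q)) :
    Commute x (rRow r us q) := by
  refine Commute.list_prod_right _ _ fun y hy => ?_
  simp only [List.mem_map, List.mem_reverse] at hy
  obtain ⟨k, hk, rfl⟩ := hy
  exact h k hk

lemma commute_rAll {x : M} {us vs : List ι} (h : ∀ k ∈ us, ∀ q ∈ vs, Commute x (r k q)) :
    Commute x (rAll r us vs) := by
  refine Commute.list_prod_right _ _ fun y hy => ?_
  simp only [List.mem_map] at hy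
  obtain ⟨q, hq, rfl⟩ := hy
  exact commute_rRow fun k hk => h k hk q hq

lemma prod_commute {us : List ι} {x : M} (h : ∀ k ∈ us, Commute (t k) x) :
    Commute (us.map t).prod x := by
  refine Commute.list_prod_left _ _ fun y hy => ?_
  simp only [List.mem_map] at hy
  obtain ⟨k, hk, rfl⟩ := hy
  exact h k hk

lemma prod_mul_rRow {us : List ι} {q : ι} (hn : us.Nodup) (hq : q ∉ us)
    (hex : ∀ k ∈ us, t k * t q * r k q = r k q * (t q * t k))
    (htr : ∀ p ∈ us, ∀ k ∈ us, p ≠ k → Commute (t p) (r k q)) :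
    (us.map t).prod * t q * rRow r us q = rRow r us q * (t q * (us.map t).prod) := by
  induction us with
  | nil => simp [rRow]
  | cons k us ih =>
    rw [List.nodup_cons] at hn
    have ih' := ih hn.2 (fun h => hq (by simp [h])) (fun k hk => hex k (by simp [hk]))
      fun p hp k hk => htr p (by simp [hp]) k (by simp [hk])
    have c1 : Commute (us.map t).prod (r k q) := prod_commute fun p hp =>
      htr p (by simp [hp]) k (by simp) (by rintro rfl; exact hn.1 hp)
    have c2 : Commute (t k) (rRow r us q) := commute_rRow fun p hp =>
      htr k (by simp) p (by simp [hp]) (by rintro rfl; exact hn.1 hp)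
    rw [List.map_cons, List.prod_cons, rRow_cons]
    calc t k * (us.map t).prod * t q * (rRow r us q * r k q)
        = t k * ((us.map t).prod * t q * rRow r us q) * r k q := by simp only [mul_assoc]
      _ = t k * rRow r us q * t q * ((us.map t).prod * r k q) := by
          rw [ih']; simp only [mul_assoc]
      _ = rRow r us q * (t k * t q * r k q) * (us.map t).prod := by
          rw [c1.eq, c2.eq]; simp only [mul_assoc]
      _ = _ := by rw [hex k (by simp)]; simp only [mul_assoc]

lemma prod_mul_rAll {us vs : List ι} (hu : us.Nodup) (hv : vs.Nodup) (hd : us.Disjoint vs)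
    (hex : ∀ k ∈ us, ∀ q ∈ vs, t k * t q * r k q = r k q * (t q * t k))
    (htr : ∀ p ∈ us ++ vs, ∀ k ∈ us, ∀ q ∈ vs, p ≠ k → p ≠ q → Commute (t p) (r k q)) :
    (us.map t).prod * (vs.map t).prod * rAll r us vs =
      rAll r us vs * ((vs.map t).prod * (us.map t).prod) := by
  induction vs with
  | nil => simp [rAll]
  | cons q vs ih =>
    rw [List.nodup_cons] at hv
    have hqu : q ∉ us := fun h => hd h (by simp)
    have ne : ∀ {k}, k ∈ us → ∀ {p}, p ∈ q :: vs → p ≠ k := fun hk _ hp e => hd hk (e ▸ hp)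
    have ih' := ih hv.2 (fun x h1 h2 => hd h1 (by simp [h2]))
      (fun k hk p hp => hex k hk p (by simp [hp]))
      fun p hp k hk q' hq' => htr p (by
        rw [List.mem_append] at hp ⊢; exact hp.imp_right fun h => by simp [h]) k hk q' (by simp [hq'])
    have e := prod_mul_rRow hu hqu (fun k hk => hex k hk q (by simp)) fun p hp k hk hne =>
      htr p (by simp [hp]) k hk q (by simp) hne (by rintro rfl; exact hqu hp)
    have c1 : Commute (vs.map t).prod (rRow r us q) := prod_commute fun p hp =>
      commute_rRow fun k hk => htr p (by simp [hp]) k hk q (by simp) (ne hk (by simp [hp]))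
        (by rintro rfl; exact hv.1 hp)
    have c2 : Commute (t q) (rAll r us vs) := commute_rAll fun k hk p hp =>
      htr q (by simp) k hk p (by simp [hp]) (ne hk (by simp)) (by rintro rfl; exact hv.1 hp)
    rw [List.map_cons, List.prod_cons, rAll_cons]
    calc (us.map t).prod * (t q * (vs.map t).prod) * (rRow r us q * rAll r us vs)
        = (us.map t).prod * t q * ((vs.map t).prod * rRow r us q) * rAll r us vs := by
          simp only [mul_assoc]
      _ = ((us.map t).prod * t q * rRow r us q) * (vs.map t).prod * rAll r us vs := by
          rw [c1.eq]; simp only [mul_assoc]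
      _ = rRow r us q * t q * ((us.map t).prod * (vs.map t).prod * rAll r us vs) := by
          rw [e]; simp only [mul_assoc]
      _ = rRow r us q * (t q * rAll r us vs) * ((vs.map t).prod * (us.map t).prod) := by
          rw [ih']; simp only [mul_assoc]
      _ = _ := by rw [c2.eq]; simp only [mul_assoc]

/-- `T_{u} T_{v} ℝ`. -/
def ttr (t : ι → M) (r : ι → ι → M) (us vs : List ι) : M :=
  (us.map t).prod * (vs.map t).prod * rAll r us vs

/-- `ℝ T_{v} T_{u}`. -/
def rtt (t : ι → M) (r : ι → ι → M) (us vs : List ι) : M :=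
  rAll r us vs * ((vs.map t).prod * (us.map t).prod)

lemma ttr_cons {us vs : List ι} {k : ι}
    (hrr : vs.Pairwise fun q q' => ∀ k' ∈ us, Commute (r k q) (r k' q')) :
    ttr t r (k :: us) vs = t k * ttr t r us vs * (vs.map (r k)).prod := by
  have e : rAll r (k :: us) vs = rAll r us vs * (vs.map (r k)).prod := by
    induction vs with
    | nil => simp [rAll]
    | cons q vs ih =>
      rw [List.pairwise_cons] at hrr
      have c : Commute (r k q) (rAll r us vs) := commute_rAll fun k' hk' q' hq' =>
        hrr.1 q' hq' k' hk'
      rw [rAll_cons, rAll_cons, rRow_cons, ih hrr.2, List.map_cons, List.prod_cons]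
      calc rRow r us q * r k q * (rAll r us vs * (vs.map (r k)).prod)
          = rRow r us q * (r k q * rAll r us vs) * (vs.map (r k)).prod := by simp only [mul_assoc]
        _ = _ := by rw [c.eq]; simp only [mul_assoc]
  rw [ttr, ttr, e, List.map_cons, List.prod_cons]
  simp only [mul_assoc]

lemma rtt_cons {us vs : List ι} {q : ι}
    (htr : ∀ k ∈ us, ∀ q' ∈ vs, Commute (t q) (r k q')) :
    rtt t r us (q :: vs) = rRow r us q * (t q * rtt t r us vs) := by
  have c : Commute (t q) (rAll r us vs) := commute_rAll htr
  rw [rtt, rtt, rAll_cons, List.map_cons, List.prod_cons]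
  calc rRow r us q * rAll r us vs * (t q * (vs.map t).prod * (us.map t).prod)
      = rRow r us q * (rAll r us vs * t q) * (vs.map t).prod * (us.map t).prod := by
        simp only [mul_assoc]
    _ = _ := by rw [← c.eq]; simp only [mul_assoc]

end Reordering

section Crossing

variable {ι σ F N : Type*} [DecidableEq ι] [Field F] [AddCommGroup N] [Module F N]
  {γ : σ → σ → F} {ε : F} {y : ι → σ}

/-- The word of the letters at the sites `vs`, in the state `s`. -/
def stWord (y : ι → σ) (s : ι → Bool) (vs : List ι) : List (σ × Bool) := vs.map fun q => (y q, s q)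

lemma eq_foldl_lineStep {G : List ι → (ι → Bool) → N} {V : Bool → List (σ × Bool) → N} {z : σ}
    {k : ι} {vs : List ι} (hn : vs.Nodup) (hk : k ∉ vs)
    (h0 : ∀ s, G [] s = V (s k) (stWord y s vs))
    (hstep : ∀ l q l', vs = l ++ q :: l' → ∀ s, G (l ++ [q]) s = if s k = s q then
      ((if s q then ε else 1) + γ (y q) z) • G l s
      else G l s + γ (y q) z • G l (s ∘ Equiv.swap k q))
    (s : ι → Bool) : G vs s = (stWord y s vs).foldl (lineStep γ ε z) V (s k) [] := by
  have key : ∀ l l', vs = l ++ l' → ∀ s,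
      G l s = (stWord y s l).foldl (lineStep γ ε z) V (s k) (stWord y s l') := by
    intro l
    induction l using List.reverseRecOn with
    | nil => rintro l' rfl s; exact h0 s
    | append_singleton l q ih =>
      rintro l' hl s
      rw [List.append_assoc, List.singleton_append] at hl
      have hk' := hk
      rw [hl] at hn hk'
      simp only [List.mem_append, List.mem_cons, not_or] at hk'
      have hq : q ∉ l := fun h => (List.nodup_append.1 hn).2.2 q h q (by simp) rfl
      have hq' : q ∉ l' := (List.nodup_cons.1 (List.nodup_append.1 hn).2.1).1
      have e : ∀ m : List ι, k ∉ m → q ∉ m → stWord y (s ∘ Equiv.swap k q) m = stWord y s m := by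
        intro m h1 h2
        refine List.map_congr_left fun x hx => ?_
        rw [Function.comp_apply, Equiv.swap_apply_of_ne_of_ne (by rintro rfl; exact h1 hx)
          (by rintro rfl; exact h2 hx)]
      have e2 : ∀ (s : ι → Bool) (m : List ι), stWord y s (q :: m) = (y q, s q) :: stWord y s m :=
        fun _ _ => rfl
      have e3 : stWord y s (l ++ [q]) = stWord y s l ++ [(y q, s q)] := by simp [stWord]
      rw [hstep l q l' hl, ih _ hl, ih _ hl, e l hk'.1 hq, e2, e2, e l' hk'.2.2 hq', e3,
        List.foldl_append, List.foldl_cons, List.foldl_nil, Function.comp_apply,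
        Function.comp_apply, Equiv.swap_apply_left, Equiv.swap_apply_right]
      cases h1 : s k <;> cases h2 : s q <;> simp [lineStep]
  simpa [stWord] using key vs [] (by simp) s

/-- The words obtained when several lines cross a word. -/
def lineWords (γ : σ → σ → F) (ε : F) (P : Bool → σ → Module.End F N)
    (W : List (σ × Bool) → N) : List σ → List (σ × Bool) → N
  | [] => W
  | y :: ys => lineWord γ ε y fun b l => P b y (lineWords γ ε P W ys l)

/-- The number of sites in the state `true`. -/
def cnt (s : ι → Bool) (l : List ι) : ℕ := (l.map fun q => (s q).toNat).sum

omit [DecidableEq ι] in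
lemma cnt_cons (s : ι → Bool) (q : ι) (l : List ι) : cnt s (q :: l) = (s q).toNat + cnt s l := by
  simp [cnt]

omit [DecidableEq ι] in
lemma cnt_append (s : ι → Bool) (l l' : List ι) : cnt s (l ++ l') = cnt s l + cnt s l' := by
  simp [cnt]

lemma cnt_comp_swap (s : ι → Bool) {k q : ι} {l : List ι} (h1 : k ∉ l) (h2 : q ∉ l) :
    cnt (s ∘ Equiv.swap k q) l = cnt s l := by
  rw [cnt, cnt]
  congr 1
  refine List.map_congr_left fun x hx => ?_
  rw [Function.comp_apply, Equiv.swap_apply_of_ne_of_ne (by rintro rfl; exact h1 hx)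
    (by rintro rfl; exact h2 hx)]

end Crossing
end SuperYangian

namespace SuperYangian

section Entries

open Finset

variable {F A Q σ M : Type*} [Field F] [Ring A] [Algebra F A] [AddCommGroup M] [Module F M] {N : ℕ}
  {par : Q → ℕ} {τ : A →ₐ[F] A} [Fintype Q] [DecidableEq Q] [hτ : Fact (τ * τ = 1)]
  {g : σ → σ → F} {T : σ → Q → Q → A} {y : Fin N → σ}

lemma sum_eq_list_sum {ι R : Type*} [DecidableEq ι] [AddCommMonoid R] {S : Finset ι} {l : List ι}
    {f : ι → R} (hn : l.Nodup) (hl : ∀ t ∈ l, t ∈ S) (h0 : ∀ t ∈ S, t ∉ l → f t = 0) :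
    ∑ t ∈ S, f t = (l.map f).sum := by
  rw [← List.sum_toFinset f hn]
  refine (sum_subset (fun t ht => hl t (by simpa using ht)) fun t ht h => ?_).symm
  exact h0 t ht (by simpa using h)

lemma sum_map_cnt {ι : Type*} {l : List ι} {f : ι → ZMod 2} {s : ι → Bool} {δ : ZMod 2}
    (h : ∀ t ∈ l, f t = δ * (s t).toNat) : (l.map f).sum = δ * cnt s l := by
  induction l with
  | nil => simp [cnt]
  | cons q l ih =>
    rw [List.map_cons, List.sum_cons, cnt_cons, h q (by simp), ih fun t ht => h t (by simp [ht])]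
    push_cast; ring

lemma sum_map_length {ι : Type*} {l : List ι} {f : ι → ZMod 2} {δ : ZMod 2}
    (h : ∀ t ∈ l, f t = δ) : (l.map f).sum = l.length * δ := by
  induction l with
  | nil => simp
  | cons q l ih =>
    rw [List.map_cons, List.sum_cons, h q (by simp), ih fun t ht => h t (by simp [ht])]
    simp only [List.length_cons]
    push_cast; ring

lemma choose_two_add (b : Bool) (n : ℕ) :
    (((b.toNat + n).choose 2 : ℕ) : ZMod 2) = (n.choose 2 : ℕ) + b.toNat * n := by
  cases b
  · simp
  · simp only [Bool.toNat_true]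
    rw [add_comm 1 n, Nat.choose_succ_succ' n 1, Nat.choose_one_right]
    push_cast; ring

omit hτ in
lemma gT_mul_of_isDiagAt {T : Q → Q → A}
    (hT : ∀ i j, τ (T i j) = ((-1 : F) ^ (par i + par j)) • T i j) {p : Fin N} {Y : GMat par τ N}
    (hY : IsDiagAt p Y) (I L : Fin N → Q) : (gT par τ T p * Y) I L =
      zs F ((zp par I p + zp par L p) * ∑ t ∈ Ioi p, (zp par I t + zp par L t)) •
          (T (I p) (L p) * Y (Function.update I p (L p)) L) := by
  rw [gT_mul hT, sum_eq_single (L p)]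
  · congr 2
    have : (par (L p) : ZMod 2) = zp par L p := rfl
    rw [this, CharTwo.add_self_eq_zero, zero_add, sum_add_distrib]
  · intro x _ hx
    rw [hY _ _ (by rwa [Function.update_self]), mul_zero, smul_zero]
  · simp

omit hτ in
lemma gT_prod_apply (hT : ∀ u i j, τ (T u i j) = ((-1 : F) ^ (par i + par j)) • T u i j)
    {ps : List (Fin N)} (hs : ps.Pairwise (· < ·)) {δ : ZMod 2} {s : Fin N → Bool}
    {I L : Fin N → Q} (hf : ∀ p ∈ ps, zp par I p + zp par L p = δ * (s p).toNat)
    (hIL : ∀ p, p ∉ ps → I p = L p) :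
    (ps.map fun p => gT par τ (T (y p)) p).prod I L =
      zs F (δ * ((cnt s ps).choose 2 : ℕ)) • (ps.map fun p => T (y p) (I p) (L p)).prod := by
  induction ps generalizing I with
  | nil =>
    have : I = L := funext fun p => hIL p (by simp)
    simp [cnt, GMat.one_apply, this, zs_zero]
  | cons p ps ih =>
    rw [List.pairwise_cons] at hs
    have hp : p ∉ ps := fun h => lt_irrefl _ (hs.1 p h)
    have hd : IsDiagAt p (ps.map fun p => gT par τ (T (y p)) p).prod := by
      refine isDiagAt_list_prod fun M hM => ?_
      rw [List.mem_map] at hM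
      obtain ⟨q, hq, rfl⟩ := hM
      exact isDiagAt_gT _ (by rintro rfl; exact hp hq)
    have hu : ∀ q ∈ ps, Function.update I p (L p) q = I q := fun q hq =>
      Function.update_of_ne (by rintro rfl; exact hp hq) _ _
    rw [List.map_cons, List.prod_cons, gT_mul_of_isDiagAt (hT _) hd, ih hs.2, List.map_cons,
      List.prod_cons]
    · rw [mul_smul_comm, smul_smul, ← zs_add, cnt_cons, choose_two_add, hf p (by simp),
        sum_eq_list_sum (hs.2.imp fun h => h.ne) (fun t ht => by rw [mem_Ioi]; exact hs.1 t ht)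
          fun t ht hn => ?_, sum_map_cnt (δ := δ) (s := s) fun t ht => hf t (by simp [ht])]
      · have : δ * δ = δ := (by decide : ∀ a : ZMod 2, a * a = a) δ
        congr 2
        · linear_combination ((s p).toNat * cnt s ps : ZMod 2) * this
        · congr 1
          exact List.map_congr_left fun q hq => by rw [hu q hq]
      · rw [mem_Ioi] at ht
        have : I t = L t := hIL t (by simp [hn, ht.ne'])
        rw [zp, zp, this, CharTwo.add_self_eq_zero]
    · intro q hq
      rw [zp, hu q hq]
      exact hf q (by simp [hq])
    · intro q hq
      by_cases h : q = p
      · subst h; simp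
      · rw [Function.update_of_ne h]; exact hIL q (by simp [h, hq])

/-- `T_p` with the parameter of the site `p`. -/
def siteT (par : Q → ℕ) (τ : A →ₐ[F] A) (T : σ → Q → Q → A) (y : Fin N → σ) (p : Fin N) :
    GMat par τ N := gT par τ (T (y p)) p

/-- `R_{qk}` with the parameters of the sites `k < q`. -/
def siteR (par : Q → ℕ) (τ : A →ₐ[F] A) (g : σ → σ → F) (y : Fin N → σ) (k q : Fin N) :
    GMat par τ N := gR par τ (g (y q) (y k)) k q

lemma isDiagAt_rAll {k : Fin N} {us vs : List (Fin N)} (hu : k ∉ us) (hv : k ∉ vs) :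
    IsDiagAt k (rAll (siteR par τ g y) us vs) := by
  refine isDiagAt_list_prod fun M hM => ?_
  rw [List.mem_map] at hM
  obtain ⟨q, hq, rfl⟩ := hM
  refine isDiagAt_list_prod fun M hM => ?_
  simp only [List.mem_map, List.mem_reverse] at hM
  obtain ⟨p, hp, rfl⟩ := hM
  exact isDiagAt_gR _ (by rintro rfl; exact hu hp) (by rintro rfl; exact hv hq)

omit hτ in
lemma isDiagAt_prod_siteT {k : Fin N} {us : List (Fin N)} (hu : k ∉ us) :
    IsDiagAt k (us.map (siteT par τ T y)).prod := by
  refine isDiagAt_list_prod fun M hM => ?_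
  rw [List.mem_map] at hM
  obtain ⟨q, hq, rfl⟩ := hM
  exact isDiagAt_gT _ (by rintro rfl; exact hu hq)

variable {q₁ q₂ q₃ : Q}

/-- The entries of `T_u T_v ℝ` satisfy the recursion of lines which cross a word. -/
lemma ttr_apply (hT : ∀ u i j, τ (T u i j) = ((-1 : F) ^ (par i + par j)) • T u i j)
    (hpar : ((par q₁ : ZMod 2) + par q₂) * (par q₂ + par q₃) = 0) {P : Bool → σ → Module.End F M}
    {π : A →ₗ[F] M} (hπ : ∀ b z X, π (T z q₁ (if b then q₃ else q₂) * X) = P b z (π X))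
    {us vs : List (Fin N)} (hu : us.Pairwise (· < ·)) (hv : vs.Pairwise (· < ·))
    (huv : ∀ k ∈ us, ∀ q ∈ vs, k < q) {s : Fin N → Bool} {I L : Fin N → Q}
    (hIu : ∀ k ∈ us, I k = q₁) (hLu : ∀ k ∈ us, L k = q₂) (hIv : ∀ q ∈ vs, I q = q₂)
    (hLv : ∀ q ∈ vs, L q = if s q then q₃ else q₂) (hIL : ∀ p, p ∉ us → p ∉ vs → I p = L p) :
    π (ttr (siteT par τ T y) (siteR par τ g y) us vs I L) =
      zs F ((par q₁ + par q₂) * (us.length.choose 2 : ℕ) +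
          (par q₂ + par q₃) * ((cnt s vs).choose 2 : ℕ)) •
        lineWords (fun w z => zs F (par q₂) * g w z) (zs F (par q₂ + par q₃)) P
          (fun l => π (l.map fun x => T x.1 q₂ (if x.2 then q₃ else q₂)).prod)
          (us.map y) (stWord y s vs) := by
  have sq : ∀ a : ZMod 2, a * a = a := by decide
  have hst : ∀ b : Bool, (par (if b then q₃ else q₂) : ZMod 2) =
      par q₂ + (par q₂ + par q₃) * b.toNat := by
    intro b; cases b
    · simp
    · simp only [if_true, Bool.toNat_true]; grind
  induction us generalizing s I L with
  | nil =>
    have e : ttr (siteT par τ T y) (siteR par τ g y) [] vs = (vs.map (siteT par τ T y)).prod := by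
      have : rAll (siteR par τ g y) [] vs = 1 := by
        rw [rAll]
        refine List.prod_eq_one fun x hx => ?_
        rw [List.mem_map] at hx
        obtain ⟨q, _, rfl⟩ := hx
        rfl
      rw [ttr, this, List.map_nil, List.prod_nil, one_mul, mul_one]
    rw [e]
    have e2 := gT_prod_apply (τ := τ) (y := y) hT hv (δ := par q₂ + par q₃) (s := s) (I := I) (L := L)
      (fun p hp => by rw [zp, zp, hIv p hp, hLv p hp, hst]; grind) (fun p hp => hIL p (by simp) hp)
    rw [show (siteT par τ T y) = fun p => gT par τ (T (y p)) p from rfl, e2, map_smul]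
    congr 1
    · simp
    · rw [List.map_nil, lineWords]
      congr 2
      rw [stWord, List.map_map]
      exact List.map_congr_left fun q hq => by rw [hIv q hq, hLv q hq]; rfl
  | cons k us ih =>
    rw [List.pairwise_cons] at hu
    simp only [List.mem_cons, forall_eq_or_imp] at hIu hLu huv
    have hku : k ∉ us := fun h => lt_irrefl _ (hu.1 k h)
    have hkv : k ∉ vs := fun h => lt_irrefl _ (huv.1 k h)
    have huvd : ∀ p ∈ us, p ∉ vs := fun p h h' => lt_irrefl _ (huv.2 p h p h')
    have hvn : vs.Nodup := hv.imp fun h => h.ne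
    have hun : us.Nodup := hu.2.imp fun h => h.ne
    have hdis : us.Disjoint vs := fun p h h' => huvd p h h'
    set X := ttr (siteT par τ T y) (siteR par τ g y) us vs with hX
    have hXd : IsDiagAt k X := by
      rw [hX, ttr]
      exact ((isDiagAt_prod_siteT hku).mul (isDiagAt_prod_siteT hkv)).mul (isDiagAt_rAll hku hkv)
    rw [ttr_cons (hv.imp_of_mem fun {q q'} hq hq' hlt k' hk' =>
      gR_comm_gR _ _ (hu.1 k' hk') (huv.2 k' hk' q hq) hlt), ← hX]
    set Lf : (Fin N → Bool) → Fin N → Q := fun s p =>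
      if p = k ∨ p ∈ vs then (if s p then q₃ else q₂) else L p with hLf
    have Lk : ∀ s, Lf s k = if s k then q₃ else q₂ := fun s => by simp [hLf]
    have Lv : ∀ s, ∀ q ∈ vs, Lf s q = if s q then q₃ else q₂ := fun s q hq => by simp [hLf, hq]
    have Lu : ∀ s, ∀ q ∈ us, Lf s q = q₂ := fun s q hq => by
      have h1 : q ≠ k := by rintro rfl; exact hku hq
      simp only [hLf]
      rw [if_neg (by simp [h1, huvd q hq])]
      exact hLu.2 q hq
    have Lo : ∀ s p, p ≠ k → p ∉ us → p ∉ vs → Lf s p = I p := fun s p h1 h2 h3 => by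
      simp only [hLf]
      rw [if_neg (by simp [h1, h3]), hIL p (by simp [h1, h2]) h3]
    have Lswap : ∀ s, ∀ q ∈ vs, Lf (s ∘ Equiv.swap k q) = Lf s ∘ Equiv.swap k q := by
      intro s q hq
      funext p
      by_cases h1 : p = k
      · subst h1; simp [hLf, hq]
      · by_cases h2 : p = q
        · subst h2; simp [hLf, hq]
        · simp [hLf, Equiv.swap_apply_of_ne_of_ne h1 h2]
    set C : ZMod 2 := (par q₁ + par q₂) * ((us.length + 1).choose 2 : ℕ) with hC
    set δ : ZMod 2 := par q₂ + par q₃ with hδ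
    have fu : ∀ s, ∀ p ∈ us, zp par I p + zp par (Lf s) p = par q₁ + par q₂ := fun s p hp => by
      rw [zp, zp, hIu.2 p hp, Lu s p hp]
    have fv : ∀ s, ∀ p ∈ vs, zp par I p + zp par (Lf s) p = δ * (s p).toNat := fun s p hp => by
      rw [zp, zp, hIv p hp, Lv s p hp, hst]; grind
    have fo : ∀ s p, p ≠ k → p ∉ us → p ∉ vs → zp par I p + zp par (Lf s) p = 0 :=
      fun s p h1 h2 h3 => by rw [zp, zp, Lo s p h1 h2 h3, CharTwo.add_self_eq_zero]
    have main := eq_foldl_lineStep (γ := fun w z => zs F (par q₂) * g w z) (ε := zs F δ)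
      (y := y) (z := y k)
      (V := fun b l => P b (y k) (lineWords (fun w z => zs F (par q₂) * g w z) (zs F δ) P
          (fun l => π (l.map fun x => T x.1 q₂ (if x.2 then q₃ else q₂)).prod) (us.map y) l))
      (G := fun l s => zs F (C + δ * (((cnt s (k :: vs)).choose 2 : ℕ) + (s k).toNat * cnt s l)) •
        π ((siteT par τ T y k * X * (l.map (siteR par τ g y k)).prod : GMat par τ N) I (Lf s)))
      hvn hkv ?_ ?_ (Function.update s k false)
    · have hL : Lf (Function.update s k false) = L := by
        funext p
        by_cases h1 : p = k
        · subst h1; rw [Lk, Function.update_self, hLu.1]; rfl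
        · by_cases h2 : p ∈ vs
          · rw [Lv _ _ h2, hLv p h2, Function.update_of_ne h1]
          · simp [hLf, h1, h2]
      have hw : stWord y (Function.update s k false) vs = stWord y s vs :=
        List.map_congr_left fun q hq => by
          rw [Function.update_of_ne (by rintro rfl; exact hkv hq)]
      have hc : cnt (Function.update s k false) vs = cnt s vs := by
        rw [cnt, cnt]
        congr 1
        exact List.map_congr_left fun q hq => by
          rw [Function.update_of_ne (by rintro rfl; exact hkv hq)]
      simp only [hL, hw, hc, cnt_cons, Function.update_self, Bool.toNat_false, Nat.cast_zero,
        zero_mul, add_zero, zero_add] at main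
      rw [List.map_cons, lineWords, lineWord, ← main, smul_smul, List.length_cons, zs_mul_self,
        one_smul]
    · intro s
      have e : (siteT par τ T y k * X * (List.map (siteR par τ g y k) []).prod : GMat par τ N) I (Lf s)
          = (gT par τ (T (y k)) k * X) I (Lf s) := by
        rw [List.map_nil, List.prod_nil, mul_one]; rfl
      have up : ∀ p, p ≠ k → Function.update I k (Lf s k) p = I p := fun p hp =>
        Function.update_of_ne hp _ _
      have ne : ∀ p ∈ us, p ≠ k := by rintro p hp rfl; exact hku hp
      have ne' : ∀ p ∈ vs, p ≠ k := by rintro p hp rfl; exact hkv hp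
      have e2 := ih hu.2 huv.2 (s := s) (I := Function.update I k (Lf s k)) (L := Lf s)
        (fun p hp => by rw [up p (ne p hp)]; exact hIu.2 p hp) (Lu s)
        (fun p hp => by rw [up p (ne' p hp)]; exact hIv p hp) (Lv s) (fun p h1 h2 => by
          by_cases h : p = k
          · subst h; simp
          · rw [up p h, Lo s p h h1 h2])
      rw [e, gT_mul_of_isDiagAt (hT _) hXd, map_smul, hIu.1, Lk, hπ, ← Lk, e2, map_smul, smul_smul,
        smul_smul, ← zs_add, ← zs_add]
      conv_rhs => rw [← one_smul F (P _ _ _), ← zs_zero (F := F)]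
      congr 2
      rw [sum_eq_list_sum (l := us ++ vs) (List.nodup_append'.2 ⟨hun, hvn, hdis⟩) ?_ ?_,
        List.map_append, List.sum_append, sum_map_length (fu s), sum_map_cnt (fv s), cnt_cons,
        choose_two_add, zp, zp, hIu.1, Lk, hst, hC, Nat.choose_succ_succ' us.length 1,
        Nat.choose_one_right, show cnt s [] = 0 from rfl]
      · push_cast
        linear_combination (us.length : ZMod 2) * sq (par q₁ + par q₂) + ((s k).toNat * cnt s vs) * sq δ +
          ((s k).toNat * us.length + cnt s vs) * hpar + ((par q₁ + par q₂) * (us.length +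
            (us.length.choose (1 + 1) : ℕ)) + δ * (((cnt s vs).choose 2 : ℕ) +
              (s k).toNat * cnt s vs)) * two_eq_zero_zmod
      · intro t ht
        rw [mem_Ioi]
        rcases List.mem_append.1 ht with h | h
        · exact hu.1 t h
        · exact huv.1 t h
      · intro t ht h
        rw [List.mem_append, not_or] at h
        exact fo s t (mem_Ioi.1 ht).ne' h.1 h.2
    · intro l q l' hl s
      have hq : q ∈ vs := by simp [hl]
      have hkq : k < q := huv.1 q hq
      have hv' := hv
      rw [hl, List.pairwise_append] at hv'
      have hql : q ∉ l := fun h => lt_irrefl _ (hv'.2.2 q h q (by simp))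
      have hql' : q ∉ l' := fun h => lt_irrefl _ ((List.pairwise_cons.1 hv'.2.1).1 q h)
      have hkl : k ∉ l := fun h => hkv (by simp [hl, h])
      have hkl' : k ∉ l' := fun h => hkv (by simp [hl, h])
      have hsum : ∑ t ∈ Ioo k q, (zp par I t + zp par (Lf s) t) =
          us.length * (par q₁ + par q₂) + δ * cnt s l := by
        rw [sum_eq_list_sum (l := us ++ l) ?_ ?_ ?_, List.map_append, List.sum_append,
          sum_map_length (fu s), sum_map_cnt fun t ht => fv s t (by simp [hl, ht])]
        · exact List.nodup_append'.2 ⟨hun, hv'.1.imp fun h => h.ne, fun p h h' =>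
            huvd p h (by simp [hl, h'])⟩
        · intro t ht
          rw [mem_Ioo]
          rcases List.mem_append.1 ht with h | h
          · exact ⟨hu.1 t h, huv.2 t h q hq⟩
          · exact ⟨huv.1 t (by simp [hl, h]), hv'.2.2 t h q (by simp)⟩
        · intro t ht h
          rw [List.mem_append, not_or] at h
          rw [mem_Ioo] at ht
          refine fo s t ht.1.ne' h.1 fun h' => ?_
          rw [hl, List.mem_append, List.mem_cons] at h'
          rcases h' with h' | rfl | h'
          · exact h.2 h'
          · exact lt_irrefl _ ht.2
          · exact lt_asymm ht.2 ((List.pairwise_cons.1 hv'.2.1).1 t h')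
      have e : (siteT par τ T y k * X * (List.map (siteR par τ g y k) (l ++ [q])).prod :
          GMat par τ N) = siteT par τ T y k * X * (List.map (siteR par τ g y k) l).prod *
            gR par τ (g (y q) (y k)) k q := by
        rw [List.map_append, List.prod_append, ← mul_assoc]; simp [siteR]
      simp only [e, mul_gR _ hkq, Lswap s q hq, map_add, map_smul, smul_add]
      rw [← sum_add_distrib, hsum, zp, zp, zp, hIv q hq, Lk, Lv s q hq, hst, hst]
      generalize (siteT par τ T y k * X * (List.map (siteR par τ g y k) l).prod : GMat par τ N) = Z
      have c1 : cnt (s ∘ Equiv.swap k q) l = cnt s l := cnt_comp_swap s hkl hql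
      have c2 : cnt (s ∘ Equiv.swap k q) (k :: vs) = cnt s (k :: vs) := by
        rw [hl, cnt_cons, cnt_append, cnt_cons, cnt_cons, cnt_append, cnt_cons, c1,
          cnt_comp_swap s hkl' hql', Function.comp_apply, Function.comp_apply,
          Equiv.swap_apply_left, Equiv.swap_apply_right]
        ring
      rw [c1, c2, cnt_append, Function.comp_apply, Equiv.swap_apply_left]
      generalize ((cnt s (k :: vs)).choose 2 : ℕ) = n₁
      simp only [cnt_cons s q [], show cnt s [] = 0 from rfl, add_zero]
      by_cases hs : s k = s q
      · rw [if_pos hs]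
        have : Lf s ∘ Equiv.swap k q = Lf s := by
          funext p
          by_cases h1 : p = k
          · subst h1; simp [Lk, Lv s q hq, hs]
          · by_cases h2 : p = q
            · subst h2; simp [Lk, Lv s p hq, hs]
            · simp [Equiv.swap_apply_of_ne_of_ne h1 h2]
        rw [this, smul_smul, smul_smul, ← add_smul]
        congr 1
        rw [hs]
        have e1 : ∀ x y : ZMod 2, x * x + (x + x) * y = x := fun x y => by
          linear_combination sq x + x * y * two_eq_zero_zmod
        rw [e1]
        cases s q
        · simp only [Bool.toNat_false, Nat.cast_zero, zero_mul, mul_zero, add_zero, Bool.false_eq_true,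
            if_false]
          ring
        · simp only [Bool.toNat_true, Nat.cast_one, one_mul, mul_one, if_true, Nat.cast_add]
          rw [← add_assoc (n₁ : ZMod 2), mul_add δ _ 1, ← add_assoc, zs_add _ (δ * 1), mul_one,
            zs_add (par q₂ : ZMod 2) δ]
          linear_combination (zs F (C + δ * (n₁ + cnt s l)) * g (y q) (y k) * zs F (par q₂ : ZMod 2)) *
            zs_mul_self (F := F) δ
      · rw [if_neg hs]
        have e1 : ∀ b b' : Bool, b ≠ b' → ((par q₂ : ZMod 2) + δ * b.toNat) * (par q₂ + δ * b'.toNat) +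
            (par q₂ + δ * b.toNat + (par q₂ + δ * b'.toNat)) *
              (par q₂ + (us.length * (par q₁ + par q₂) + δ * cnt s l)) = par q₂ + δ * cnt s l := by
          have : ((par q₂ : ZMod 2)) * (par q₂ + δ) + (par q₂ + (par q₂ + δ)) *
              (par q₂ + (us.length * (par q₁ + par q₂) + δ * cnt s l)) = par q₂ + δ * cnt s l := by
            linear_combination sq (par q₂) + (us.length : ZMod 2) * hpar + (cnt s l : ZMod 2) * sq δ +
              (par q₂ * δ + par q₂ * (par q₂ + (us.length * (par q₁ + par q₂) + δ * cnt s l))) *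
                two_eq_zero_zmod
          intro b b' hb
          cases b <;> cases b' <;>
            simp only [Bool.toNat_true, Bool.toNat_false, Nat.cast_zero, Nat.cast_one, mul_zero,
              mul_one, add_zero, ne_eq, not_true_eq_false] at hb ⊢
          · exact this
          · rw [← this]; ring
        rw [e1 _ _ hs, smul_smul, smul_smul, zs_add (par q₂ : ZMod 2)]
        cases h1 : s k <;> cases h2 : s q
        · exact absurd (h1.trans h2.symm) hs
        · simp only [Bool.toNat_true, Bool.toNat_false, Nat.cast_zero, Nat.cast_one, zero_mul, one_mul,
            add_zero]
          rw [mul_add δ, ← add_assoc, zs_add _ (δ * (cnt s l : ZMod 2))]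
          congr 2
          ring
        · simp only [Bool.toNat_true, Bool.toNat_false, Nat.cast_zero, Nat.cast_one, zero_mul, one_mul,
            add_zero]
          congr 2
          rw [mul_add δ, ← add_assoc, zs_add _ (δ * (cnt s l : ZMod 2))]
          linear_combination (zs F (C + δ * n₁) * g (y q) (y k) * zs F (par q₂ : ZMod 2)) *
            zs_mul_self (F := F) (δ * (cnt s l : ZMod 2))
        · exact absurd (h1.trans h2.symm) hs

end Entries
end SuperYangian

namespace SuperYangian

section Entries

open Finset

variable {F A Q σ M : Type*} [Field F] [Ring A] [Algebra F A] [AddCommGroup M] [Module F M] {N : ℕ}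
  {par : Q → ℕ} {τ : A →ₐ[F] A} [Fintype Q] [DecidableEq Q] [hτ : Fact (τ * τ = 1)]
  {g : σ → σ → F} {T : σ → Q → Q → A} {y : Fin N → σ} {q₁ q₂ q₃ : Q}

/-- The entries of `ℝ T_v T_u` satisfy the recursion of lines which cross a word. -/
lemma rtt_apply (hT : ∀ u i j, τ (T u i j) = ((-1 : F) ^ (par i + par j)) • T u i j)
    (hpar : ((par q₁ : ZMod 2) + par q₂) * (par q₂ + par q₃) = 0) {P : Bool → σ → Module.End F M}
    {π : A →ₗ[F] M} (hπ : ∀ b z X, π (T z (if b then q₁ else q₂) q₃ * X) = P b z (π X))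
    {us vs : List (Fin N)} (hu : us.Pairwise (· < ·)) (hv : vs.Pairwise (· < ·))
    (huv : ∀ q ∈ vs, ∀ k ∈ us, k < q) {s : Fin N → Bool} {I L : Fin N → Q}
    (hIv : ∀ q ∈ vs, I q = q₂) (hLv : ∀ q ∈ vs, L q = q₃) (hLu : ∀ k ∈ us, L k = q₂)
    (hIu : ∀ k ∈ us, I k = if s k then q₁ else q₂) (hIL : ∀ p, p ∉ us → p ∉ vs → I p = L p) :
    π (rtt (siteT par τ T y) (siteR par τ g y) us vs I L) =
      zs F ((par q₂ + par q₃) * (vs.length.choose 2 : ℕ) +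
          (par q₁ + par q₂) * ((cnt s us).choose 2 : ℕ)) •
        lineWords (fun w z => zs F (par q₂) * g z w) (zs F (par q₁ + par q₂)) P
          (fun l => π (l.map fun x => T x.1 (if x.2 then q₁ else q₂) q₂).prod)
          (vs.map y) (stWord y s us) := by
  have sq : ∀ a : ZMod 2, a * a = a := by decide
  have hst : ∀ b : Bool, (par (if b then q₁ else q₂) : ZMod 2) =
      par q₂ + (par q₁ + par q₂) * b.toNat := by
    intro b; cases b
    · simp
    · simp only [if_true, Bool.toNat_true]; grind
  induction vs generalizing s I L with
  | nil =>
    have e : rtt (siteT par τ T y) (siteR par τ g y) us [] = (us.map (siteT par τ T y)).prod := by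
      rw [rtt, rAll, List.map_nil, List.map_nil, List.prod_nil, one_mul, one_mul]
    rw [e]
    have e2 := gT_prod_apply (τ := τ) (y := y) hT hu (δ := par q₁ + par q₂) (s := s) (I := I) (L := L)
      (fun p hp => by rw [zp, zp, hLu p hp, hIu p hp, hst]; grind) (fun p hp => hIL p hp (by simp))
    rw [show (siteT par τ T y) = fun p => gT par τ (T (y p)) p from rfl, e2, map_smul]
    congr 1
    · simp
    · rw [List.map_nil, lineWords]
      congr 2
      rw [stWord, List.map_map]
      exact List.map_congr_left fun q hq => by rw [hLu q hq, hIu q hq]; rfl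
  | cons j vs ih =>
    rw [List.pairwise_cons] at hv
    simp only [List.mem_cons, forall_eq_or_imp] at hIv hLv huv
    have hjv : j ∉ vs := fun h => lt_irrefl _ (hv.1 j h)
    have hju : j ∉ us := fun h => lt_irrefl _ (huv.1 j h)
    have hvud : ∀ p ∈ vs, p ∉ us := fun p h h' => lt_irrefl _ (huv.2 p h p h')
    have hvn : vs.Nodup := hv.2.imp fun h => h.ne
    have hun : us.Nodup := hu.imp fun h => h.ne
    set X := rtt (siteT par τ T y) (siteR par τ g y) us vs with hX
    have hXd : IsDiagAt j X := by
      rw [hX, rtt]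
      exact (isDiagAt_rAll hju hjv).mul ((isDiagAt_prod_siteT hjv).mul (isDiagAt_prod_siteT hju))
    rw [rtt_cons (t := siteT par τ T y) (r := siteR par τ g y) (fun k hk q hq => gT_comm_gR (hT _) _ (huv.2 q hq k hk) (huv.1 k hk).ne'
      (hv.1 q hq).ne), ← hX]
    set If : (Fin N → Bool) → Fin N → Q := fun s p =>
      if p = j ∨ p ∈ us then (if s p then q₁ else q₂) else I p with hIf
    have Ij : ∀ s, If s j = if s j then q₁ else q₂ := fun s => by simp [hIf]
    have Iu : ∀ s, ∀ q ∈ us, If s q = if s q then q₁ else q₂ := fun s q hq => by simp [hIf, hq]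
    have Iv : ∀ s, ∀ q ∈ vs, If s q = q₂ := fun s q hq => by
      have h1 : q ≠ j := by rintro rfl; exact hjv hq
      simp only [hIf]
      rw [if_neg (by simp [h1, hvud q hq])]
      exact hIv.2 q hq
    have Io : ∀ s p, p ≠ j → p ∉ us → p ∉ vs → If s p = L p := fun s p h1 h2 h3 => by
      simp only [hIf]
      rw [if_neg (by simp [h1, h2]), hIL p h2 (by simp [h1, h3])]
    have Iswap : ∀ s, ∀ q ∈ us, If (s ∘ Equiv.swap j q) = If s ∘ Equiv.swap q j := by
      intro s q hq
      rw [Equiv.swap_comm q j]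
      funext p
      by_cases h1 : p = j
      · subst h1; simp [hIf, hq]
      · by_cases h2 : p = q
        · subst h2; simp [hIf, hq]
        · simp [hIf, Equiv.swap_apply_of_ne_of_ne h1 h2]
    set e : ZMod 2 := par q₂ + par q₃ with he
    set C : ZMod 2 := e * ((vs.length + 1).choose 2 : ℕ) with hC
    set δ : ZMod 2 := par q₁ + par q₂ with hδ
    have fv : ∀ s, ∀ p ∈ vs, zp par (If s) p + zp par L p = e := fun s p hp => by
      rw [zp, zp, hLv.2 p hp, Iv s p hp]
    have fu : ∀ s, ∀ p ∈ us, zp par (If s) p + zp par L p = δ * (s p).toNat := fun s p hp => by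
      rw [zp, zp, hLu p hp, Iu s p hp, hst]; grind
    have fo : ∀ s p, p ≠ j → p ∉ us → p ∉ vs → zp par (If s) p + zp par L p = 0 :=
      fun s p h1 h2 h3 => by rw [zp, zp, Io s p h1 h2 h3, CharTwo.add_self_eq_zero]
    have main := eq_foldl_lineStep (γ := fun w z => zs F (par q₂) * g z w) (ε := zs F δ)
      (y := y) (z := y j)
      (V := fun b l => P b (y j) (lineWords (fun w z => zs F (par q₂) * g z w) (zs F δ) P
          (fun l => π (l.map fun x => T x.1 (if x.2 then q₁ else q₂) q₂).prod) (vs.map y) l))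
      (G := fun l s => zs F (C + δ * (((cnt s (j :: us)).choose 2 : ℕ) +
          (s j).toNat * (cnt s us + cnt s l))) •
        π ((rRow (siteR par τ g y) l j * (siteT par τ T y j * X) : GMat par τ N) (If s) L))
      hun hju ?_ ?_ (Function.update s j false)
    · have hI : If (Function.update s j false) = I := by
        funext p
        by_cases h1 : p = j
        · subst h1; rw [Ij, Function.update_self, hIv.1]; rfl
        · by_cases h2 : p ∈ us
          · rw [Iu _ _ h2, hIu p h2, Function.update_of_ne h1]
          · simp [hIf, h1, h2]
      have hw : stWord y (Function.update s j false) us = stWord y s us :=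
        List.map_congr_left fun q hq => by
          rw [Function.update_of_ne (by rintro rfl; exact hju hq)]
      have hc : cnt (Function.update s j false) us = cnt s us := by
        rw [cnt, cnt]
        congr 1
        exact List.map_congr_left fun q hq => by
          rw [Function.update_of_ne (by rintro rfl; exact hju hq)]
      simp only [hI, hw, hc, cnt_cons, Function.update_self, Bool.toNat_false, Nat.cast_zero,
        zero_mul, add_zero, zero_add] at main
      rw [List.map_cons, lineWords, lineWord, ← main, smul_smul, List.length_cons, zs_mul_self,
        one_smul]
    · intro s
      have e0 : (rRow (siteR par τ g y) [] j * (siteT par τ T y j * X) : GMat par τ N) (If s) L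
          = (gT par τ (T (y j)) j * X) (If s) L := by
        rw [rRow, List.reverse_nil, List.map_nil, List.prod_nil, one_mul]; rfl
      have up : ∀ p, p ≠ j → Function.update (If s) j (L j) p = If s p := fun p hp =>
        Function.update_of_ne hp _ _
      have ne : ∀ p ∈ us, p ≠ j := by rintro p hp rfl; exact hju hp
      have ne' : ∀ p ∈ vs, p ≠ j := by rintro p hp rfl; exact hjv hp
      have e2 := ih hv.2 huv.2 (s := s) (I := Function.update (If s) j (L j)) (L := L)
        (fun p hp => by rw [up p (ne' p hp)]; exact Iv s p hp) hLv.2 hLu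
        (fun p hp => by rw [up p (ne p hp)]; exact Iu s p hp) (fun p h1 h2 => by
          by_cases h : p = j
          · subst h; simp
          · rw [up p h, Io s p h h1 h2])
      have e3 : π (T (y j) (If s j) (L j) * X (Function.update (If s) j (L j)) L) =
          P (s j) (y j) (π (X (Function.update (If s) j (L j)) L)) := by
        rw [Ij, ← hπ, hLv.1]
      rw [e0, gT_mul_of_isDiagAt (hT _) hXd, map_smul, e3, e2, map_smul, smul_smul,
        smul_smul, ← zs_add, ← zs_add]
      conv_rhs => rw [← one_smul F (P _ _ _), ← zs_zero (F := F)]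
      congr 2
      rw [sum_eq_list_sum (l := vs) hvn (fun t ht => mem_Ioi.2 (hv.1 t ht)) fun t ht h => fo s t
        (mem_Ioi.1 ht).ne' (fun h' => lt_asymm (mem_Ioi.1 ht) (huv.1 t h')) h,
        sum_map_length (fv s), cnt_cons, choose_two_add, zp, zp, hLv.1, Ij, hst, hC,
        Nat.choose_succ_succ' vs.length 1, Nat.choose_one_right, show cnt s [] = 0 from rfl]
      push_cast
      linear_combination (vs.length : ZMod 2) * sq e + ((s j).toNat * vs.length) * hpar +
        (e * (vs.length + (vs.length.choose (1 + 1) : ℕ)) + δ * (((cnt s us).choose 2 : ℕ) +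
            (s j).toNat * cnt s us)) * two_eq_zero_zmod
    · intro l q l' hl s
      have hq : q ∈ us := by simp [hl]
      have hqj : q < j := huv.1 q hq
      have hu' := hu
      rw [hl, List.pairwise_append] at hu'
      have hql : q ∉ l := fun h => lt_irrefl _ (hu'.2.2 q h q (by simp))
      have hql' : q ∉ l' := fun h => lt_irrefl _ ((List.pairwise_cons.1 hu'.2.1).1 q h)
      have hjl : j ∉ l := fun h => hju (by simp [hl, h])
      have hjl' : j ∉ l' := fun h => hju (by simp [hl, h])
      have hsum : ∑ t ∈ Ioo q j, (zp par (If s) t + zp par L t) = δ * cnt s l' := by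
        rw [sum_eq_list_sum (l := l') ?_ ?_ ?_, sum_map_cnt fun t ht => fu s t (by simp [hl, ht])]
        · exact (List.pairwise_cons.1 hu'.2.1).2.imp fun h => h.ne
        · intro t ht
          exact mem_Ioo.2 ⟨(List.pairwise_cons.1 hu'.2.1).1 t ht, huv.1 t (by simp [hl, ht])⟩
        · intro t ht h
          rw [mem_Ioo] at ht
          refine fo s t ht.2.ne (fun h' => ?_) fun h' => lt_asymm ht.2 (hv.1 t h')
          rw [hl, List.mem_append, List.mem_cons] at h'
          rcases h' with h' | rfl | h'
          · exact lt_asymm ht.1 (hu'.2.2 t h' q (by simp))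
          · exact lt_irrefl _ ht.1
          · exact h h'
      have e0 : (rRow (siteR par τ g y) (l ++ [q]) j * (siteT par τ T y j * X) : GMat par τ N) =
          gR par τ (g (y j) (y q)) q j *
            (rRow (siteR par τ g y) l j * (siteT par τ T y j * X)) := by
        simp [siteR, rRow, mul_assoc]
      simp only [e0, gR_mul _ hqj, map_add, map_smul, smul_add]
      rw [← Iswap s q hq, ← sum_add_distrib, hsum, zp, zp, zp, hLu q hq, Ij, Iu s q hq, hst, hst]
      generalize (rRow (siteR par τ g y) l j * (siteT par τ T y j * X) : GMat par τ N) = Z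
      have c1 : cnt (s ∘ Equiv.swap j q) l = cnt s l := cnt_comp_swap s hjl hql
      have c0 : cnt s us = cnt s l + ((s q).toNat + cnt s l') := by rw [hl, cnt_append, cnt_cons]
      have c3 : cnt (s ∘ Equiv.swap j q) us = cnt s l + ((s j).toNat + cnt s l') := by
        rw [hl, cnt_append, cnt_cons, c1, cnt_comp_swap s hjl' hql', Function.comp_apply,
          Equiv.swap_apply_right]
      have c2 : cnt (s ∘ Equiv.swap j q) (j :: us) = cnt s (j :: us) := by
        rw [cnt_cons, cnt_cons, c3, c0, Function.comp_apply, Equiv.swap_apply_left]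
        ring
      rw [c1, c2, c3, c0, cnt_append, Function.comp_apply, Equiv.swap_apply_left]
      generalize ((cnt s (j :: us)).choose 2 : ℕ) = n₁
      simp only [cnt_cons s q [], show cnt s [] = 0 from rfl, add_zero]
      by_cases hs : s j = s q
      · rw [if_pos hs]
        have : If (s ∘ Equiv.swap j q) = If s := by
          congr 1
          funext p
          by_cases h1 : p = j
          · subst h1; simp [hs]
          · by_cases h2 : p = q
            · subst h2; simp [hs]
            · simp [Equiv.swap_apply_of_ne_of_ne h1 h2]
        rw [this, smul_smul, smul_smul, ← add_smul]
        congr 1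
        rw [hs]
        have e1 : ∀ x y : ZMod 2, x * x + (x + x) * y = x := fun x y => by
          linear_combination sq x + x * y * two_eq_zero_zmod
        rw [e1]
        cases s q
        · simp only [Bool.toNat_false, Nat.cast_zero, zero_mul, mul_zero, add_zero, Bool.false_eq_true,
            if_false]
          ring
        · simp only [Bool.toNat_true, Nat.cast_one, one_mul, mul_one, if_true, Nat.cast_add]
          rw [show C + δ * (n₁ + (cnt s l + (1 + cnt s l') + (cnt s l + 1)) : ZMod 2) =
              C + δ * (n₁ + (cnt s l + (1 + cnt s l') + cnt s l)) + δ by ring,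
            zs_add _ δ, zs_add (par q₂ : ZMod 2) δ]
          linear_combination (zs F (C + δ * (n₁ + (cnt s l + (1 + cnt s l') + cnt s l))) *
            g (y j) (y q) * zs F (par q₂ : ZMod 2)) * zs_mul_self (F := F) δ
      · rw [if_neg hs]
        have e1 : ∀ b b' : Bool, b ≠ b' → ((par q₂ : ZMod 2) + δ * b.toNat) * (par q₂ + δ * b'.toNat) +
            (par q₂ + δ * b.toNat + (par q₂ + δ * b'.toNat)) *
              (par q₂ + δ * cnt s l') = par q₂ + δ * cnt s l' := by
          have : ((par q₂ : ZMod 2)) * (par q₂ + δ) + (par q₂ + (par q₂ + δ)) *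
              (par q₂ + δ * cnt s l') = par q₂ + δ * cnt s l' := by
            linear_combination sq (par q₂) + (cnt s l' : ZMod 2) * sq δ +
              (par q₂ * δ + par q₂ * (par q₂ + δ * cnt s l')) * two_eq_zero_zmod
          intro b b' hb
          cases b <;> cases b' <;>
            simp only [Bool.toNat_true, Bool.toNat_false, Nat.cast_zero, Nat.cast_one, mul_zero,
              mul_one, add_zero, ne_eq, not_true_eq_false] at hb ⊢
          · exact this
          · linear_combination this
        rw [e1 _ _ (Ne.symm hs), smul_smul, smul_smul, zs_add (par q₂ : ZMod 2)]
        have e4 : C + δ * (n₁ + (cnt s l + cnt s l' + cnt s l) : ZMod 2) =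
            C + δ * n₁ + δ * cnt s l' := by
          linear_combination δ * cnt s l * two_eq_zero_zmod
        cases h1 : s j <;> cases h2 : s q
        · exact absurd (h1.trans h2.symm) hs
        · simp only [Bool.toNat_true, Bool.toNat_false, Nat.cast_zero, Nat.cast_one, zero_mul, one_mul,
            add_zero, zero_add, Nat.cast_add]
          rw [e4, zs_add _ (δ * (cnt s l' : ZMod 2))]
          congr 2
          ring
        · simp only [Bool.toNat_true, Bool.toNat_false, Nat.cast_zero, Nat.cast_one, zero_mul, one_mul,
            add_zero, zero_add, Nat.cast_add]
          rw [e4, zs_add _ (δ * (cnt s l' : ZMod 2))]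
          congr 2
          linear_combination (zs F (C + δ * n₁) * g (y j) (y q) * zs F (par q₂ : ZMod 2)) *
            zs_mul_self (F := F) (δ * (cnt s l' : ZMod 2))
        · exact absurd (h1.trans h2.symm) hs

end Entries
end SuperYangian

namespace SuperYangian

section Supertrace

open Finset

variable {F A Q σ M : Type*} [Field F] [Ring A] [Algebra F A] {N : ℕ}
  {par : Q → ℕ} {τ : A →ₐ[F] A} [Fintype Q] [DecidableEq Q]

/-- The matrix unit `E_{ij}` at the site `p`. -/
def gE (par : Q → ℕ) (τ : A →ₐ[F] A) (p : Fin N) (i j : Q) : GMat par τ N := fun I J =>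
  if I p = i ∧ J p = j ∧ ∀ q, q ≠ p → I q = J q then 1 else 0

lemma gE_mul_apply (p : Fin N) (i j : Q) (Y : GMat par τ N) (I L : Fin N → Q) :
    (gE par τ p i j * Y) I L = if I p = i then ((-1 : F) ^ gExp par I (Function.update I p j) L) •
      Y (Function.update I p j) L else 0 := by
  rw [GMat.mul_apply, sum_eq_single (Function.update I p j)]
  · rw [gE, Function.update_self]
    by_cases h : I p = i
    · rw [if_pos h, if_pos ⟨h, rfl, fun q hq => (Function.update_of_ne hq _ _).symm⟩, map_one, one_mul]
    · rw [if_neg h, if_neg (fun h' => h h'.1), map_zero, zero_mul, smul_zero]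
  · intro J _ hJ
    rw [gE, if_neg, map_zero, zero_mul, smul_zero]
    rintro ⟨h1, h2, h3⟩
    refine hJ (funext fun q => ?_)
    by_cases hq : q = p
    · subst hq; rw [Function.update_self, h2]
    · rw [Function.update_of_ne hq, h3 q hq]
  · simp

lemma gE_prod_apply [Fact (τ * τ = 1)] (α β : Fin N → Q) {ps : List (Fin N)}
    (hs : ps.Pairwise (· < ·)) (I L : Fin N → Q) :
    (ps.map fun p => gE par τ p (α p) (β p)).prod I L =
      if (∀ p ∈ ps, I p = α p ∧ L p = β p) ∧ ∀ p, p ∉ ps → I p = L p then 1 else 0 := by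
  induction ps generalizing I with
  | nil =>
    simp only [List.map_nil, List.prod_nil, GMat.one_apply, List.not_mem_nil, false_imp_iff,
      implies_true, true_and, not_false_eq_true, true_imp_iff]
    exact if_congr funext_iff rfl rfl
  | cons p ps ih =>
    rw [List.pairwise_cons] at hs
    have hp : p ∉ ps := fun h => lt_irrefl _ (hs.1 p h)
    have ne : ∀ q ∈ ps, q ≠ p := by rintro q hq rfl; exact hp hq
    rw [List.map_cons, List.prod_cons, gE_mul_apply, ih hs.2]
    by_cases h : (∀ q ∈ p :: ps, I q = α q ∧ L q = β q) ∧ ∀ q, q ∉ p :: ps → I q = L q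
    · rw [if_pos h, if_pos (h.1 p (by simp)).1]
      have key : (∀ q ∈ ps, Function.update I p (β p) q = α q ∧ L q = β q) ∧
          ∀ q, q ∉ ps → Function.update I p (β p) q = L q := by
        refine ⟨fun q hq => ?_, fun q hq => ?_⟩
        · rw [Function.update_of_ne (ne q hq)]; exact h.1 q (by simp [hq])
        · by_cases hqp : q = p
          · subst hqp; rw [Function.update_self, (h.1 q (by simp)).2]
          · rw [Function.update_of_ne hqp]; exact h.2 q (by simp [hqp, hq])
      rw [if_pos key, neg_one_pow_congr (l := 0), pow_zero, one_smul]
      rw [gExp_cast, Nat.cast_zero, sum_eq_single p]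
      · rw [sum_eq_zero, mul_zero]
        intro q hq
        rw [key.2 q fun h' => lt_asymm (mem_Iio.1 hq) (hs.1 q h'), CharTwo.add_self_eq_zero]
      · intro q _ hq
        rw [Function.update_of_ne hq, CharTwo.add_self_eq_zero, zero_mul]
      · simp
    · rw [if_neg h]
      by_cases h1 : I p = α p
      · rw [if_pos h1, if_neg, smul_zero]
        rintro ⟨h2, h3⟩
        refine h ⟨fun q hq => ?_, fun q hq => ?_⟩
        · rcases List.mem_cons.1 hq with rfl | hq
          · exact ⟨h1, by rw [← h3 q hp, Function.update_self]⟩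
          · have := h2 q hq
            rwa [Function.update_of_ne (ne q hq)] at this
        · rw [List.mem_cons, not_or] at hq
          rw [← h3 q hq.2, Function.update_of_ne hq.1]
      · rw [if_neg h1]

lemma supertrace_mul_unit {X E : GMat par τ N} (hX : IsEvenMat X) {I₀ L₀ : Fin N → Q}
    (hE : ∀ I J, E I J = if I = L₀ ∧ J = I₀ then 1 else 0) :
    ∑ I, ((-1 : F) ^ (∑ p, par (I p))) • (X * E) I I =
      zs F (∑ p, zp par I₀ p + ∑ p, (zp par I₀ p + zp par L₀ p) *
        ∑ q ∈ Ioi p, (zp par I₀ q + zp par L₀ q) + ∑ p, (zp par I₀ p + zp par L₀ p)) • X I₀ L₀ := by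
  have hk : ∀ k : ℕ, (τ ^ k) (X I₀ L₀) = ((-1 : F) ^ (gDeg par I₀ L₀ * k)) • X I₀ L₀ := by
    intro k
    induction k with
    | zero => simp
    | succ k ih => rw [pow_succ', AlgHom.mul_apply, ih, map_smul, hX, smul_smul, ← pow_add]; rfl
  rw [sum_eq_single I₀]
  · rw [GMat.mul_apply, sum_eq_single L₀]
    · rw [hE, if_pos ⟨rfl, rfl⟩, mul_one, hk, smul_smul, smul_smul, ← pow_add, ← pow_add, ← zs_natCast]
      congr 2
      push_cast
      rw [gExp_cast']
      have h1 : (gDeg par I₀ L₀ : ZMod 2) = ∑ p, (zp par I₀ p + zp par L₀ p) := by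
        rw [gDeg]; push_cast; rfl
      have h2 : (gDeg par L₀ I₀ : ZMod 2) = ∑ p, (zp par I₀ p + zp par L₀ p) := by
        rw [gDeg]; push_cast
        exact sum_congr rfl fun p _ => add_comm _ _
      have sq : ∀ a : ZMod 2, a * a = a := by decide
      have h3 : ∑ p, ((par (L₀ p) : ZMod 2) + par (I₀ p)) *
          ∑ q ∈ Ioi p, ((par (I₀ q) : ZMod 2) + par (L₀ q)) =
          ∑ p, (zp par I₀ p + zp par L₀ p) * ∑ q ∈ Ioi p, (zp par I₀ q + zp par L₀ q) :=
        sum_congr rfl fun p _ => by rw [add_comm (par (L₀ p) : ZMod 2)]; rfl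
      rw [h1, h2, h3, sq]
      rfl
    · intro J _ hJ
      rw [hE, if_neg (fun h => hJ h.1), mul_zero, smul_zero]
    · simp
  · intro I _ hI
    have : (X * E) I I = 0 := by
      rw [GMat.mul_apply]
      exact sum_eq_zero fun J _ => by rw [hE, if_neg (fun h => hI h.2), mul_zero, smul_zero]
    rw [this, smul_zero]
  · simp

lemma sum_pairs {f : Fin N → ZMod 2} {δ : ZMod 2} {ps : List (Fin N)} (hs : ps.Pairwise (· < ·))
    (hf : ∀ p ∈ ps, f p = δ) (hf0 : ∀ p, p ∉ ps → f p = 0) :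
    ∑ p, f p * ∑ q ∈ Ioi p, f q = δ * (ps.length.choose 2 : ℕ) := by
  have key : ∀ l l', ps = l' ++ l →
      (l.map fun p => f p * ∑ q ∈ Ioi p, f q).sum = δ * (l.length.choose 2 : ℕ) := by
    intro l
    induction l with
    | nil => simp
    | cons p l ih =>
      intro l' hl
      have hs' := hs
      rw [hl, List.pairwise_append, List.pairwise_cons] at hs'
      obtain ⟨-, ⟨hp, hs1⟩, h3⟩ := hs'
      rw [List.map_cons, List.sum_cons, ih (l' ++ [p]) (by simp [hl]), hf p (by simp [hl]),
        sum_eq_list_sum (hs1.imp fun h => h.ne) (fun t ht => mem_Ioi.2 (hp t ht)) fun t ht h => ?_,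
        sum_map_length (fun t ht => hf t (by simp [hl, ht])), List.length_cons,
        Nat.choose_succ_succ' l.length 1, Nat.choose_one_right]
      · have : δ * δ = δ := (by decide : ∀ a : ZMod 2, a * a = a) δ
        push_cast
        linear_combination (l.length : ZMod 2) * this
      · refine hf0 t fun h' => ?_
        rw [hl, List.mem_append, List.mem_cons] at h'
        rw [mem_Ioi] at ht
        rcases h' with h' | rfl | h'
        · exact lt_asymm ht (h3 t h' p (by simp))
        · exact lt_irrefl _ ht
        · exact h h'
  rw [sum_eq_list_sum (hs.imp fun h => h.ne) (fun t _ => mem_univ t) fun t _ h => by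
    rw [hf0 t h, zero_mul]]
  exact key ps [] rfl

end Supertrace
end SuperYangian

noncomputable section
namespace SuperYangian
open scoped BigOperators

section Bridge

open Finset

variable {σ : Type*} [LinearOrder σ] [Finite σ] {m n : ℕ}

lemma smul_mk (k : KK σ) (k' : KK σ) (X : YY m n σ) : (k * k') • X = k • k' • X := mul_smul k k' X

/-- The grading automorphism on series. -/
def grHom (m n : ℕ) (σ : Type*) [LinearOrder σ] [Finite σ] : YY m n σ →ₐ[KK σ] YY m n σ where
  toFun := grY
  map_one' := HahnSeries.map_one (gr m n).toRingHom.toMonoidWithZeroHom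
  map_zero' := by ext; simp [grY]
  map_mul' _ _ := HahnSeries.map_mul (gr m n).toRingHom.toNonUnitalRingHom
  map_add' x y := by ext; simp [grY]
  commutes' k := by
    ext a
    exact (gr m n).commutes (k.coeff a)

lemma grHom_apply (X : YY m n σ) : grHom m n σ X = grY X := rfl

instance : Fact (grHom m n σ * grHom m n σ = 1) := ⟨by
  ext X a
  exact gr_gr (X.coeff a)⟩

lemma grY_T (c : ℂ) (i j : Fin (m + n)) (u : σ) :
    grY (T c i j u) = sg (par i + par j) • T c i j u := by
  ext a
  rw [grY, HahnSeries.map_coeff, HahnSeries.coeff_smul, T_coeff]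
  split_ifs with h
  · rw [tCoeff]
    split_ifs
    · rw [map_smul, gr_Tc, smul_comm]
    · rw [map_zero, smul_zero]
  · rw [map_zero, smul_zero]

lemma div_sub_comm_neg {R : Type*} [Field R] (c z w : R) : c / (z - w) = -(c / (w - z)) := by
  rw [← neg_sub, div_neg]

lemma g_anti (c : ℂ) (z w : σ) : g c z w = -g c w z := div_sub_comm_neg _ _ _

lemma isRTT_T (m n : ℕ) (c : ℂ) : IsRTT (par (m := m) (n := n)) (grHom m n σ) (g c)
    (fun u i j => T c i j u) where
  hom u i j := by rw [grHom_apply, grY_T]; exact sg_smul (R := KK σ) _ (T c i j u)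
  comm i j k l z w h := by
    have := T_comm c i j k l h
    rw [sg_smul (R := KK σ), sg_smul (R := KK σ)] at this
    rw [this]
    exact (smul_mk _ _ _).symm
  anti := g_anti c

/-- Elements of the graded tensor product. -/
def toG {N : ℕ} (X : SMat m n N σ) : GMat (par (m := m) (n := n)) (grHom m n σ) N := X

lemma iterate_grY (k : ℕ) (X : YY m n σ) : grY^[k] X = (grHom m n σ ^ k) X := by
  induction k with
  | zero => rfl
  | succ k ih => rw [Function.iterate_succ_apply', ih, pow_succ', AlgHom.mul_apply]; rfl

lemma toG_sMul {N : ℕ} (X Y : SMat m n N σ) : toG (sMul X Y) = toG X * toG Y := by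
  funext I L
  rw [GMat.mul_apply]
  refine sum_congr rfl fun J _ => ?_
  rw [iterate_grY, signE]
  exact sg_smul (R := KK σ) _ ((grHom m n σ ^ degE J L) (X I J) * Y J L)

lemma toG_sProd {N : ℕ} (l : List (SMat m n N σ)) : toG (sProd l) = (l.map toG).prod := by
  induction l with
  | nil => rfl
  | cons X l ih =>
    rw [List.map_cons, List.prod_cons, ← ih, ← toG_sMul]; rfl

lemma toG_auxT {N : ℕ} (c : ℂ) (p : Fin N) (u : σ) :
    toG (auxT (m := m) (n := n) c p u) = gT par (grHom m n σ) (fun i j => T c i j u) p := rfl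

lemma toG_auxE {N : ℕ} (p : Fin N) (i j : Fin (m + n)) :
    toG (auxE (σ := σ) p i j) = gE par (grHom m n σ) p i j := rfl

lemma perm_apply {N : ℕ} {p q : Fin N} (hpq : p < q) (I J : MIdx m n N) :
    perm (σ := σ) q p I J = if J = I ∘ Equiv.swap p q then sg (par (I q)) • 1 else 0 := by
  have e : ∀ i j, sMul (auxE (σ := σ) q i j) (auxE p j i) I J =
      (toG (auxE (σ := σ) q i j) * toG (auxE p j i) : GMat par (grHom m n σ) N) I J := fun i j => by rw [← toG_sMul]; rfl
  have e2 : ∀ i j, sMul (auxE (σ := σ) q i j) (auxE p j i) I J =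
      if I q = i ∧ I p = j ∧ J = I ∘ Equiv.swap p q then
        sg (par (I p) + par (I q)) • 1 else 0 := by
    intro i j
    rw [e, toG_auxE, gE_mul_apply, toG_auxE, gE, Function.update_of_ne hpq.ne]
    by_cases h : I q = i ∧ I p = j ∧ J = I ∘ Equiv.swap p q
    · obtain ⟨rfl, rfl, rfl⟩ := h
      have hup : ∀ t, t ≠ p → Function.update I q (I p) t = (I ∘ Equiv.swap p q) t := by
        intro t ht
        by_cases htq : t = q
        · subst htq; simp
        · rw [Function.update_of_ne htq, Function.comp_apply, Equiv.swap_apply_of_ne_of_ne ht htq]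
      rw [if_pos rfl, if_pos ⟨rfl, by simp, hup⟩, if_pos ⟨rfl, rfl, rfl⟩]
      · rw [sg_smul (R := KK σ)]
        congr 1
        refine neg_one_pow_congr ?_
        rw [gExp_cast, sum_eq_single q, sum_eq_single p, Function.update_self,
          Function.update_of_ne hpq.ne, Function.comp_apply, Equiv.swap_apply_left]
        · push_cast
          have : ∀ a b : ZMod 2, (a + b) * (b + a) = a + b := by decide
          rw [this, add_comm]
        · intro t _ ht
          by_cases htq : t = q
          · subst htq; simp [CharTwo.add_self_eq_zero]
          · rw [Function.update_of_ne htq, Function.comp_apply, Equiv.swap_apply_of_ne_of_ne ht htq,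
              CharTwo.add_self_eq_zero]
        · intro h; exact absurd (mem_Iio.2 hpq) h
        · intro t _ ht
          rw [Function.update_of_ne ht, CharTwo.add_self_eq_zero, zero_mul]
        · simp
    · rw [if_neg h]
      by_cases h1 : I q = i
      · rw [if_pos h1, if_neg, smul_zero]
        rintro ⟨h2, h3, h4⟩
        refine h ⟨h1, h2, ?_⟩
        funext t
        by_cases htp : t = p
        · subst htp; simp [h3, h1]
        · rw [← h4 t htp]
          by_cases htq : t = q
          · subst htq; simp [h2]
          · rw [Function.update_of_ne htq, Function.comp_apply, Equiv.swap_apply_of_ne_of_ne htp htq]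
      · rw [if_neg h1]
  rw [perm]
  simp only [e2]
  by_cases h : J = I ∘ Equiv.swap p q
  · rw [if_pos h, sum_eq_single (I q), sum_eq_single (I p), if_pos ⟨rfl, rfl, h⟩, smul_smul, ← sg_add]
    · congr 1
      refine sg_congr ?_
      push_cast
      linear_combination (par (I p) : ZMod 2) * two_eq_zero_zmod
    · intro j _ hj
      rw [if_neg (fun h => hj h.2.1.symm), smul_zero]
    · simp
    · intro i _ hi
      exact sum_eq_zero fun j _ => by rw [if_neg (fun h => hi h.1.symm), smul_zero]
    · simp
  · rw [if_neg h]
    exact sum_eq_zero fun i _ => sum_eq_zero fun j _ => by rw [if_neg (fun h' => h h'.2.2), smul_zero]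

lemma toG_Rmat {N : ℕ} (c : ℂ) {p q : Fin N} (hpq : p < q) (z w : σ) :
    toG (Rmat (m := m) (n := n) c q p z w) = gR par (grHom m n σ) (g c z w) p q := by
  funext I J
  have : toG (Rmat (m := m) (n := n) c q p z w) I J = sOne I J + scal (g c z w) (perm q p I J) := rfl
  rw [this, perm_apply hpq, scal_eq_smul, gR]
  have e : sg (par (I q)) • (1 : YY m n σ) = algebraMap (KK σ) (YY m n σ) ((-1) ^ par (I q)) := by
    rw [sg_smul (R := KK σ)]
    exact (Algebra.algebraMap_eq_smul_one _).symm
  rw [e]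
  rfl

/-- The sites of `ū`. -/
def uSites (a b : ℕ) : List (Fin (a + b)) := (List.finRange a).map (Fin.castAdd b)

/-- The sites of `v̄`. -/
def vSites (a b : ℕ) : List (Fin (a + b)) := (List.finRange b).map (Fin.natAdd a)

lemma uSites_pairwise (a b : ℕ) : (uSites a b).Pairwise (· < ·) :=
  List.Pairwise.map _ (fun _ _ h => h) (List.pairwise_lt_finRange a)

lemma vSites_pairwise (a b : ℕ) : (vSites a b).Pairwise (· < ·) :=
  List.Pairwise.map _ (fun _ _ h => by simpa using h) (List.pairwise_lt_finRange b)

lemma mem_uSites {a b : ℕ} {p : Fin (a + b)} : p ∈ uSites a b ↔ (p : ℕ) < a := by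
  simp only [uSites, List.mem_map, List.mem_finRange, true_and]
  constructor
  · rintro ⟨k, rfl⟩; simp
  · intro h; exact ⟨⟨p, h⟩, rfl⟩

lemma mem_vSites {a b : ℕ} {p : Fin (a + b)} : p ∈ vSites a b ↔ a ≤ (p : ℕ) := by
  simp only [vSites, List.mem_map, List.mem_finRange, true_and]
  constructor
  · rintro ⟨k, rfl⟩; simp
  · intro h; exact ⟨⟨p - a, by omega⟩, by ext; simp; omega⟩

lemma lt_of_mem_sites {a b : ℕ} {k q : Fin (a + b)} (hk : k ∈ uSites a b) (hq : q ∈ vSites a b) :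
    k < q := by
  rw [mem_uSites] at hk
  rw [mem_vSites] at hq
  exact Fin.lt_def.2 (lt_of_lt_of_le hk hq)

/-- The indices `i` at the sites of `ū` and `j` at the sites of `v̄`. -/
def siteIdx {a b : ℕ} (i j : Fin (m + n)) (p : Fin (a + b)) : Fin (m + n) := if (p : ℕ) < a then i else j

lemma siteIdx_u {a b : ℕ} (i j : Fin (m + n)) {p : Fin (a + b)} (hp : p ∈ uSites a b) :
    siteIdx i j p = i := if_pos (mem_uSites.1 hp)

lemma siteIdx_v {a b : ℕ} (i j : Fin (m + n)) {p : Fin (a + b)} (hp : p ∈ vSites a b) :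
    siteIdx i j p = j := if_neg (not_lt.2 (mem_vSites.1 hp))

lemma sum_sites {a b : ℕ} (i j : Fin (m + n)) : ∑ p : Fin (a + b), (par (siteIdx i j p) : ZMod 2) =
    a * par i + b * par j := by
  rw [Fin.sum_univ_add]
  have h1 : ∀ k : Fin a, (par (siteIdx i j (Fin.castAdd b k)) : ZMod 2) = par i := fun k => by
    rw [siteIdx_u _ _ (mem_uSites.2 (by simp))]
  have h2 : ∀ k : Fin b, (par (siteIdx i j (Fin.natAdd a k)) : ZMod 2) = par j := fun k => by
    rw [siteIdx_v _ _ (mem_vSites.2 (by simp))]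
  simp [h1, h2]

lemma ofFn_siteT_u (m n : ℕ) (c : ℂ) {a b : ℕ} (u : Fin a → σ) (v : Fin b → σ) :
    (List.ofFn fun k => toG (auxT (m := m) (n := n) c (Fin.castAdd b k) (u k))) =
      (uSites a b).map (siteT par (grHom m n σ) (fun u i j => T c i j u) (Fin.append u v)) := by
  rw [List.ofFn_eq_map, uSites, List.map_map]
  exact List.map_congr_left fun k _ => by
    rw [toG_auxT, Function.comp_apply, siteT, Fin.append_left]

lemma ofFn_siteT_v (m n : ℕ) (c : ℂ) {a b : ℕ} (u : Fin a → σ) (v : Fin b → σ) :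
    (List.ofFn fun k => toG (auxT (m := m) (n := n) c (Fin.natAdd a k) (v k))) =
      (vSites a b).map (siteT par (grHom m n σ) (fun u i j => T c i j u) (Fin.append u v)) := by
  rw [List.ofFn_eq_map, vSites, List.map_map]
  exact List.map_congr_left fun k _ => by
    rw [toG_auxT, Function.comp_apply, siteT, Fin.append_right]

lemma castAdd_lt_natAdd {a b : ℕ} (k : Fin a) (j : Fin b) : Fin.castAdd b k < Fin.natAdd a j :=
  lt_of_mem_sites (mem_uSites.2 (by simp)) (mem_vSites.2 (by simp))

lemma toG_Rmat_site (m n : ℕ) (c : ℂ) {a b : ℕ} (u : Fin a → σ) (v : Fin b → σ) (k : Fin a)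
    (j : Fin b) : toG (Rmat (m := m) (n := n) c (Fin.natAdd a j) (Fin.castAdd b k) (v j) (u k)) =
      siteR par (grHom m n σ) (g c) (Fin.append u v) (Fin.castAdd b k) (Fin.natAdd a j) := by
  rw [toG_Rmat c (castAdd_lt_natAdd k j), siteR, Fin.append_left, Fin.append_right]

lemma ofFn_siteR (m n : ℕ) (c : ℂ) {a b : ℕ} (u : Fin a → σ) (v : Fin b → σ) :
    (List.ofFn fun j => (List.ofFn fun k => toG (Rmat (m := m) (n := n) c (Fin.natAdd a j)
      (Fin.castAdd b k) (v j) (u k))).reverse.prod) =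
      (vSites a b).map (rRow (siteR par (grHom m n σ) (g c) (Fin.append u v)) (uSites a b)) := by
  rw [List.ofFn_eq_map, vSites, List.map_map]
  refine List.map_congr_left fun j _ => ?_
  rw [Function.comp_apply, rRow, List.ofFn_eq_map, uSites, List.map_reverse, List.map_map]
  exact congrArg (fun l => List.prod (List.reverse l))
    (List.map_congr_left fun k _ => toG_Rmat_site m n c u v k j)

lemma ofFn_gE_u (i₁ i₂ i₃ : Fin (m + n)) (a b : ℕ) :
    (List.ofFn fun k : Fin a => toG (auxE (σ := σ) (Fin.castAdd b k) i₂ i₁)) =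
      (uSites a b).map fun p => gE par (grHom m n σ) p (siteIdx i₂ i₃ p) (siteIdx i₁ i₂ p) := by
  rw [List.ofFn_eq_map, uSites, List.map_map]
  refine List.map_congr_left fun k _ => ?_
  have hk : Fin.castAdd b k ∈ uSites a b := mem_uSites.2 (by simp)
  rw [toG_auxE, Function.comp_apply, siteIdx_u _ _ hk, siteIdx_u _ _ hk]

lemma ofFn_gE_v (i₁ i₂ i₃ : Fin (m + n)) (a b : ℕ) :
    (List.ofFn fun k : Fin b => toG (auxE (σ := σ) (Fin.natAdd a k) i₃ i₂)) =
      (vSites a b).map fun p => gE par (grHom m n σ) p (siteIdx i₂ i₃ p) (siteIdx i₁ i₂ p) := by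
  rw [List.ofFn_eq_map, vSites, List.map_map]
  refine List.map_congr_left fun k _ => ?_
  have hk : Fin.natAdd a k ∈ vSites a b := mem_vSites.2 (by simp)
  rw [toG_auxE, Function.comp_apply, siteIdx_v _ _ hk, siteIdx_v _ _ hk]

/-- `T_u T_v ℝ`. -/
def betheMat (m n : ℕ) (c : ℂ) {a b : ℕ} (u : Fin a → σ) (v : Fin b → σ) :
    GMat (par (m := m) (n := n)) (grHom m n σ) (a + b) :=
  ttr (siteT par (grHom m n σ) (fun u i j => T c i j u) (Fin.append u v))
    (siteR par (grHom m n σ) (g c) (Fin.append u v)) (uSites a b) (vSites a b)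

/-- `E_{21} ⋯ E_{21} E_{32} ⋯ E_{32}`. -/
def unitMat (i₁ i₂ i₃ : Fin (m + n)) (σ : Type*) [LinearOrder σ] [Finite σ] (a b : ℕ) :
    GMat (par (m := m) (n := n)) (grHom m n σ) (a + b) :=
  ((uSites a b ++ vSites a b).map fun p =>
    gE par (grHom m n σ) p (siteIdx i₂ i₃ p) (siteIdx i₁ i₂ p)).prod

lemma betheMat_isEvenMat (m n : ℕ) (c : ℂ) {a b : ℕ} (u : Fin a → σ) (v : Fin b → σ) :
    IsEvenMat (betheMat m n c u v) := by
  refine ((isEvenMat_list_prod fun M hM => ?_).mul (isEvenMat_list_prod fun M hM => ?_)).mul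
    (isEvenMat_list_prod fun M hM => ?_)
  · obtain ⟨p, _, rfl⟩ := List.mem_map.1 hM
    exact isEvenMat_gT ((isRTT_T (σ := σ) m n c).hom _) p
  · obtain ⟨p, _, rfl⟩ := List.mem_map.1 hM
    exact isEvenMat_gT ((isRTT_T (σ := σ) m n c).hom _) p
  · obtain ⟨q, _, rfl⟩ := List.mem_map.1 hM
    refine isEvenMat_list_prod fun M hM => ?_
    obtain ⟨p, _, rfl⟩ := List.mem_map.1 hM
    exact isEvenMat_gR _ _ _

lemma mem_sites {a b : ℕ} (p : Fin (a + b)) : p ∈ uSites a b ++ vSites a b := by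
  rw [List.mem_append, mem_uSites, mem_vSites]; exact lt_or_ge _ _

lemma unitMat_apply (i₁ i₂ i₃ : Fin (m + n)) {a b : ℕ} (I J : Fin (a + b) → Fin (m + n)) :
    unitMat i₁ i₂ i₃ σ a b I J = if I = siteIdx i₂ i₃ ∧ J = siteIdx i₁ i₂ then 1 else 0 := by
  rw [unitMat, gE_prod_apply]
  · refine if_congr ⟨fun h => ⟨funext fun p => (h.1 p (mem_sites p)).1,
      funext fun p => (h.1 p (mem_sites p)).2⟩, ?_⟩ rfl rfl
    rintro ⟨rfl, rfl⟩
    exact ⟨fun p _ => ⟨rfl, rfl⟩, fun p hp => absurd (mem_sites p) hp⟩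
  · rw [List.pairwise_append]
    exact ⟨uSites_pairwise a b, vSites_pairwise a b, fun k hk q hq => lt_of_mem_sites hk hq⟩

lemma toG_bethe (i₁ i₂ i₃ : Fin (m + n)) (c : ℂ) {a b : ℕ} (u : Fin a → σ) (v : Fin b → σ) :
    toG (sProd (List.ofFn (fun k => auxT c (Fin.castAdd b k) (u k)) ++
      List.ofFn (fun j => auxT c (Fin.natAdd a j) (v j)) ++
      (List.ofFn fun j => (List.ofFn fun k =>
        Rmat c (Fin.natAdd a j) (Fin.castAdd b k) (v j) (u k)).reverse).flatten ++
      List.ofFn (fun k => auxE (Fin.castAdd b k) i₂ i₁) ++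
      List.ofFn (fun j => auxE (Fin.natAdd a j) i₃ i₂))) =
      betheMat m n c u v * unitMat i₁ i₂ i₃ σ a b := by
  rw [toG_sProd, betheMat, unitMat, ttr, rAll, List.map_append (l₁ := uSites a b), List.prod_append,
    ← ofFn_siteT_u, ← ofFn_siteT_v, ← ofFn_siteR, ← ofFn_gE_u, ← ofFn_gE_v]
  simp only [List.map_append, List.prod_append, List.map_flatten, List.map_ofFn, List.map_reverse,
    Function.comp_def, List.prod_flatten, mul_assoc]

lemma sum_sites_pairs {i₁ i₂ i₃ : Fin (m + n)}
    (hpar : ((par i₁ : ZMod 2) + par i₂) * (par i₂ + par i₃) = 0) (a b : ℕ) :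
    ∑ p : Fin (a + b), ((par (siteIdx i₁ i₂ p) : ZMod 2) + par (siteIdx i₂ i₃ p)) *
      ∑ q ∈ Ioi p, ((par (siteIdx i₁ i₂ q) : ZMod 2) + par (siteIdx i₂ i₃ q)) =
      (par i₁ + par i₂) * (a.choose 2 : ℕ) + (par i₂ + par i₃) * (b.choose 2 : ℕ) := by
  have hlu : (uSites a b).length = a := by simp [uSites]
  have hlv : (vSites a b).length = b := by simp [vSites]
  rcases mul_eq_zero.1 hpar with h | h
  · rw [h, zero_mul, zero_add, sum_pairs
      (f := fun p => (par (siteIdx i₁ i₂ p) : ZMod 2) + par (siteIdx i₂ i₃ p))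
      (vSites_pairwise a b) (δ := par i₂ + par i₃), hlv]
    · intro p hp
      simp only [siteIdx_v _ _ hp]
    · intro p hp
      have := (List.mem_append.1 (mem_sites p)).resolve_right hp
      simp only [siteIdx_u _ _ this, h]
  · rw [h, zero_mul, add_zero, sum_pairs
      (f := fun p => (par (siteIdx i₁ i₂ p) : ZMod 2) + par (siteIdx i₂ i₃ p))
      (uSites_pairwise a b) (δ := par i₁ + par i₂), hlu]
    · intro p hp
      simp only [siteIdx_u _ _ hp]
    · intro p hp
      have := (List.mem_append.1 (mem_sites p)).resolve_left hp
      simp only [siteIdx_v _ _ this, h]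

/-- The super-trace formula in terms of one entry. -/
lemma strFormula_eq {i₁ i₂ i₃ : Fin (m + n)}
    (hpar : ((par i₁ : ZMod 2) + par i₂) * (par i₂ + par i₃) = 0) (c : ℂ) {a b : ℕ} (u : Fin a → σ)
    (v : Fin b → σ) :
    strFormula i₁ i₂ i₃ c u v = zs (KK σ) (a * par i₂ + b * par i₃ +
        ((par i₁ + par i₂) * (a.choose 2 : ℕ) + (par i₂ + par i₃) * (b.choose 2 : ℕ))) •
      betheMat m n c u v (siteIdx i₁ i₂) (siteIdx i₂ i₃) := by
  have h1 : strFormula i₁ i₂ i₃ c u v =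
      ∑ I, ((-1 : KK σ) ^ (∑ p, par (I p))) • (betheMat m n c u v * unitMat i₁ i₂ i₃ σ a b) I I := by
    rw [strFormula, str]
    refine sum_congr rfl fun I _ => ?_
    rw [← toG_bethe]
    exact sg_smul (R := KK σ) (V := YY m n σ) _ _
  rw [h1, supertrace_mul_unit (betheMat_isEvenMat m n c u v) (unitMat_apply i₁ i₂ i₃)]
  congr 2
  have hp := sum_sites_pairs hpar a b
  simp only [zp]
  rw [hp, sum_add_distrib, sum_sites, sum_sites]
  linear_combination ((a : ZMod 2) * par i₁ + b * par i₂) * two_eq_zero_zmod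

end Bridge
end SuperYangian
end

namespace SuperYangian

section LineExpansion

open Finset

variable {σ F N : Type*} [Field F] [AddCommGroup N] [Module F N]

lemma normWord_map (ν : σ → σ → F) (P : Module.End F N) (W : List (σ × Bool) → N) (v : List σ) :
    normWord ν (fun l => P (W l)) v = P (normWord ν W v) := (map_smul P _ _).symm

section Words

variable {D E : Set σ} {γ ν a : σ → σ → F} {ε : F} {P : Bool → σ → Module.End F N}
  {W : List (σ × Bool) → N} {χ : σ → F}

lemma isRow_lineWords (hw : IsWeights E γ ν a ε) (hD : D ⊆ E) (hW : IsRow D γ ν W)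
    {ys : List σ} (hys : ∀ x ∈ ys, x ∈ E ∧ x ∉ D) : IsRow D γ ν (lineWords γ ε P W ys) := by
  induction ys with
  | nil => exact hW
  | cons y ys ih =>
    simp only [List.mem_cons, forall_eq_or_imp] at hys
    exact isRow_lineWord hw hD hys.1.1 hys.1.2 fun b => (ih hys.2).map _

lemma IsVacuum.map (hW : IsVacuum D χ W) (Q : Module.End F N) : IsVacuum D χ fun l => Q (W l) :=
  fun z hz l => by
    change Q (W (l ++ [(z, false)])) = χ z • Q (W l)
    rw [hW z hz, map_smul]

lemma isVacuum_lineWords (hW : IsVacuum D χ W) (ys : List σ) :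
    IsVacuum D (fun z => χ z * (ys.map fun y => 1 + γ z y).prod) (lineWords γ ε P W ys) := by
  induction ys with
  | nil => simpa [lineWords] using hW
  | cons y ys ih =>
    have := isVacuum_lineWord (γ := γ) (ε := ε) (y := y) fun b => ih.map (P b y)
    refine fun z hz l => (this z hz l).trans ?_
    simp only [List.map_cons, List.prod_cons, mul_comm (1 + γ z y), ← mul_assoc]; rfl

end Words

variable [DecidableEq σ] {D E : Set σ} {γ ν a : σ → σ → F} {ε : F} {g h : σ → σ → F} {t : F}
  {ν₀ b q : σ → σ → F} {κ : Finset σ → Finset σ → F}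

lemma normWord_lineWords (H : IsExpansionData D E γ ν a ε g h t ν₀ b q κ)
    {P : Bool → σ → Module.End F N} (h01 : ∀ z ∈ E, ∀ w ∈ E, z ≠ w → P false z * P true w =
      (t * (1 - g z w)) • (P true w * P false z) + (t * g z w) • (P true z * P false w))
    (h11 : IsTwistedOp E h (P true)) (h00 : IsTwistedOp E ν₀ (P false)) {χ : σ → F}
    {W : List (σ × Bool) → N} (hW : IsRow D γ ν W) (hχ : IsVacuum D χ W)
    {ys : List σ} (hys : ∀ x ∈ ys, x ∈ E ∧ x ∉ D) (hn : ys.Nodup) (V : Finset σ)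
    (hV : ∀ x ∈ V, x ∈ D) :
    normWord ν (lineWords γ ε P W ys) V.toList =
      pairNorm ν₀ ys • ∑ I ∈ ys.toFinset.powerset, ∑ J ∈ V.powersetCard I.card,
        partCoef κ b a χ I (ys.toFinset \ I) J (V \ J) •
          normOp h (P true) I (normOp ν₀ (P false) (ys.toFinset \ I) (normWord ν W (V \ J).toList)) := by
  refine expansion H h01 h11 h00 (R := fun ys V => normWord ν (lineWords γ ε P W ys) V.toList)
    ?_ ys hys hn V hV
  intro y ys V hy hyD hys hn hV
  have hrow := isRow_lineWords (P := P) H.weights H.sub hW hys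
  have hvac := isVacuum_lineWords (γ := γ) (ε := ε) (P := P) hχ ys
  rw [lineWords, lineWord_cWord H.weights H.sub hy hyD (hrow.map (P true y)).toIsExchange
    (hvac.map (P true y)) (nodup_toList V) (by simpa using hV), normWord_map, sum_map_toList]
  congr 1
  refine sum_congr rfl fun j hj => ?_
  have hp : (V.toList.erase j).Perm (V.erase j).toList := by
    rw [List.perm_ext_iff_of_nodup ((nodup_toList V).erase j) (nodup_toList _)]
    simp [(nodup_toList V).mem_erase_iff]
  have hVj : ∀ x ∈ V.toList.erase j, x ∈ D := fun x hx =>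
    hV x (mem_toList.1 (List.mem_of_mem_erase hx))
  rw [normWord_map, normWord_perm (fun hx hy' => H.weights.norm_ne (H.sub hx) (H.sub hy')) hp
    ((nodup_toList V).erase j) hVj fun l l' => hrow.cc l l', (hp.map _).prod_eq, prod_map_toList,
    List.prod_toFinset _ (List.nodup_cons.1 hn).2]

end LineExpansion

section Operators

open Finset

variable {σ F A N : Type*} [Field F] [Ring A] [Algebra F A] [AddCommGroup N] [Module F N]
  [Module A N] [IsScalarTower F A N]

/-- The normalised ordered product. -/
def nProd (ν : σ → σ → F) (X : σ → A) (l : List σ) : A := (pairNorm ν l)⁻¹ • (l.map X).prod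

/-- The left action. -/
def actEnd (F : Type*) [Field F] (N : Type*) [AddCommGroup N] [Module F N] [Algebra F A]
    [Module A N] [IsScalarTower F A N] (X : A) : Module.End F N := Algebra.lsmul F F N X

lemma actEnd_prod (l : List A) (n : N) : (l.map (actEnd F N)).prod n = l.prod • n := by
  have : (l.map (actEnd F N)).prod = actEnd F N l.prod := (map_list_prod (Algebra.lsmul F F N) l).symm
  rw [this]; rfl

/-- `X(z)X(w)ν(z,w) = X(w)X(z)ν(w,z)`. -/
def IsTwistedAlg (ν : σ → σ → F) (X : σ → A) : Prop :=
  ∀ {z w}, z ≠ w → ν z w • (X z * X w) = ν w z • (X w * X z)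

lemma IsTwistedAlg.op {ν : σ → σ → F} {X : σ → A} (h : IsTwistedAlg ν X)
    (hν : ∀ z w, ν z w ≠ 0) (E : Set σ) : IsTwistedOp E ν fun z => actEnd F N (X z) :=
  fun z _ w _ hzw => ⟨hν z w, by
    have := congrArg (actEnd F N) (h hzw)
    simpa only [actEnd, map_smul, map_mul] using this⟩

lemma IsTwistedAlg.nProd_perm {ν : σ → σ → F} {X : σ → A} (h : IsTwistedAlg ν X)
    (hν : ∀ z w, ν z w ≠ 0) {l l' : List σ} (hp : l.Perm l') (hn : l.Nodup) :
    nProd ν X l = nProd ν X l' := by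
  have := normWord_perm (D := Set.univ) (N := A) (W := fun l => (l.map fun p => X p.1).prod)
    (fun _ _ _ => hν _ _) hp hn (fun _ _ => trivial) (fun l l' _ _ hzw => by
      simp only [List.map_append, List.map_cons, List.prod_append, List.prod_cons]
      exact smul_mul_mid (h hzw) _ _)
  simpa [normWord, cWord, List.map_map, Function.comp_def, nProd] using this

lemma normOp_actEnd [DecidableEq σ] (ν : σ → σ → F) (X : σ → A) (S : Finset σ) (n : N) :
    normOp ν (fun z => actEnd F N (X z)) S n = nProd ν X S.toList • n := by
  rw [normOp, LinearMap.smul_apply, nProd, smul_assoc, ← actEnd_prod (F := F), List.map_map]; rfl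

/-- The relations of the letters. -/
structure IsLetters (γ ν : σ → σ → F) (A₀ C : σ → A) : Prop where
  ac : ∀ {z w}, z ≠ w → A₀ z * C w = (1 - γ z w) • (C w * A₀ z) + γ z w • (C z * A₀ w)
  cc : IsTwistedAlg ν C
  aa : ∀ {z w}, z ≠ w → A₀ z * A₀ w = A₀ w * A₀ z

/-- The value of a word on a vector. -/
def wordAct (A₀ C : σ → A) (n : N) (l : List (σ × Bool)) : N :=
  (l.map fun x => if x.2 then C x.1 else A₀ x.1).prod • n

omit [Module F N] [IsScalarTower F A N] in
lemma wordAct_append (A₀ C : σ → A) (n : N) (l l' : List (σ × Bool)) :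
    wordAct A₀ C n (l ++ l') = (l.map fun x => if x.2 then C x.1 else A₀ x.1).prod •
      wordAct A₀ C n l' := by
  rw [wordAct, List.map_append, List.prod_append, mul_smul]; rfl

omit [Module F N] [IsScalarTower F A N] in
lemma wordAct_cons₂ (A₀ C : σ → A) (n : N) (x y : σ × Bool) (l : List (σ × Bool)) :
    wordAct A₀ C n (x :: y :: l) = ((if x.2 then C x.1 else A₀ x.1) *
      if y.2 then C y.1 else A₀ y.1) • wordAct A₀ C n l := by
  rw [wordAct, List.map_cons, List.map_cons, List.prod_cons, List.prod_cons, ← mul_assoc, mul_smul]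
  rfl

lemma smul_algebra_smul (r : F) (X : A) (m : N) : X • r • m = r • X • m := by
  rw [← algebraMap_smul A r m, ← algebraMap_smul A r (X • m), ← mul_smul, ← mul_smul,
    Algebra.commutes]

lemma IsLetters.isRow {γ ν : σ → σ → F} {A₀ C : σ → A} (h : IsLetters γ ν A₀ C) (n : N)
    (D : Set σ) : IsRow D γ ν (wordAct A₀ C n) := by
  refine ⟨⟨fun {z w} l l' _ _ hzw => ?_, fun {z w} l l' _ _ hzw => ?_⟩, fun {z w} l l' _ _ hzw => ?_⟩
  · simp only [wordAct_append, wordAct_cons₂, if_true, Bool.false_eq_true, if_false, one_mul]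
    rw [h.ac hzw, add_smul, smul_add, smul_assoc, smul_assoc, smul_algebra_smul,
      smul_algebra_smul]
  · simp only [wordAct_append, wordAct_cons₂, if_true]
    rw [← smul_algebra_smul (ν z w), ← smul_algebra_smul (ν w z), ← smul_assoc (ν z w) (C z * C w), ← smul_assoc (ν w z) (C w * C z), h.cc hzw]
  · simp only [wordAct_append, wordAct_cons₂, Bool.false_eq_true, if_false]
    rw [h.aa hzw]

lemma isVacuum_wordAct {A₀ : σ → A} (C : σ → A) {n : N} {χ : σ → F} (h : ∀ z, A₀ z • n = χ z • n)
    (D : Set σ) : IsVacuum D χ (wordAct A₀ C n) := by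
  intro z _ l
  rw [wordAct_append]
  have e : wordAct A₀ C n [(z, false)] = χ z • n := by simp [wordAct, h]
  rw [e, wordAct, smul_algebra_smul]

variable [DecidableEq σ] {D E : Set σ} {γ ν a : σ → σ → F} {ε : F} {g h : σ → σ → F} {t : F}
  {ν₀ b q : σ → σ → F} {κ : Finset σ → Finset σ → F}

/-- The expansion over partitions, in a module over the algebra. -/
theorem lineWords_cWord_expansion (hE : ∀ x, x ∈ E) (H : IsExpansionData D E γ ν a ε g h t ν₀ b q κ) {A₀ C X₀ X₁ : σ → A}
    (hl : IsLetters γ ν A₀ C) (hν : ∀ z w, ν z w ≠ 0) (hν₀ : ∀ z w, ν₀ z w ≠ 0) (hh : ∀ z w, h z w ≠ 0)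
    (h01 : ∀ {z w}, z ≠ w →
      X₀ z * X₁ w = (t * (1 - g z w)) • (X₁ w * X₀ z) + (t * g z w) • (X₁ z * X₀ w))
    (h11 : IsTwistedAlg h X₁) (h00 : IsTwistedAlg ν₀ X₀) {n : N} {χ : σ → F}
    (hχ : ∀ z, A₀ z • n = χ z • n) {ys vs : List σ} (hys : ∀ x ∈ ys, x ∉ D) (hn : ys.Nodup)
    (hvs : ∀ x ∈ vs, x ∈ D) (hvn : vs.Nodup) :
    lineWords γ ε (fun b z => actEnd F N (if b then X₁ z else X₀ z)) (wordAct A₀ C n) ys (cWord vs) =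
      (pairNorm ν vs * pairNorm ν₀ ys) • ∑ I ∈ ys.toFinset.powerset,
        ∑ J ∈ vs.toFinset.powersetCard I.card,
          partCoef κ b a χ I (ys.toFinset \ I) J (vs.toFinset \ J) •
            (nProd h X₁ I.toList * nProd ν₀ X₀ (ys.toFinset \ I).toList *
              nProd ν C (vs.toFinset \ J).toList) • n := by
  have key := normWord_lineWords (N := N) H (P := fun b z => actEnd F N (if b then X₁ z else X₀ z))
    (fun z _ w _ hzw => by
      have := congrArg (actEnd F N) (h01 hzw)
      simpa only [actEnd, map_smul, map_mul, map_add, if_true, Bool.false_eq_true, if_false] using this)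
    (by simpa using h11.op (N := N) hh E) (by simpa using h00.op (N := N) hν₀ E) (hl.isRow n D)
    (isVacuum_wordAct C hχ D) (fun x hx => ⟨hE x, hys x hx⟩) hn vs.toFinset (by simpa using hvs)
  have hrow := isRow_lineWords (P := fun b z => actEnd F N (if b then X₁ z else X₀ z)) H.weights H.sub
    (hl.isRow n D) (fun x hx => ⟨hE x, hys x hx⟩)
  have hperm : vs.toFinset.toList.Perm vs := by
    rw [List.perm_ext_iff_of_nodup (nodup_toList _) hvn]; simp
  rw [normWord_perm (fun _ _ _ => hν _ _) hperm (nodup_toList _) (by simpa using hvs)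
    fun l l' => hrow.cc l l'] at key
  have hp : pairNorm ν vs ≠ 0 := by
    clear key hvn hvs hperm
    induction vs with
    | nil => exact one_ne_zero
    | cons x vs ih =>
      refine mul_ne_zero (List.prod_ne_zero fun h0 => ?_) ih
      obtain ⟨y, _, hy⟩ := List.mem_map.1 h0
      exact hν _ _ hy
  rw [normWord, inv_smul_eq_iff₀ hp] at key
  rw [key, smul_smul]
  congr 1
  refine sum_congr rfl fun I _ => sum_congr rfl fun J _ => ?_
  congr 1
  have e1 : normWord ν (wordAct A₀ C n) (vs.toFinset \ J).toList =
      nProd ν C (vs.toFinset \ J).toList • n := by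
    rw [normWord, nProd, smul_assoc, wordAct, cWord, List.map_map]; rfl
  simp only [if_true, Bool.false_eq_true, if_false]
  rw [e1, normOp_actEnd, normOp_actEnd, mul_smul, mul_smul]

end Operators
end SuperYangian

namespace SuperYangian

section Cases

open Finset

variable {F A Q σ : Type*} [Field F] [Ring A] [Algebra F A] {par : Q → ℕ} {τ : A →ₐ[F] A}
  {g h : σ → σ → F} {T : σ → Q → Q → A} {s : σ → F} {c : F}

lemma mul_self_zmod (k : ZMod 2) : k * k = k := by revert k; decide

lemma zs_one : zs F 1 = -1 := by simp [zs, ZMod.val_one]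

lemma one_sub_zs_mul_ne (hs : IsRational s c g h) (k : ZMod 2) {z w : σ} (hzw : z ≠ w) :
    1 - zs F k * g z w ≠ 0 := by
  fin_cases k
  · change 1 - zs F 0 * g z w ≠ 0
    rw [zs_zero, one_mul, sub_eq_add_neg, ← hs.anti, ← hs.g_mul_h hzw.symm]
    exact mul_ne_zero (hs.g_ne hzw.symm) (hs.h_ne _ _)
  · change 1 - zs F 1 * g z w ≠ 0
    rw [zs_one, neg_one_mul, sub_neg_eq_add, ← hs.g_mul_h hzw]
    exact mul_ne_zero (hs.g_ne hzw) (hs.h_ne _ _)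

lemma IsRTT.self_comm (H : IsRTT par τ g T) (hs : IsRational s c g h) {i j : Q}
    (hij : (par i : ZMod 2) = par j) {z w : σ} (hzw : z ≠ w) :
    T z i j * T w i j = T w i j * T z i j := by
  have k := H.comm_zs i j i j hzw
  rw [hij, CharTwo.add_self_eq_zero, mul_zero, mul_zero, zs_zero, one_smul, zero_add,
    ← sub_eq_zero] at k
  have k : (1 - zs F ((par j : ZMod 2) * par j) * g z w) • (T z i j * T w i j - T w i j * T z i j) = 0 := by
    rw [← k]; module
  exact sub_eq_zero.1 ((smul_eq_zero_iff_right (one_sub_zs_mul_ne hs _ hzw)).1 k)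

lemma IsRTT.self_twisted (H : IsRTT par τ g T) (hs : IsRational s c g h) {i j : Q}
    (hi : (par i : ZMod 2) = 0) (hj : (par j : ZMod 2) = 1) : IsTwistedAlg h fun z => T z i j := by
  intro z w hzw
  have k := H.comm_zs i j i j hzw
  have e1 := hs.g_mul_h hzw
  have e2 := hs.g_mul_h hzw.symm
  rw [hi, hj] at k
  simp only [zero_add, mul_one, add_zero, zs_one] at k
  rw [hs.anti w z] at e2
  have : g z w • (h z w • (T z i j * T w i j) - h w z • (T w i j * T z i j)) = 0 := by
    rw [smul_sub, smul_smul, smul_smul, e1, show g z w * h w z = -(1 - g z w) by linear_combination -e2]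
    generalize T z i j * T w i j = X at *
    generalize T w i j * T z i j = Y at *
    rw [← sub_eq_zero] at k
    rw [← k]; module
  exact sub_eq_zero.1 ((smul_eq_zero_iff_right (hs.g_ne hzw)).1 this)

variable {q₁ q₂ q₃ : Q}

lemma IsRTT.letters (H : IsRTT par τ g T) (hs : IsRational s c g h) {ν : σ → σ → F}
    (hν : IsTwistedAlg ν fun z => T z q₂ q₃) :
    IsLetters (fun w z => zs F (par q₂) * g w z) ν (fun z => T z q₂ q₂) fun z => T z q₂ q₃ where
  ac {z w} hzw := by
    have k := H.comm_zs q₂ q₂ q₂ q₃ hzw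
    rw [CharTwo.add_self_eq_zero, zero_mul, mul_zero, zs_zero, one_smul, zero_add, mul_self_zmod,
      sub_eq_iff_eq_add] at k
    rw [k]; module
  cc := hν
  aa hzw := H.self_comm hs rfl hzw

lemma IsRTT.letters' (H : IsRTT par τ g T) (hs : IsRational s c g h) {ν : σ → σ → F}
    (h1 : (par q₁ : ZMod 2) = 0) (hν : IsTwistedAlg ν fun z => T z q₁ q₂) :
    IsLetters (fun w z => zs F (par q₂) * g z w) ν (fun z => T z q₂ q₂) fun z => T z q₁ q₂ where
  ac {z w} hzw := by
    have k := H.comm_zs q₁ q₂ q₂ q₂ hzw.symm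
    rw [CharTwo.add_self_eq_zero, mul_zero, zs_zero, one_smul, h1, zero_add, zero_mul, add_zero,
      mul_self_zmod, ← sub_eq_zero] at k
    rw [← sub_eq_zero, ← neg_eq_zero, ← k]; module
  cc := hν
  aa hzw := H.self_comm hs rfl hzw

lemma IsRTT.cross (H : IsRTT par τ g T) (h1 : (par q₁ : ZMod 2) = 0) (h3 : (par q₃ : ZMod 2) = 1)
    {z w : σ} (hzw : z ≠ w) : T z q₁ q₂ * T w q₁ q₃ =
      (zs F (par q₂) * (1 - g z w)) • (T w q₁ q₃ * T z q₁ q₂) +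
        (zs F (par q₂) * g z w) • (T z q₁ q₃ * T w q₁ q₂) := by
  have k := H.comm_zs q₁ q₂ q₁ q₃ hzw
  rw [h1, h3] at k
  simp only [zero_add, mul_one, zero_mul, add_zero, one_mul] at k
  rw [sub_eq_iff_eq_add] at k
  rw [k]; module

lemma IsRTT.cross' (H : IsRTT par τ g T) (h1 : (par q₁ : ZMod 2) = 0) (h3 : (par q₃ : ZMod 2) = 1)
    {z w : σ} (hzw : z ≠ w) : T z q₂ q₃ * T w q₁ q₃ =
      (zs F (par q₂ + 1) * (1 - g z w)) • (T w q₁ q₃ * T z q₂ q₃) +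
        (zs F (par q₂ + 1) * g z w) • (T z q₁ q₃ * T w q₂ q₃) := by
  have k := H.comm_zs q₁ q₃ q₂ q₃ hzw.symm
  have e := zs_mul_self (F := F) (par q₂ + 1)
  rw [h1, h3, H.anti] at k
  simp only [zero_add, mul_one, add_zero, one_mul, zs_one] at k
  have k' := congrArg (fun X => zs F (par q₂ + 1) • X) k
  simp only [smul_sub, smul_smul, e, one_smul] at k'
  rw [← sub_eq_zero] at k' ⊢
  rw [← neg_eq_zero, ← k']; module

variable {N : Type*} [AddCommGroup N] [Module F N] [Module A N] [IsScalarTower F A N]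
  {S : ℕ} {y : Fin S → σ} [Fintype Q] [DecidableEq Q] [hτ : Fact (τ * τ = 1)] [DecidableEq σ]
  {D : Set σ} {ν a : σ → σ → F} {t : F} {ν₀ b q : σ → σ → F} {κ : Finset σ → Finset σ → F}

lemma cnt_true {ι : Type*} (l : List ι) : cnt (fun _ => true) l = l.length := by
  simp [cnt]

theorem IsRTT.ttr_expansion (H : IsRTT par τ g T) (hs : IsRational s c g h)
    (h1 : (par q₁ : ZMod 2) = 0) (h3 : (par q₃ : ZMod 2) = 1)
    (HE : IsExpansionData D Set.univ (fun w z => zs F (par q₂) * g w z) ν a (zs F (par q₂ + par q₃))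
      g h (zs F (par q₂)) ν₀ b q κ)
    (hν : ∀ z w, ν z w ≠ 0) (hν₀ : ∀ z w, ν₀ z w ≠ 0) (h23 : IsTwistedAlg ν fun z => T z q₂ q₃)
    (h12 : IsTwistedAlg ν₀ fun z => T z q₁ q₂) {n : N} {χ : σ → F}
    (hχ : ∀ z, T z q₂ q₂ • n = χ z • n) (hy : Function.Injective y)
    {us vs : List (Fin S)} (hu : us.Pairwise (· < ·)) (hv : vs.Pairwise (· < ·))
    (huv : ∀ k ∈ us, ∀ q ∈ vs, k < q) {I L : Fin S → Q}
    (hIu : ∀ k ∈ us, I k = q₁) (hLu : ∀ k ∈ us, L k = q₂) (hIv : ∀ q ∈ vs, I q = q₂)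
    (hLv : ∀ q ∈ vs, L q = q₃) (hIL : ∀ p, p ∉ us → p ∉ vs → I p = L p)
    (hD : ∀ q ∈ vs, y q ∈ D) (hD' : ∀ k ∈ us, y k ∉ D) :
    ttr (siteT par τ T y) (siteR par τ g y) us vs I L • n =
      (zs F ((par q₁ + par q₂) * (us.length.choose 2 : ℕ) +
          (par q₂ + par q₃) * (vs.length.choose 2 : ℕ)) *
        (pairNorm ν (vs.map y) * pairNorm ν₀ (us.map y))) •
        ∑ I ∈ (us.map y).toFinset.powerset, ∑ J ∈ (vs.map y).toFinset.powersetCard I.card,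
          partCoef κ b a χ I ((us.map y).toFinset \ I) J ((vs.map y).toFinset \ J) •
            (nProd h (fun z => T z q₁ q₃) I.toList *
              nProd ν₀ (fun z => T z q₁ q₂) ((us.map y).toFinset \ I).toList *
              nProd ν (fun z => T z q₂ q₃) ((vs.map y).toFinset \ J).toList) • n := by
  have e := ttr_apply (F := F) (g := g) (y := y) (s := fun _ => true) (q₁ := q₁) (q₂ := q₂)
    (q₃ := q₃) H.hom (by rw [h1, h3, zero_add, mul_add, mul_one, mul_self_zmod, CharTwo.add_self_eq_zero])
    (P := fun b z => actEnd F N (if b then T z q₁ q₃ else T z q₁ q₂))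
    (π := (LinearMap.toSpanSingleton A N n).restrictScalars F)
    (fun b z X => by cases b <;> exact mul_smul _ _ _) hu hv huv hIu hLu hIv (by simpa using hLv) hIL
  rw [cnt_true] at e
  refine e.trans ?_
  rw [← smul_smul, ← lineWords_cWord_expansion (fun _ => trivial) HE (H.letters hs h23) hν hν₀
    (fun _ _ => hs.h_ne _ _) (fun hzw => H.cross h1 h3 hzw) (H.self_twisted hs h1 h3) h12 hχ
    (by simpa using hD') (List.Nodup.map hy (hu.imp fun h => h.ne)) (by simpa using hD)
    (List.Nodup.map hy (hv.imp fun h => h.ne))]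
  have e2 : (fun l : List (σ × Bool) => (LinearMap.toSpanSingleton A N n).restrictScalars F
      (l.map fun x => T x.1 q₂ (if x.2 then q₃ else q₂)).prod) =
      wordAct (fun z => T z q₂ q₂) (fun z => T z q₂ q₃) n := by
    funext l
    rw [wordAct]
    refine congrArg (fun l : List A => l.prod • n) (List.map_congr_left fun x _ => ?_)
    split_ifs <;> rfl
  rw [e2, stWord, cWord, List.map_map]
  rfl

theorem IsRTT.rtt_expansion (H : IsRTT par τ g T) (hs : IsRational s c g h)
    (h1 : (par q₁ : ZMod 2) = 0) (h3 : (par q₃ : ZMod 2) = 1)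
    (HE : IsExpansionData D Set.univ (fun w z => zs F (par q₂) * g z w) ν a (zs F (par q₁ + par q₂))
      g h (zs F (par q₂ + 1)) ν₀ b q κ)
    (hν : ∀ z w, ν z w ≠ 0) (hν₀ : ∀ z w, ν₀ z w ≠ 0) (h12 : IsTwistedAlg ν fun z => T z q₁ q₂)
    (h23 : IsTwistedAlg ν₀ fun z => T z q₂ q₃) {n : N} {χ : σ → F}
    (hχ : ∀ z, T z q₂ q₂ • n = χ z • n) (hy : Function.Injective y)
    {us vs : List (Fin S)} (hu : us.Pairwise (· < ·)) (hv : vs.Pairwise (· < ·))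
    (huv : ∀ k ∈ us, ∀ q ∈ vs, k < q) {I L : Fin S → Q}
    (hIu : ∀ k ∈ us, I k = q₁) (hLu : ∀ k ∈ us, L k = q₂) (hIv : ∀ q ∈ vs, I q = q₂)
    (hLv : ∀ q ∈ vs, L q = q₃) (hIL : ∀ p, p ∉ us → p ∉ vs → I p = L p)
    (hD : ∀ k ∈ us, y k ∈ D) (hD' : ∀ q ∈ vs, y q ∉ D) :
    ttr (siteT par τ T y) (siteR par τ g y) us vs I L • n =
      (zs F ((par q₁ + par q₂) * (us.length.choose 2 : ℕ) +
          (par q₂ + par q₃) * (vs.length.choose 2 : ℕ)) *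
        (pairNorm ν (us.map y) * pairNorm ν₀ (vs.map y))) •
        ∑ I ∈ (vs.map y).toFinset.powerset, ∑ J ∈ (us.map y).toFinset.powersetCard I.card,
          partCoef κ b a χ I ((vs.map y).toFinset \ I) J ((us.map y).toFinset \ J) •
            (nProd h (fun z => T z q₁ q₃) I.toList *
              nProd ν₀ (fun z => T z q₂ q₃) ((vs.map y).toFinset \ I).toList *
              nProd ν (fun z => T z q₁ q₂) ((us.map y).toFinset \ J).toList) • n := by
  have e0 : ttr (siteT par τ T y) (siteR par τ g y) us vs =
      (SuperYangian.rtt (siteT par τ T y) (siteR par τ g y) us vs : GMat par τ S) := by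
    refine prod_mul_rAll (hu.imp fun h => h.ne) (hv.imp fun h => h.ne)
      (fun k hk hk' => lt_irrefl _ (huv k hk k hk')) (fun k hk q hq => ?_) fun p _ k hk q hq h h' => ?_
    · exact H.rtt (huv k hk q hq) (hy.ne (huv k hk q hq).ne)
    · exact gT_comm_gR (H.hom _) _ (huv k hk q hq) h h'
  have e := rtt_apply (F := F) (g := g) (y := y) (s := fun _ => true) (q₁ := q₁) (q₂ := q₂)
    (q₃ := q₃) H.hom (by rw [h1, h3, zero_add, mul_add, mul_one, mul_self_zmod, CharTwo.add_self_eq_zero])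
    (P := fun b z => actEnd F N (if b then T z q₁ q₃ else T z q₂ q₃))
    (π := (LinearMap.toSpanSingleton A N n).restrictScalars F)
    (fun b z X => by cases b <;> exact mul_smul _ _ _) hu hv (fun q hq k hk => huv k hk q hq) hIv hLv
    hLu (by simpa using hIu) hIL
  rw [cnt_true, ← e0, add_comm ((_ : ZMod 2) * _)] at e
  refine e.trans ?_
  rw [← smul_smul, ← lineWords_cWord_expansion (fun _ => trivial) HE (H.letters' hs h1 h12) hν hν₀
    (fun _ _ => hs.h_ne _ _) (fun hzw => H.cross' h1 h3 hzw) (H.self_twisted hs h1 h3) h23 hχ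
    (by simpa using hD') (List.Nodup.map hy (hv.imp fun h => h.ne)) (by simpa using hD)
    (List.Nodup.map hy (hu.imp fun h => h.ne))]
  have e2 : (fun l : List (σ × Bool) => (LinearMap.toSpanSingleton A N n).restrictScalars F
      (l.map fun x => T x.1 (if x.2 then q₁ else q₂) q₂).prod) =
      wordAct (fun z => T z q₂ q₂) (fun z => T z q₁ q₂) n := by
    funext l
    rw [wordAct]
    refine congrArg (fun l : List A => l.prod • n) (List.map_congr_left fun x _ => ?_)
    split_ifs <;> rfl
  rw [e2, stWord, cWord, List.map_map]
  rfl

end Cases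
end SuperYangian

noncomputable section
namespace SuperYangian
open scoped BigOperators

section Sites

open Finset

variable {σ : Type*}

lemma map_uSites {a b : ℕ} (u : Fin a → σ) (v : Fin b → σ) :
    (uSites a b).map (Fin.append u v) = List.ofFn u := by
  rw [uSites, List.map_map, List.ofFn_eq_map]
  exact List.map_congr_left fun k _ => Fin.append_left u v k

lemma map_vSites {a b : ℕ} (u : Fin a → σ) (v : Fin b → σ) :
    (vSites a b).map (Fin.append u v) = List.ofFn v := by
  rw [vSites, List.map_map, List.ofFn_eq_map]
  exact List.map_congr_left fun k _ => Fin.append_right u v k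

lemma toFinset_ofFn [DecidableEq σ] {a : ℕ} (u : Fin a → σ) : (List.ofFn u).toFinset = univ.image u := by
  ext x; simp [List.mem_ofFn]

lemma append_injective {a b : ℕ} {u : Fin a → σ} {v : Fin b → σ}
    (huv : Function.Injective (Sum.elim u v)) : Function.Injective (Fin.append u v) := by
  have : Fin.append u v = Sum.elim u v ∘ finSumFinEquiv.symm := by
    funext p
    refine Fin.addCases (fun k => ?_) (fun k => ?_) p <;> simp
  rw [this]
  exact huv.comp finSumFinEquiv.symm.injective

end Sites

section Kets

open Finset

variable {σ : Type*} [LinearOrder σ] [Finite σ] {m n : ℕ} {M : Type*} [AddCommGroup M]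
  [Module (Yang m n) M] {Ω : M}

lemma ket_coeff (Ω : M) (X : YY m n σ) (a : Expo σ) : (ket Ω X).coeff a = X.coeff a • Ω := rfl

/-- The left ideal of the series which annihilate `Ω`. -/
def ketIdeal (σ : Type*) [LinearOrder σ] [Finite σ] (Ω : M) : Submodule (YY m n σ) (YY m n σ) where
  carrier := {X | ket Ω X = 0}
  zero_mem' := by ext a; simp [ket_coeff]
  add_mem' {X Y} hX hY := by
    ext a
    have h1 := congrArg (fun X => X.coeff a) hX
    have h2 := congrArg (fun X => X.coeff a) hY
    simp only [ket_coeff, HahnSeries.coeff_zero] at h1 h2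
    rw [ket_coeff, HahnSeries.coeff_add, add_smul, h1, h2]; simp
  smul_mem' Y X hX := by
    ext a
    rw [ket_coeff, smul_eq_mul, HahnSeries.coeff_mul, sum_smul]
    refine sum_eq_zero fun p _ => ?_
    have h1 := congrArg (fun X => X.coeff p.2) hX
    simp only [ket_coeff, HahnSeries.coeff_zero] at h1
    rw [mul_smul, h1, smul_zero]

/-- The cyclic module generated by `Ω`, over series. -/
abbrev KetModule (σ : Type*) [LinearOrder σ] [Finite σ] (Ω : M) : Type _ :=
  YY m n σ ⧸ ketIdeal (m := m) (n := n) σ Ω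

/-- The generator of the cyclic module. -/
def vac (m n : ℕ) (σ : Type*) [LinearOrder σ] [Finite σ] {M : Type*} [AddCommGroup M]
    [Module (Yang m n) M] (Ω : M) : KetModule (m := m) (n := n) σ Ω := Submodule.Quotient.mk 1

lemma smul_vac (X : YY m n σ) : X • vac m n σ Ω = Submodule.Quotient.mk X := by
  rw [vac, ← Submodule.Quotient.mk_smul, smul_eq_mul, mul_one]

lemma sub_mem_of_smul_vac {X Y : YY m n σ} (hXY : X • vac m n σ Ω = Y • vac m n σ Ω) :
    ket Ω (X - Y) = 0 := by
  rw [smul_vac, smul_vac, Submodule.Quotient.eq] at hXY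
  exact hXY

lemma T_smul_vac {lam : Fin (m + n) → ℕ → ℂ} (hΩ : IsSingular m n Ω lam) (c : ℂ) (i : Fin (m + n))
    (u : σ) : T c i i u • vac m n σ Ω = series c (lam i) u • vac m n σ Ω := by
  have e : series c (lam i) u • vac m n σ Ω =
      (series c (lam i) u • (1 : YY m n σ)) • vac m n σ Ω := by rw [smul_assoc, one_smul]
  rw [e, smul_vac, smul_vac, Submodule.Quotient.eq]
  change ket Ω _ = 0
  ext a
  have e2 : (series c (lam i) u • (1 : YY m n σ)).coeff a =
      algebraMap ℂ (Yang m n) ((series c (lam i) u).coeff a) := by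
    rw [← Algebra.algebraMap_eq_smul_one]; rfl
  rw [ket_coeff, HahnSeries.coeff_sub, e2, sub_smul, HahnSeries.coeff_zero, sub_eq_zero]
  by_cases ha : ∃ r : ℕ, a = r • ee u
  · obtain ⟨r, rfl⟩ := ha
    rw [T, series, substInv_coeff, substInv_coeff, PowerSeries.coeff_mk, PowerSeries.coeff_mk,
      map_mul, mul_smul, ← hΩ.diag, ← mul_smul, ← Algebra.smul_def]
  · push Not at ha
    rw [T, series, substInv_coeff_of_ne u _ ha, substInv_coeff_of_ne u _ ha, map_zero]

lemma pairNorm_h (c : ℂ) (l : List σ) : pairNorm (h c) l = HH c l := by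
  induction l with
  | nil => rfl
  | cons x l ih =>
    rw [pairNorm, HH, ih, prod2]
    simp

lemma pairNorm_one {F σ : Type*} [Field F] (l : List σ) : pairNorm (fun _ _ => (1 : F)) l = 1 := by
  induction l with
  | nil => rfl
  | cons x l ih => rw [pairNorm, ih]; simp

variable {lam : Fin (m + n) → ℕ → ℂ} {c : ℂ} {a b : ℕ} {u : Fin a → σ} {v : Fin b → σ}
  {q₁ q₂ q₃ : Fin (m + n)} {ν α ν₀ β q : σ → σ → KK σ} {κ : Finset σ → Finset σ → KK σ}

/-- The expansion over partitions, before it is applied to a vector. -/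
def expSum (ν α ν₀ β : σ → σ → KK σ) (κ : Finset σ → Finset σ → KK σ) (χ : σ → KK σ)
    (η : σ → σ → KK σ) (X₁ X₀ C : σ → YY m n σ) (U V : Finset σ) : YY m n σ :=
  ∑ I ∈ U.powerset, ∑ J ∈ V.powersetCard I.card, partCoef κ β α χ I (U \ I) J (V \ J) •
    (nProd η X₁ I.toList * nProd ν₀ X₀ (U \ I).toList * nProd ν C (V \ J).toList)

lemma expSum_smul {N : Type*} [AddCommGroup N] [Module (KK σ) N] [Module (YY m n σ) N]
    [IsScalarTower (KK σ) (YY m n σ) N] (χ : σ → KK σ) (η : σ → σ → KK σ) (X₁ X₀ C : σ → YY m n σ)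
    (U V : Finset σ) (x : N) : expSum ν α ν₀ β κ χ η X₁ X₀ C U V • x =
      ∑ I ∈ U.powerset, ∑ J ∈ V.powersetCard I.card, partCoef κ β α χ I (U \ I) J (V \ J) •
        (nProd η X₁ I.toList * nProd ν₀ X₀ (U \ I).toList * nProd ν C (V \ J).toList) • x := by
  rw [expSum, sum_smul]
  refine sum_congr rfl fun I _ => ?_
  rw [sum_smul]
  exact sum_congr rfl fun J _ => smul_assoc _ _ _

lemma strFormula_ttr (hc : c ≠ 0) (huv : Function.Injective (Sum.elim u v))
    (hΩ : IsSingular m n Ω lam) (h1 : (par q₁ : ZMod 2) = 0) (h3 : (par q₃ : ZMod 2) = 1)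
    (HE : IsExpansionData (Set.range v) Set.univ (fun w z => zs (KK σ) (par q₂) * g c w z) ν α
      (zs (KK σ) (par q₂ + par q₃)) (g c) (h c) (zs (KK σ) (par q₂)) ν₀ β q κ)
    (hν : ∀ z w, ν z w ≠ 0) (hν₀ : ∀ z w, ν₀ z w ≠ 0)
    (h23 : IsTwistedAlg ν fun z => T (m := m) (n := n) c q₂ q₃ z)
    (h12 : IsTwistedAlg ν₀ fun z => T (m := m) (n := n) c q₁ q₂ z) :
    strFormula q₁ q₂ q₃ c u v • vac m n σ Ω = (zs (KK σ) (a * par q₂ + b) *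
      (pairNorm ν (List.ofFn v) * pairNorm ν₀ (List.ofFn u))) •
        expSum ν α ν₀ β κ (series c (lam q₂)) (h c) (T c q₁ q₃) (T c q₁ q₂) (T c q₂ q₃)
          (univ.image u) (univ.image v) • vac m n σ Ω := by
  have hpar : ((par q₁ : ZMod 2) + par q₂) * (par q₂ + par q₃) = 0 := by
    rw [h1, h3, zero_add, mul_add, mul_one, mul_self_zmod, CharTwo.add_self_eq_zero]
  have hu : (uSites a b).map (Fin.append u v) = List.ofFn u := map_uSites u v
  have hv : (vSites a b).map (Fin.append u v) = List.ofFn v := map_vSites u v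
  have e := (isRTT_T (σ := σ) m n c).ttr_expansion (isRational_spec hc) h1 h3 HE hν hν₀ h23 h12
    (T_smul_vac hΩ c q₂) (append_injective huv) (uSites_pairwise a b) (vSites_pairwise a b)
    (fun k hk q hq => lt_of_mem_sites hk hq) (I := siteIdx q₁ q₂) (L := siteIdx q₂ q₃)
    (fun k hk => siteIdx_u _ _ hk) (fun k hk => siteIdx_u _ _ hk) (fun k hk => siteIdx_v _ _ hk)
    (fun k hk => siteIdx_v _ _ hk)
    (fun p hp hp' => by rcases List.mem_append.1 (mem_sites p) with h | h <;> contradiction)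
    (fun p hp => by
      have := List.mem_map_of_mem (f := Fin.append u v) hp
      rw [hv, List.mem_ofFn] at this
      exact this)
    (fun p hp => by
      have := List.mem_map_of_mem (f := Fin.append u v) hp
      rw [hu, List.mem_ofFn] at this
      rintro ⟨j, hj⟩
      obtain ⟨i, hi⟩ := this
      exact absurd (@huv (Sum.inl i) (Sum.inr j) (hi.trans hj.symm)) (by simp))
  rw [hu, hv, toFinset_ofFn, toFinset_ofFn] at e
  rw [strFormula_eq hpar, smul_assoc, betheMat, e, expSum_smul, smul_smul]
  congr 1
  have l1 : (uSites a b).length = a := by simp [uSites]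
  have l2 : (vSites a b).length = b := by simp [vSites]
  rw [l1, l2, ← mul_assoc, ← zs_add, h3, mul_one, add_assoc, CharTwo.add_self_eq_zero, add_zero]

lemma strFormula_rtt (hc : c ≠ 0) (huv : Function.Injective (Sum.elim u v))
    (hΩ : IsSingular m n Ω lam) (h1 : (par q₁ : ZMod 2) = 0) (h3 : (par q₃ : ZMod 2) = 1)
    (HE : IsExpansionData (Set.range u) Set.univ (fun w z => zs (KK σ) (par q₂) * g c z w) ν α
      (zs (KK σ) (par q₁ + par q₂)) (g c) (h c) (zs (KK σ) (par q₂ + 1)) ν₀ β q κ)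
    (hν : ∀ z w, ν z w ≠ 0) (hν₀ : ∀ z w, ν₀ z w ≠ 0)
    (h12 : IsTwistedAlg ν fun z => T (m := m) (n := n) c q₁ q₂ z)
    (h23 : IsTwistedAlg ν₀ fun z => T (m := m) (n := n) c q₂ q₃ z) :
    strFormula q₁ q₂ q₃ c u v • vac m n σ Ω = (zs (KK σ) (a * par q₂ + b) *
      (pairNorm ν (List.ofFn u) * pairNorm ν₀ (List.ofFn v))) •
        expSum ν α ν₀ β κ (series c (lam q₂)) (h c) (T c q₁ q₃) (T c q₂ q₃) (T c q₁ q₂)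
          (univ.image v) (univ.image u) • vac m n σ Ω := by
  have hpar : ((par q₁ : ZMod 2) + par q₂) * (par q₂ + par q₃) = 0 := by
    rw [h1, h3, zero_add, mul_add, mul_one, mul_self_zmod, CharTwo.add_self_eq_zero]
  have hu : (uSites a b).map (Fin.append u v) = List.ofFn u := map_uSites u v
  have hv : (vSites a b).map (Fin.append u v) = List.ofFn v := map_vSites u v
  have e := (isRTT_T (σ := σ) m n c).rtt_expansion (isRational_spec hc) h1 h3 HE hν hν₀ h12 h23
    (T_smul_vac hΩ c q₂) (append_injective huv) (uSites_pairwise a b) (vSites_pairwise a b)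
    (fun k hk q hq => lt_of_mem_sites hk hq) (I := siteIdx q₁ q₂) (L := siteIdx q₂ q₃)
    (fun k hk => siteIdx_u _ _ hk) (fun k hk => siteIdx_u _ _ hk) (fun k hk => siteIdx_v _ _ hk)
    (fun k hk => siteIdx_v _ _ hk)
    (fun p hp hp' => by rcases List.mem_append.1 (mem_sites p) with h | h <;> contradiction)
    (fun p hp => by
      have := List.mem_map_of_mem (f := Fin.append u v) hp
      rw [hu, List.mem_ofFn] at this
      exact this)
    (fun p hp => by
      have := List.mem_map_of_mem (f := Fin.append u v) hp
      rw [hv, List.mem_ofFn] at this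
      rintro ⟨j, hj⟩
      obtain ⟨i, hi⟩ := this
      exact absurd (@huv (Sum.inr i) (Sum.inl j) (hi.trans hj.symm)) (by simp))
  rw [hu, hv, toFinset_ofFn, toFinset_ofFn] at e
  rw [strFormula_eq hpar, smul_assoc, betheMat, e, expSum_smul, smul_smul]
  congr 1
  have l1 : (uSites a b).length = a := by simp [uSites]
  have l2 : (vSites a b).length = b := by simp [vSites]
  rw [l1, l2, ← mul_assoc, ← zs_add, h3, mul_one, add_assoc, CharTwo.add_self_eq_zero, add_zero]

end Kets
end SuperYangian

noncomputable section
namespace SuperYangian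
open scoped BigOperators

section Bethe

open Finset

variable {σ : Type*} [LinearOrder σ] [Finite σ] {M : Type*} [AddCommGroup M] {c : ℂ} {a b : ℕ}
  {u : Fin a → σ} {v : Fin b → σ}

/-- `g(J,I) h(I,I)`. -/
def prodKernel (c : ℂ) (I J : Finset σ) : KK σ :=
  (∏ x ∈ I, ∏ j ∈ J, g c j x) * ∏ x ∈ I, ∏ y ∈ I, h c x y

lemma h_ne (hc : c ≠ 0) (z w : σ) : h c z w ≠ 0 := (isRational_spec hc).h_ne z w

lemma HH_ne (hc : c ≠ 0) (l : List σ) : HH c l ≠ 0 := by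
  induction l with
  | nil => exact one_ne_zero
  | cons x l ih =>
    refine mul_ne_zero (List.prod_ne_zero fun h0 => ?_) ih
    obtain ⟨y, _, hy⟩ := List.mem_map.1 h0
    simp [h_ne hc] at hy

lemma isTwistedAlg_one {F A σ : Type*} [Field F] [Ring A] [Algebra F A] {X : σ → A}
    (h : ∀ {z w}, z ≠ w → X z * X w = X w * X z) : IsTwistedAlg (fun _ _ => (1 : F)) X :=
  fun hzw => by rw [h hzw]

lemma scal_smul_vac {m n : ℕ} {N : Type*} [AddCommGroup N] [Module (KK σ) N] [Module (YY m n σ) N]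
    [IsScalarTower (KK σ) (YY m n σ) N] {x : N} {k k' : KK σ} {X Y : YY m n σ}
    (h : X • x = k' • Y • x) : scal k X • x = (k * k') • Y • x := by
  rw [scal_eq_smul, smul_assoc, h, smul_smul]

section TwoOne

lemma sign_two_one {F : Type*} [Field F] (b : ℕ) (k : F) (hk : k ≠ 0) :
    (-1) ^ b / k * ((-1) ^ b * k) = 1 := by
  rw [div_mul_eq_mul_div, ← mul_assoc, ← pow_add, Even.neg_one_pow ⟨b, rfl⟩, one_mul, div_self hk]

variable [Module (Yang 2 1) M] {Ω : M} {lam : Fin (2 + 1) → ℕ → ℂ}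

lemma par_two_one : (par (m := 2) (n := 1) 0 = 0) ∧ (par (m := 2) (n := 1) 1 = 0) ∧
    (par (m := 2) (n := 1) 2 = 1) := ⟨rfl, rfl, rfl⟩

theorem betheOp21_ttr (hc : c ≠ 0) (huv : Function.Injective (Sum.elim u v))
    (hΩ : IsSingular 2 1 Ω lam) : betheOp21 c u v • vac 2 1 σ Ω =
      expSum (m := 2) (n := 1) (h c) (g c) (fun _ _ => 1) (fun x y => 1 + g c x y) (prodKernel c) (series c (lam 1))
        (h c) (T c 0 2) (T c 0 1) (T c 1 2) (univ.image u) (univ.image v) • vac 2 1 σ Ω := by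
  obtain ⟨p0, p1, p2⟩ := par_two_one
  have H := isRTT_T (σ := σ) 2 1 c
  have hs := isRational_spec (σ := σ) hc
  have HE : IsExpansionData (Set.range v) Set.univ
      (fun w z => zs (KK σ) (par (m := 2) (n := 1) 1) * g c w z) (h c) (g c)
      (zs (KK σ) (par (m := 2) (n := 1) 1 + par (m := 2) (n := 1) 2)) (g c) (h c)
      (zs (KK σ) (par (m := 2) (n := 1) 1)) (fun _ _ => 1) (fun x y => 1 + g c x y) (h c)
      (prodKernel c) := by
    simp only [p1, p2, Nat.cast_zero, Nat.cast_one, zero_add, zs_zero, zs_one, one_mul]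
    exact hs.expansionData (Set.subset_univ _)
  have e := strFormula_ttr hc huv hΩ (by rw [p0]; rfl) (by rw [p2]; rfl) HE (h_ne hc)
    (fun _ _ => one_ne_zero) (H.self_twisted hs (by rw [p1]; rfl) (by rw [p2]; rfl))
    (isTwistedAlg_one fun hzw => H.self_comm hs (by rw [p0, p1]) hzw)
  rw [betheOp21, scal_smul_vac e, pairNorm_h, pairNorm_one, p1, Nat.cast_zero, mul_zero, zero_add,
    zs_natCast, mul_one, sign_two_one b _ (HH_ne hc _), one_smul]

theorem betheOp21_rtt (hc : c ≠ 0) (huv : Function.Injective (Sum.elim u v))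
    (hΩ : IsSingular 2 1 Ω lam) : betheOp21 c u v • vac 2 1 σ Ω =
      expSum (m := 2) (n := 1) (fun _ _ => 1) (fun x y => 1 + g c y x) (h c) (fun x y => g c y x)
        (izerginSet (g (σ := σ) c) (h c)) (series c (lam 1))
        (h c) (T c 0 2) (T c 1 2) (T c 0 1) (univ.image v) (univ.image u) • vac 2 1 σ Ω := by
  obtain ⟨p0, p1, p2⟩ := par_two_one
  have H := isRTT_T (σ := σ) 2 1 c
  have hs := isRational_spec (σ := σ) hc
  have HE : IsExpansionData (Set.range u) Set.univ
      (fun w z => zs (KK σ) (par (m := 2) (n := 1) 1) * g c z w) (fun _ _ => 1)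
      (fun x y => 1 + g c y x)
      (zs (KK σ) (par (m := 2) (n := 1) 0 + par (m := 2) (n := 1) 1)) (g c) (h c)
      (zs (KK σ) (par (m := 2) (n := 1) 1 + 1)) (h c) (fun x y => g c y x) (fun _ _ => 1)
      (izerginSet (g (σ := σ) c) (h c)) := by
    simp only [p0, p1, Nat.cast_zero, zero_add, zs_zero, zs_one, one_mul]
    exact hs.expansionData' (Set.subset_univ _)
  have e := strFormula_rtt hc huv hΩ (by rw [p0]; rfl) (by rw [p2]; rfl) HE
    (fun _ _ => one_ne_zero) (h_ne hc)
    (isTwistedAlg_one fun hzw => H.self_comm hs (by rw [p0, p1]) hzw)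
    (H.self_twisted hs (by rw [p1]; rfl) (by rw [p2]; rfl))
  rw [betheOp21, scal_smul_vac e, pairNorm_h, pairNorm_one, p1, Nat.cast_zero, mul_zero, zero_add,
    zs_natCast, one_mul, sign_two_one b _ (HH_ne hc _), one_smul]

end TwoOne

section OneTwo

variable [Module (Yang 1 2) M] {Ω : M} {lam : Fin (1 + 2) → ℕ → ℂ}

lemma par_one_two : (par (m := 1) (n := 2) 0 = 0) ∧ (par (m := 1) (n := 2) 1 = 1) ∧
    (par (m := 1) (n := 2) 2 = 1) := ⟨rfl, rfl, rfl⟩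

lemma sign_one_two {F : Type*} [Field F] (a b : ℕ) (k : F) (hk : k ≠ 0) :
    (-1) ^ a / k * (zs F (a + b) * k) = (-1) ^ b := by
  have : zs F ((a : ZMod 2) + b) = (-1) ^ (a + b) := by rw [← zs_natCast, Nat.cast_add]
  rw [this, div_mul_eq_mul_div, ← mul_assoc, ← pow_add, ← add_assoc, ← two_mul, pow_add, pow_mul,
    neg_one_sq, one_pow, one_mul, mul_div_assoc, div_self hk, mul_one]

lemma neg_one_mul_of_eq_neg {R : Type*} [Ring R] {x y : R} (h : x = -y) : -1 * y = x := by
  rw [h, neg_one_mul]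

lemma neg_one_mul_g (c : ℂ) (z w : σ) : -1 * g c z w = g c w z :=
  neg_one_mul_of_eq_neg (g_anti c w z)

theorem betheOp12_rtt (hc : c ≠ 0) (huv : Function.Injective (Sum.elim u v))
    (hΩ : IsSingular 1 2 Ω lam) : betheOp12 c u v • vac 1 2 σ Ω = ((-1 : KK σ) ^ b) •
      expSum (m := 1) (n := 2) (h c) (g c) (fun _ _ => 1) (fun x y => 1 + g c x y) (prodKernel c) (series c (lam 1))
        (h c) (T c 0 2) (T c 1 2) (T c 0 1) (univ.image v) (univ.image u) • vac 1 2 σ Ω := by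
  obtain ⟨p0, p1, p2⟩ := par_one_two
  have H := isRTT_T (σ := σ) 1 2 c
  have hs := isRational_spec (σ := σ) hc
  have HE : IsExpansionData (Set.range u) Set.univ
      (fun w z => zs (KK σ) (par (m := 1) (n := 2) 1) * g c z w) (h c) (g c)
      (zs (KK σ) (par (m := 1) (n := 2) 0 + par (m := 1) (n := 2) 1)) (g c) (h c)
      (zs (KK σ) (par (m := 1) (n := 2) 1 + 1)) (fun _ _ => 1) (fun x y => 1 + g c x y) (h c)
      (prodKernel c) := by
    simp only [p0, p1, Nat.cast_zero, Nat.cast_one, zero_add, zs_zero, zs_one, neg_one_mul_g,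
      CharTwo.add_self_eq_zero]
    exact hs.expansionData (Set.subset_univ _)
  have e := strFormula_rtt hc huv hΩ (by rw [p0]; rfl) (by rw [p2]; rfl) HE (h_ne hc)
    (fun _ _ => one_ne_zero) (H.self_twisted hs (by rw [p0]; rfl) (by rw [p1]; rfl))
    (isTwistedAlg_one fun hzw => H.self_comm hs (by rw [p1, p2]) hzw)
  rw [betheOp12, scal_smul_vac e, pairNorm_h, pairNorm_one, p1, Nat.cast_one, mul_one, mul_one,
    sign_one_two a b _ (HH_ne hc _)]

theorem betheOp12_ttr (hc : c ≠ 0) (huv : Function.Injective (Sum.elim u v))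
    (hΩ : IsSingular 1 2 Ω lam) : betheOp12 c u v • vac 1 2 σ Ω = ((-1 : KK σ) ^ b) •
      expSum (m := 1) (n := 2) (fun _ _ => 1) (fun x y => 1 + g c y x) (h c) (fun x y => g c y x)
        (izerginSet (g (σ := σ) c) (h c)) (series c (lam 1))
        (h c) (T c 0 2) (T c 0 1) (T c 1 2) (univ.image u) (univ.image v) • vac 1 2 σ Ω := by
  obtain ⟨p0, p1, p2⟩ := par_one_two
  have H := isRTT_T (σ := σ) 1 2 c
  have hs := isRational_spec (σ := σ) hc
  have HE : IsExpansionData (Set.range v) Set.univ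
      (fun w z => zs (KK σ) (par (m := 1) (n := 2) 1) * g c w z) (fun _ _ => 1)
      (fun x y => 1 + g c y x)
      (zs (KK σ) (par (m := 1) (n := 2) 1 + par (m := 1) (n := 2) 2)) (g c) (h c)
      (zs (KK σ) (par (m := 1) (n := 2) 1)) (h c) (fun x y => g c y x) (fun _ _ => 1)
      (izerginSet (g (σ := σ) c) (h c)) := by
    simp only [p1, p2, Nat.cast_one, zs_one, neg_one_mul_g, CharTwo.add_self_eq_zero,
      zs_zero]
    exact hs.expansionData' (Set.subset_univ _)
  have e := strFormula_ttr hc huv hΩ (by rw [p0]; rfl) (by rw [p2]; rfl) HE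
    (fun _ _ => one_ne_zero) (h_ne hc)
    (isTwistedAlg_one fun hzw => H.self_comm hs (by rw [p1, p2]) hzw)
    (H.self_twisted hs (by rw [p0]; rfl) (by rw [p1]; rfl))
  rw [betheOp12, scal_smul_vac e, pairNorm_h, pairNorm_one, p1, Nat.cast_one, mul_one, one_mul,
    sign_one_two a b _ (HH_ne hc _)]

end OneTwo

end Bethe
end SuperYangian

noncomputable section
namespace SuperYangian
open scoped BigOperators

section Psi

open Finset

variable {σ : Type*} [LinearOrder σ] [Finite σ] {m n : ℕ}

/-- The transposition map on series. -/
def psiY (X : YY m n σ) : YY m n σ := X.map (psi m n)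

lemma psiY_coeff (X : YY m n σ) (a : Expo σ) : (psiY X).coeff a = psi m n (X.coeff a) := rfl

lemma psiY_support (X : YY m n σ) : (psiY X).support ⊆ X.support := by
  intro a ha hX
  exact ha (by rw [psiY_coeff, hX, map_zero])

lemma psiY_mul_of {X Y : YY m n σ} {k : ℕ} (H : ∀ a b, psi m n (X.coeff a * Y.coeff b) =
    sg k • (psi m n (Y.coeff b) * psi m n (X.coeff a))) :
    psiY (X * Y) = sg k • (psiY Y * psiY X) := by
  ext a
  rw [psiY_coeff, HahnSeries.coeff_smul, HahnSeries.coeff_mul,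
    HahnSeries.coeff_mul_left' Y.isPWO_support (psiY_support Y), map_sum, smul_sum]
  symm
  have hc : ∀ p : Expo σ × Expo σ, sg k • ((psiY Y).coeff p.1 * (psiY X).coeff p.2) =
      psi m n (X.coeff p.2 * Y.coeff p.1) := fun p => (H _ _).symm
  simp only [hc]
  have hsub : Finset.antidiagonal Y.isPWO_support (psiY X).isPWO_support a ⊆
      Finset.antidiagonal Y.isPWO_support X.isPWO_support a := by
    intro p hp
    simp only [Finset.mem_antidiagonal] at hp ⊢
    exact ⟨hp.1, psiY_support X hp.2.1, hp.2.2⟩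
  rw [sum_subset hsub]
  · refine sum_bij' (fun p _ => p.swap) (fun p _ => p.swap) ?_ ?_ ?_ ?_ ?_
    · rintro ⟨i, j⟩ h
      simp only [Finset.mem_antidiagonal, Prod.swap] at h ⊢
      exact ⟨h.2.1, h.1, by rw [add_comm]; exact h.2.2⟩
    · rintro ⟨i, j⟩ h
      simp only [Finset.mem_antidiagonal, Prod.swap] at h ⊢
      exact ⟨h.2.1, h.1, by rw [add_comm]; exact h.2.2⟩
    all_goals intros; simp
  · rintro ⟨i, j⟩ h1 h2
    simp only [Finset.mem_antidiagonal] at h1 h2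
    have : (psiY X).coeff j = 0 := by
      by_contra h0
      exact h2 ⟨h1.1, h0, h1.2.2⟩
    rw [← hc, this, mul_zero, smul_zero]

/-- `X` is homogeneous of degree `k`. -/
def IsHomY (k : ℕ) (X : YY m n σ) : Prop := grY X = sg k • X

lemma psiY_mul {X Y : YY m n σ} {k l : ℕ} (hX : IsHomY k X) (hY : IsHomY l Y) :
    psiY (X * Y) = sg (k * l) • (psiY Y * psiY X) :=
  psiY_mul_of fun a b => psi_mul_homogeneous (congrArg (fun X => X.coeff a) hX)
    (congrArg (fun X => X.coeff b) hY)

lemma psiY_smul (k : KK σ) (X : YY m n σ) : psiY (k • X) = k • psiY X := by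
  have e : psiY (scalHom m n σ k * X) = sg 0 • (psiY X * psiY (scalHom m n σ k)) :=
    psiY_mul_of fun a b => by
      change psi m n (algebraMap ℂ (Yang m n) (k.coeff a) * _) =
        sg 0 • (_ * psi m n (algebraMap ℂ (Yang m n) (k.coeff a)))
      rw [Algebra.algebraMap_eq_smul_one, smul_one_mul, map_smul, map_smul, psi_one, mul_smul_comm,
        mul_one, sg, pow_zero, one_smul]
  have e2 : psiY (scalHom m n σ k) = scalHom m n σ k := by
    ext a
    change psi m n (algebraMap ℂ (Yang m n) (k.coeff a)) = algebraMap ℂ (Yang m n) (k.coeff a)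
    rw [Algebra.algebraMap_eq_smul_one, map_smul, psi_one]
  rw [e2, ← scalHom_commute, sg, pow_zero, one_smul] at e
  exact e

/-- The transposition map on series, as a linear map. -/
def psiLin (m n : ℕ) (σ : Type*) [LinearOrder σ] [Finite σ] : YY m n σ →ₗ[KK σ] YY m n σ where
  toFun := psiY
  map_add' X Y := by ext a; simp [psiY]
  map_smul' := psiY_smul

lemma psiLin_apply (X : YY m n σ) : psiLin m n σ X = psiY X := rfl

lemma psiY_T (c : ℂ) {i j : Fin (m + n)} (hij : sg (par i * par j + par i) = 1) (u : σ) :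
    psiY (T c i j u) = T c j i u := by
  ext a
  rw [psiY_coeff, T_coeff, T_coeff]
  split_ifs with h
  · rw [tCoeff, tCoeff]
    split_ifs
    · rw [map_smul, psi_Tc, hij, one_smul]
    · rw [map_zero]
  · rw [map_zero]

lemma isHomY_T (c : ℂ) (i j : Fin (m + n)) (u : σ) : IsHomY (par i + par j) (T c i j u) := grY_T c i j u

lemma IsHomY.smul {k : ℕ} {X : YY m n σ} (hX : IsHomY k X) (r : KK σ) : IsHomY k (r • X) := by
  rw [IsHomY, ← grHom_apply, map_smul, grHom_apply, hX, smul_comm]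

lemma IsHomY.mul {k l : ℕ} {X Y : YY m n σ} (hX : IsHomY k X) (hY : IsHomY l Y) :
    IsHomY (k + l) (X * Y) := by
  rw [IsHomY, ← grHom_apply, map_mul, grHom_apply, grHom_apply, hX, hY, sg_add,
    smul_mul_smul_comm]

lemma isHomY_prod (c : ℂ) (i j : Fin (m + n)) (l : List σ) :
    IsHomY ((par i + par j) * l.length) (l.map (T c i j)).prod := by
  induction l with
  | nil => rw [IsHomY, ← grHom_apply]; simp [sg]
  | cons u l ih =>
    have := (isHomY_T c i j u).mul ih
    rwa [add_comm, ← mul_add_one] at this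

lemma psiY_prod (c : ℂ) {i j : Fin (m + n)} (hij : sg (par i * par j + par i) = 1) (l : List σ) :
    psiY (l.map (T c i j)).prod = sg ((par i + par j) * l.length.choose 2) • TP c j i l.reverse := by
  induction l with
  | nil =>
    ext a
    simp [psiY_coeff, HahnSeries.coeff_one, TP, sg]
    split_ifs <;> simp [psi_one]
  | cons u l ih =>
    rw [List.map_cons, List.prod_cons, psiY_mul (isHomY_T c i j u) (isHomY_prod c i j l), ih,
      psiY_T c hij, smul_mul_assoc, smul_smul, ← sg_add, TP, TP, List.reverse_cons, List.map_append,
      List.prod_append]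
    congr 1
    · refine sg_congr ?_
      rw [List.length_cons, Nat.choose_succ_succ, Nat.choose_one_right]
      push_cast
      linear_combination (l.length : ZMod 2) * mul_self_zmod (par i + par j)
    · simp

lemma psiY_nProd (c : ℂ) {i j : Fin (m + n)} (hij : sg (par i * par j + par i) = 1)
    (ν : σ → σ → KK σ) (l : List σ) : psiY (nProd ν (T c i j) l.reverse) =
      sg ((par i + par j) * l.length.choose 2) • ((pairNorm ν l.reverse)⁻¹ • TP c j i l) := by
  rw [nProd, psiY_smul, psiY_prod c hij, List.reverse_reverse, List.length_reverse, smul_comm]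

lemma psiY_mul₃ {X Y Z : YY m n σ} {k l r : ℕ} (hX : IsHomY k X) (hY : IsHomY l Y)
    (hZ : IsHomY r Z) : psiY (X * Y * Z) =
      sg ((k + l) * r + k * l) • (psiY Z * psiY Y * psiY X) := by
  rw [psiY_mul (hX.mul hY) hZ, psiY_mul hX hY, mul_smul_comm, smul_smul, ← sg_add, mul_assoc]

lemma bra_psiY {M W : Type*} [AddCommGroup M] [Module (Yang m n) M] [AddCommGroup W]
    [Module (Yang m n)ᵐᵒᵖ W] {Ω : M} {τ : M →+ W} (hτ : IsTransposition m n Ω τ) (X : YY m n σ) :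
    (ket Ω X).map τ = bra (τ Ω) (psiY X) := by
  ext a
  exact hτ (X.coeff a)

lemma ket_eq_of_smul_vac {M : Type*} [AddCommGroup M] [Module (Yang m n) M] {Ω : M} {X Y : YY m n σ}
    (h : X • vac m n σ Ω = Y • vac m n σ Ω) : ket Ω X = ket Ω Y := by
  have := sub_mem_of_smul_vac h
  ext a
  have h1 := congrArg (fun X => X.coeff a) this
  simpa [ket_coeff, sub_smul, sub_eq_zero] using h1

end Psi
end SuperYangian

noncomputable section
namespace SuperYangian
open scoped BigOperators

section Partitions

open Finset

variable {σ : Type*} {a b : ℕ}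

lemma mem_subList {w : Fin a → σ} {S : Finset (Fin a)} {x : σ} :
    x ∈ subList w S ↔ ∃ k ∈ S, w k = x := by
  simp [subList]

lemma length_subList (w : Fin a → σ) (S : Finset (Fin a)) : (subList w S).length = S.card := by
  have hn : ((List.finRange a).filter (· ∈ S)).Nodup := (List.nodup_finRange a).filter _
  rw [subList, List.length_map, ← List.toFinset_card_of_nodup hn]
  congr 1
  ext k; simp

lemma nodup_subList {w : Fin a → σ} (hw : Function.Injective w) (S : Finset (Fin a)) :
    (subList w S).Nodup := ((List.nodup_finRange a).filter _).map hw

variable [DecidableEq σ]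

lemma toFinset_subList (w : Fin a → σ) (S : Finset (Fin a)) :
    (subList w S).toFinset = S.image w := by
  ext x; simp [mem_subList]

lemma image_univ_sdiff {w : Fin a → σ} (hw : Function.Injective w) (S : Finset (Fin a)) :
    univ.image w \ S.image w = Sᶜ.image w := by
  rw [compl_eq_univ_sdiff, image_sdiff _ _ hw]

lemma sum_powerset_image {R : Type*} [AddCommMonoid R] {w : Fin a → σ} (hw : Function.Injective w)
    (F : Finset σ → R) : ∑ I ∈ (univ.image w).powerset, F I = ∑ S : Finset (Fin a), F (S.image w) := by
  refine (sum_bij (fun S _ => S.image w) (fun S _ => ?_) (fun S _ S' _ h => ?_) (fun I hI => ?_)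
    fun _ _ => rfl).symm
  · exact mem_powerset.2 (image_subset_image (subset_univ S))
  · exact image_injective hw h
  · obtain ⟨S, _, hS⟩ := subset_image_iff.1 (mem_powerset.1 hI)
    exact ⟨S, mem_univ _, hS⟩

lemma sum_powersetCard_image {R : Type*} [AddCommMonoid R] {w : Fin a → σ}
    (hw : Function.Injective w) (k : ℕ) (F : Finset σ → R) :
    ∑ I ∈ (univ.image w).powersetCard k, F I =
      ∑ S ∈ univ.filter (fun S : Finset (Fin a) => S.card = k), F (S.image w) := by
  refine (sum_bij (fun S _ => S.image w) (fun S hS => ?_) (fun S _ S' _ h => ?_) (fun I hI => ?_)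
    fun _ _ => rfl).symm
  · rw [mem_powersetCard, card_image_of_injective _ hw]
    exact ⟨image_subset_image (subset_univ S), (mem_filter.1 hS).2⟩
  · exact image_injective hw h
  · rw [mem_powersetCard] at hI
    obtain ⟨S, _, hS⟩ := subset_image_iff.1 hI.1
    refine ⟨S, mem_filter.2 ⟨mem_univ _, ?_⟩, hS⟩
    rw [← hI.2, ← hS, card_image_of_injective _ hw]

lemma nProd_toList {F A : Type*} [Field F] [Ring A] [Algebra F A] {ν : σ → σ → F} {X : σ → A}
    (h : IsTwistedAlg ν X) (hν : ∀ z w, ν z w ≠ 0) {l : List σ} (hl : l.Nodup) :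
    nProd ν X l.toFinset.toList = nProd ν X l.reverse := by
  refine h.nProd_perm hν ?_ (nodup_toList _)
  rw [List.perm_ext_iff_of_nodup (nodup_toList _) (List.nodup_reverse.2 hl)]
  simp

end Partitions

section Coefficients

open Finset

variable {σ : Type*} [LinearOrder σ] [Finite σ] {c : ℂ}

lemma prod2_eq (F : σ → σ → KK σ) {A B : List σ} (hA : A.Nodup) (hB : B.Nodup) :
    prod2 F A B = ∏ x ∈ A.toFinset, ∏ y ∈ B.toFinset, F x y := by
  rw [List.prod_toFinset _ hA, prod2]
  congr 1
  exact List.map_congr_left fun x _ => (List.prod_toFinset _ hB).symm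

lemma lamProd_eq (c : ℂ) (l : ℕ → ℂ) {A : List σ} (hA : A.Nodup) :
    lamProd c l A = ∏ x ∈ A.toFinset, series c l x := (List.prod_toFinset _ hA).symm

lemma mul_rearrange {R : Type*} [CommRing R] (p q r s t : R) :
    p * q * r * s * t = p * s * q * r * t := by ring

lemma partCoef_prodKernel (c : ℂ) (l : ℕ → ℂ) {I II J JJ : List σ} (hI : I.Nodup) (hII : II.Nodup)
    (hJ : J.Nodup) (hJJ : JJ.Nodup) :
    partCoef (prodKernel c) (fun x y => 1 + g c x y) (g c) (series c l) I.toFinset II.toFinset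
      J.toFinset JJ.toFinset = prod2 (g c) J I * prod2 (f c) I II * prod2 (g c) JJ J *
        prod2 (h c) I I * lamProd c l J := by
  rw [prod2_eq _ hJ hI, prod2_eq _ hI hII, prod2_eq _ hJJ hJ, prod2_eq _ hI hI, lamProd_eq _ _ hJ,
    prod_comm, partCoef, prodKernel]
  exact (mul_rearrange _ _ _ _ _).symm

lemma K_eq (hc : c ≠ 0) {I J : List σ} (hI : I.Nodup) (hJ : J.Nodup) (hIJ : I.length = J.length) :
    K c I J = izerginSet (g c) (h c) I.toFinset J.toFinset := by
  rw [K, dif_pos hIJ]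
  refine ((isRational_spec hc).izerginSet_eq (List.nodup_iff_injective_get.1 hI)
    ((List.nodup_iff_injective_get.1 hJ).comp (Fin.cast_injective hIJ)) ?_ ?_).symm
  · ext x; simp [List.mem_iff_get]
  · ext x
    simp only [Set.mem_range, Function.comp_apply, List.coe_toFinset, Set.mem_ofPred_eq,
      List.mem_iff_get]
    exact ⟨fun ⟨k, hk⟩ => ⟨_, hk⟩, fun ⟨k, hk⟩ => ⟨Fin.cast hIJ.symm k, hk⟩⟩

lemma mul_rearrange' {R : Type*} [CommRing R] (p q r s : R) :
    p * q * r * s = p * r * q * s := by ring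

lemma partCoef_izerginSet (hc : c ≠ 0) (l : ℕ → ℂ) {I II J JJ : List σ} (hI : I.Nodup)
    (hII : II.Nodup) (hJ : J.Nodup) (hJJ : JJ.Nodup) (hIJ : I.length = J.length) :
    partCoef (izerginSet (g (σ := σ) c) (h c)) (fun x y => g c y x) (fun x y => 1 + g c y x)
      (series c l) I.toFinset II.toFinset J.toFinset JJ.toFinset =
        K c I J * prod2 (f c) J JJ * prod2 (g c) II I * lamProd c l J := by
  rw [prod2_eq _ hJ hJJ, prod2_eq _ hII hI, lamProd_eq _ _ hJ, K_eq hc hI hJ hIJ, partCoef,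
    prod_comm (s := II.toFinset), prod_comm (s := J.toFinset) (t := JJ.toFinset)]
  exact mul_rearrange' _ _ _ _

end Coefficients

section Dual

open Finset

variable {σ : Type*} [LinearOrder σ] [Finite σ] {m n : ℕ} {c : ℂ} {a b : ℕ} {u : Fin a → σ}
  {v : Fin b → σ} {ν α ν₀ β η : σ → σ → KK σ} {κ : Finset σ → Finset σ → KK σ}

lemma expSum_image {X₁ X₀ C : σ → YY m n σ} (hu : Function.Injective u) (hv : Function.Injective v)
    (h₁ : IsTwistedAlg η X₁) (hη : ∀ z w, η z w ≠ 0) (h₀ : IsTwistedAlg ν₀ X₀)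
    (hν₀ : ∀ z w, ν₀ z w ≠ 0) (hC : IsTwistedAlg ν C) (hν : ∀ z w, ν z w ≠ 0) (χ : σ → KK σ) :
    expSum ν α ν₀ β κ χ η X₁ X₀ C (univ.image u) (univ.image v) =
      ∑ S : Finset (Fin a), ∑ R ∈ univ.filter (fun R : Finset (Fin b) => R.card = S.card),
        partCoef κ β α χ (subList u S).toFinset (subList u Sᶜ).toFinset (subList v R).toFinset
          (subList v Rᶜ).toFinset • (nProd η X₁ (subList u S).reverse *
            nProd ν₀ X₀ (subList u Sᶜ).reverse * nProd ν C (subList v Rᶜ).reverse) := by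
  rw [expSum, sum_powerset_image hu]
  refine sum_congr rfl fun S _ => ?_
  rw [sum_powersetCard_image hv, card_image_of_injective _ hu]
  refine sum_congr rfl fun R _ => ?_
  rw [image_univ_sdiff hu, image_univ_sdiff hv, ← toFinset_subList, ← toFinset_subList,
    ← toFinset_subList, ← toFinset_subList, nProd_toList h₁ hη (nodup_subList hu _),
    nProd_toList h₀ hν₀ (nodup_subList hu _), nProd_toList hC hν (nodup_subList hv _)]

lemma psiY_nProd₃ {i₁ j₁ i₀ j₀ i₂ j₂ : Fin (m + n)} (h₁ : sg (par i₁ * par j₁ + par i₁) = 1)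
    (h₀ : sg (par i₀ * par j₀ + par i₀) = 1) (h₂ : sg (par i₂ * par j₂ + par i₂) = 1)
    (l₁ l₀ l₂ : List σ) {N : ℕ} (hN : ((par i₁ + par j₁ : ZMod 2) * (l₁.length.choose 2 : ℕ) +
      (par i₀ + par j₀) * (l₀.length.choose 2 : ℕ) + (par i₂ + par j₂) * (l₂.length.choose 2 : ℕ) +
      (((par i₁ + par j₁) * l₁.length + (par i₀ + par j₀) * l₀.length) *
        ((par i₂ + par j₂) * l₂.length) +
      (par i₁ + par j₁) * l₁.length * ((par i₀ + par j₀) * l₀.length))) = N) :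
    psiY (nProd η (T c i₁ j₁) l₁.reverse * nProd ν₀ (T c i₀ j₀) l₀.reverse *
      nProd ν (T c i₂ j₂) l₂.reverse) = sg N •
        (((pairNorm ν l₂.reverse)⁻¹ • TP c j₂ i₂ l₂) * ((pairNorm ν₀ l₀.reverse)⁻¹ • TP c j₀ i₀ l₀) *
          ((pairNorm η l₁.reverse)⁻¹ • TP c j₁ i₁ l₁)) := by
  have e := psiY_mul₃ ((isHomY_prod c i₁ j₁ l₁.reverse).smul (pairNorm η l₁.reverse)⁻¹)
    ((isHomY_prod c i₀ j₀ l₀.reverse).smul (pairNorm ν₀ l₀.reverse)⁻¹)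
    ((isHomY_prod c i₂ j₂ l₂.reverse).smul (pairNorm ν l₂.reverse)⁻¹)
  refine e.trans ?_
  have e1 := psiY_nProd c h₁ η l₁
  have e0 := psiY_nProd c h₀ ν₀ l₀
  have e2 := psiY_nProd c h₂ ν l₂
  rw [nProd] at e1 e0 e2
  rw [e1, e0, e2, smul_mul_smul_comm, smul_mul_smul_comm, smul_smul, ← sg_add, ← sg_add, ← sg_add]
  congr 1
  refine sg_congr ?_
  rw [← hN]
  simp only [List.length_reverse]
  push_cast
  ring

lemma pairNorm_h_smul (c : ℂ) (i j : Fin (m + n)) (l : List σ) :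
    (pairNorm (h c) l.reverse)⁻¹ • TP c i j l = TTdual c i j l := by
  rw [pairNorm_h]; rfl

lemma choose_two_of_add {x y k : ℕ} (h : x + y = k) :
    k.choose 2 = x.choose 2 + y.choose 2 + x * y := by
  subst h
  induction x with
  | zero => simp
  | succ x ih =>
    rw [add_right_comm, Nat.choose_succ_succ, ih, Nat.choose_succ_succ x, Nat.choose_one_right,
      Nat.choose_one_right]
    ring

lemma card_add_card_compl_of_eq {p q : ℕ} {S : Finset (Fin p)} {R : Finset (Fin q)}
    (h : R.card = S.card) : S.card + Rᶜ.card = q := by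
  rw [← h, Finset.card_add_card_compl, Fintype.card_fin]

theorem psiY_expSum_prodKernel (hc : c ≠ 0) (hu : Function.Injective u) (hv : Function.Injective v)
    {i₁ j₁ i₀ j₀ i₂ j₂ : Fin (m + n)} (s₁ : sg (par i₁ * par j₁ + par i₁) = 1)
    (s₀ : sg (par i₀ * par j₀ + par i₀) = 1) (s₂ : sg (par i₂ * par j₂ + par i₂) = 1)
    (d₁ : (par i₁ + par j₁ : ZMod 2) = 1) (d₀ : (par i₀ + par j₀ : ZMod 2) = 0)
    (d₂ : (par i₂ + par j₂ : ZMod 2) = 1) (h₁ : IsTwistedAlg (h (σ := σ) c) (T (σ := σ) (m := m) (n := n) c i₁ j₁))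
    (h₀ : IsTwistedAlg (fun _ _ => (1 : KK σ)) (T (σ := σ) c i₀ j₀))
    (h₂ : IsTwistedAlg (h (σ := σ) c) (T (σ := σ) c i₂ j₂)) (l : ℕ → ℂ) :
    psiY (expSum (h c) (g c) (fun _ _ => 1) (fun x y => 1 + g c x y) (prodKernel c) (series c l)
      (h c) (T c i₁ j₁) (T c i₀ j₀) (T c i₂ j₂) (univ.image u) (univ.image v)) =
      sg (b.choose 2) • ∑ S : Finset (Fin a),
        ∑ R ∈ univ.filter (fun R : Finset (Fin b) => R.card = S.card),
          scal (prod2 (g c) (subList v R) (subList u S) * prod2 (f c) (subList u S) (subList u Sᶜ) *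
            prod2 (g c) (subList v Rᶜ) (subList v R) * prod2 (h c) (subList u S) (subList u S) *
            lamProd c l (subList v R))
          (TTdual c j₂ i₂ (subList v Rᶜ) * TP c j₀ i₀ (subList u Sᶜ) *
            TTdual c j₁ i₁ (subList u S)) := by
  rw [expSum_image hu hv h₁ (h_ne hc) h₀ (fun _ _ => one_ne_zero) h₂ (h_ne hc), ← psiLin_apply,
    map_sum, smul_sum]
  refine sum_congr rfl fun S _ => ?_
  rw [map_sum, smul_sum]
  refine sum_congr rfl fun R hR => ?_
  rw [map_smul, psiLin_apply, psiY_nProd₃ (N := b.choose 2) s₁ s₀ s₂ _ _ _ ?_,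
    partCoef_prodKernel c l (nodup_subList hu _) (nodup_subList hu _) (nodup_subList hv _)
      (nodup_subList hv _), pairNorm_h_smul, pairNorm_h_smul, pairNorm_one, inv_one, one_smul,
    scal_eq_smul, smul_comm]
  rw [d₁, d₀, d₂, length_subList, length_subList, length_subList,
    choose_two_of_add (card_add_card_compl_of_eq (mem_filter.1 hR).2)]
  push_cast
  ring

theorem psiY_expSum_izerginSet (hc : c ≠ 0) (hu : Function.Injective u) (hv : Function.Injective v)
    {i₁ j₁ i₀ j₀ i₂ j₂ : Fin (m + n)} (s₁ : sg (par i₁ * par j₁ + par i₁) = 1)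
    (s₀ : sg (par i₀ * par j₀ + par i₀) = 1) (s₂ : sg (par i₂ * par j₂ + par i₂) = 1)
    (d₁ : (par i₁ + par j₁ : ZMod 2) = 1) (d₀ : (par i₀ + par j₀ : ZMod 2) = 1)
    (d₂ : (par i₂ + par j₂ : ZMod 2) = 0) (h₁ : IsTwistedAlg (h (σ := σ) c) (T (σ := σ) (m := m) (n := n) c i₁ j₁))
    (h₀ : IsTwistedAlg (h (σ := σ) c) (T (σ := σ) c i₀ j₀))
    (h₂ : IsTwistedAlg (fun _ _ => (1 : KK σ)) (T (σ := σ) c i₂ j₂)) (l : ℕ → ℂ) :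
    psiY (expSum (fun _ _ => 1) (fun x y => 1 + g c y x) (h c) (fun x y => g c y x)
      (izerginSet (g (σ := σ) c) (h c)) (series c l)
      (h c) (T c i₁ j₁) (T c i₀ j₀) (T c i₂ j₂) (univ.image u) (univ.image v)) =
      sg (a.choose 2) • ∑ S : Finset (Fin a),
        ∑ R ∈ univ.filter (fun R : Finset (Fin b) => R.card = S.card),
          scal (K c (subList u S) (subList v R) * prod2 (f c) (subList v R) (subList v Rᶜ) *
            prod2 (g c) (subList u Sᶜ) (subList u S) * lamProd c l (subList v R))
          (TP c j₂ i₂ (subList v Rᶜ) * TTdual c j₀ i₀ (subList u Sᶜ) *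
            TTdual c j₁ i₁ (subList u S)) := by
  rw [expSum_image hu hv h₁ (h_ne hc) h₀ (h_ne hc) h₂ (fun _ _ => one_ne_zero), ← psiLin_apply,
    map_sum, smul_sum]
  refine sum_congr rfl fun S _ => ?_
  rw [map_sum, smul_sum]
  refine sum_congr rfl fun R hR => ?_
  rw [map_smul, psiLin_apply, psiY_nProd₃ (N := a.choose 2) s₁ s₀ s₂ _ _ _ ?_,
    partCoef_izerginSet hc l (nodup_subList hu _) (nodup_subList hu _) (nodup_subList hv _)
      (nodup_subList hv _) (by rw [length_subList, length_subList, (mem_filter.1 hR).2]),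
    pairNorm_h_smul, pairNorm_h_smul, pairNorm_one, inv_one, one_smul, scal_eq_smul, smul_comm]
  rw [d₁, d₀, d₂, length_subList, length_subList, length_subList,
    choose_two_of_add (card_add_card_compl_of_eq (S := S) (R := S) rfl)]
  push_cast
  ring

lemma sum_partitions_comm {R : Type*} [AddCommMonoid R] (F : Finset (Fin a) → Finset (Fin b) → R) :
    ∑ S : Finset (Fin b), ∑ R ∈ univ.filter (fun R : Finset (Fin a) => R.card = S.card), F R S =
      ∑ S : Finset (Fin a), ∑ R ∈ univ.filter (fun R : Finset (Fin b) => R.card = S.card), F S R := by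
  refine sum_comm' fun x y => ?_
  simp [eq_comm]

end Dual
end SuperYangian

noncomputable section
namespace SuperYangian
open scoped BigOperators

section DualBethe

open Finset

section Reverse

variable {σ : Type*} {a b : ℕ} {u : Fin a → σ} {v : Fin b → σ}

lemma elim_rev_injective (huv : Function.Injective (Sum.elim u v)) :
    Function.Injective (Sum.elim (u ∘ Fin.rev) (v ∘ Fin.rev)) := by
  have : Sum.elim (u ∘ Fin.rev) (v ∘ Fin.rev) = Sum.elim u v ∘ Sum.map Fin.rev Fin.rev := by
    funext x; rcases x with x | x <;> rfl
  rw [this]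
  exact huv.comp (Sum.map_injective.2 ⟨Fin.rev_injective, Fin.rev_injective⟩)

lemma image_rev [DecidableEq σ] (u : Fin a → σ) : univ.image (u ∘ Fin.rev) = univ.image u := by
  ext x
  simp only [mem_image, mem_univ, true_and, Function.comp_apply]
  exact ⟨fun ⟨k, hk⟩ => ⟨_, hk⟩, fun ⟨k, hk⟩ => ⟨k.rev, by rw [Fin.rev_rev, hk]⟩⟩

end Reverse

variable {σ : Type*} [LinearOrder σ] [Finite σ] {M W : Type*} [AddCommGroup M] [AddCommGroup W]
  {c : ℂ} {a b : ℕ} {u : Fin a → σ} {v : Fin b → σ}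

lemma map_ket_eq_bra {m n : ℕ} [Module (Yang m n) M] [Module (Yang m n)ᵐᵒᵖ W] {Ω : M} {τ : M →+ W}
    (hτ : IsTransposition m n Ω τ) {B X Y : YY m n σ} (h : B • vac m n σ Ω = X • vac m n σ Ω)
    (hXY : psiY X = Y) : (ket Ω B).map τ = bra (τ Ω) Y := by
  rw [ket_eq_of_smul_vac h, bra_psiY hτ, hXY]

section TwoOne

variable [Module (Yang 2 1) M] [Module (Yang 2 1)ᵐᵒᵖ W] {Ω : M} {lam : Fin (2 + 1) → ℕ → ℂ}
  {τ : M →+ W}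

theorem Psi21_eq_dualA21 (hc : c ≠ 0) (huv : Function.Injective (Sum.elim u v))
    (hΩ : IsSingular 2 1 Ω lam) (hτ : IsTransposition 2 1 Ω τ) :
    Psi21 c Ω τ u v = bra (τ Ω) (dualA21 c (lam 1) u v) := by
  have e := betheOp21_ttr hc (elim_rev_injective huv) hΩ
  rw [image_rev, image_rev] at e
  refine map_ket_eq_bra hτ e ?_
  obtain ⟨p0, p1, p2⟩ := par_two_one
  have H := isRTT_T (σ := σ) 2 1 c
  have hs := isRational_spec (σ := σ) hc
  rw [dualA21, ← Nat.choose_two_right]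
  refine psiY_expSum_prodKernel hc (huv.comp Sum.inl_injective) (huv.comp Sum.inr_injective)
    ?_ ?_ ?_ ?_ ?_ ?_ ?_ ?_ ?_ _
  · simp [p0, sg]
  · simp [p0, sg]
  · simp [p1, sg]
  · simp [p0, p2]
  · simp [p0, p1]
  · simp [p1, p2]
  · exact H.self_twisted hs (by rw [p0]; rfl) (by rw [p2]; rfl)
  · exact isTwistedAlg_one fun hzw => H.self_comm hs (by rw [p0, p1]) hzw
  · exact H.self_twisted hs (by rw [p1]; rfl) (by rw [p2]; rfl)

theorem Psi21_eq_dualB21 (hc : c ≠ 0) (huv : Function.Injective (Sum.elim u v))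
    (hΩ : IsSingular 2 1 Ω lam) (hτ : IsTransposition 2 1 Ω τ) :
    Psi21 c Ω τ u v = bra (τ Ω) (dualB21 c (lam 1) u v) := by
  have e := betheOp21_rtt hc (elim_rev_injective huv) hΩ
  rw [image_rev, image_rev] at e
  refine map_ket_eq_bra hτ e ?_
  obtain ⟨p0, p1, p2⟩ := par_two_one
  have H := isRTT_T (σ := σ) 2 1 c
  have hs := isRational_spec (σ := σ) hc
  rw [dualB21, ← Nat.choose_two_right, partSum, ← sum_partitions_comm]
  refine psiY_expSum_izerginSet hc (huv.comp Sum.inr_injective) (huv.comp Sum.inl_injective)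
    ?_ ?_ ?_ ?_ ?_ ?_ ?_ ?_ ?_ _
  · simp [p0, sg]
  · simp [p1, sg]
  · simp [p0, sg]
  · simp [p0, p2]
  · simp [p1, p2]
  · simp [p0, p1]
  · exact H.self_twisted hs (by rw [p0]; rfl) (by rw [p2]; rfl)
  · exact H.self_twisted hs (by rw [p1]; rfl) (by rw [p2]; rfl)
  · exact isTwistedAlg_one fun hzw => H.self_comm hs (by rw [p0, p1]) hzw

end TwoOne

section OneTwo

variable [Module (Yang 1 2) M] [Module (Yang 1 2)ᵐᵒᵖ W] {Ω : M} {lam : Fin (1 + 2) → ℕ → ℂ}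
  {τ : M →+ W}

lemma psiY_neg_one_pow_smul {m n : ℕ} (k l : ℕ) {X Y : YY m n σ} (h : psiY X = sg l • Y) :
    psiY (((-1 : KK σ) ^ k) • X) = sg (k + l) • Y := by
  rw [psiY_smul, h, sg_add, mul_smul]
  exact (sg_smul (R := KK σ) k (sg l • Y)).symm

theorem Psi12_eq_dualA12 (hc : c ≠ 0) (huv : Function.Injective (Sum.elim u v))
    (hΩ : IsSingular 1 2 Ω lam) (hτ : IsTransposition 1 2 Ω τ) :
    Psi12 c Ω τ u v = bra (τ Ω) (dualA12 c (lam 1) u v) := by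
  have e := betheOp12_rtt hc (elim_rev_injective huv) hΩ
  rw [image_rev, image_rev, ← smul_assoc] at e
  refine map_ket_eq_bra hτ e ?_
  obtain ⟨p0, p1, p2⟩ := par_one_two
  have H := isRTT_T (σ := σ) 1 2 c
  have hs := isRational_spec (σ := σ) hc
  rw [dualA12, ← Nat.choose_two_right, partSum, ← sum_partitions_comm]
  refine psiY_neg_one_pow_smul _ _ (psiY_expSum_prodKernel hc (huv.comp Sum.inr_injective)
    (huv.comp Sum.inl_injective) ?_ ?_ ?_ ?_ ?_ ?_ ?_ ?_ ?_ _)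
  · simp [p0, sg]
  · simp [p1, p2, sg]
  · simp [p0, sg]
  · simp [p0, p2]
  · simp [p1, p2]; rfl
  · simp [p0, p1]
  · exact H.self_twisted hs (by rw [p0]; rfl) (by rw [p2]; rfl)
  · exact isTwistedAlg_one fun hzw => H.self_comm hs (by rw [p1, p2]) hzw
  · exact H.self_twisted hs (by rw [p0]; rfl) (by rw [p1]; rfl)

theorem Psi12_eq_dualB12 (hc : c ≠ 0) (huv : Function.Injective (Sum.elim u v))
    (hΩ : IsSingular 1 2 Ω lam) (hτ : IsTransposition 1 2 Ω τ) :
    Psi12 c Ω τ u v = bra (τ Ω) (dualB12 c (lam 1) u v) := by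
  have e := betheOp12_ttr hc (elim_rev_injective huv) hΩ
  rw [image_rev, image_rev, ← smul_assoc] at e
  refine map_ket_eq_bra hτ e ?_
  obtain ⟨p0, p1, p2⟩ := par_one_two
  have H := isRTT_T (σ := σ) 1 2 c
  have hs := isRational_spec (σ := σ) hc
  rw [dualB12, ← Nat.choose_two_right, partSum]
  refine psiY_neg_one_pow_smul _ _ (psiY_expSum_izerginSet hc (huv.comp Sum.inl_injective)
    (huv.comp Sum.inr_injective) ?_ ?_ ?_ ?_ ?_ ?_ ?_ ?_ ?_ _)
  · simp [p0, sg]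
  · simp [p0, sg]
  · simp [p1, p2, sg]
  · simp [p0, p2]
  · simp [p0, p1]
  · simp [p1, p2]; rfl
  · exact H.self_twisted hs (by rw [p0]; rfl) (by rw [p2]; rfl)
  · exact H.self_twisted hs (by rw [p0]; rfl) (by rw [p1]; rfl)
  · exact isTwistedAlg_one fun hzw => H.self_comm hs (by rw [p1, p2]) hzw

end OneTwo

end DualBethe
end SuperYangian

theorem mainTheorem9 {σ : Type*} [LinearOrder σ] [Finite σ] (c : ℂ) (hc : c ≠ 0) {a b : ℕ}
    (u : Fin a → σ) (v : Fin b → σ) (huv : Function.Injective (Sum.elim u v)) :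
    (∀ (M W : Type*) [AddCommGroup M] [Module (SuperYangian.Yang 2 1) M] [AddCommGroup W]
      [Module (SuperYangian.Yang 2 1)ᵐᵒᵖ W] (Ω : M) (lam : Fin (2 + 1) → ℕ → ℂ) (τ : M →+ W),
      SuperYangian.IsSingular 2 1 Ω lam → SuperYangian.IsTransposition 2 1 Ω τ →
        SuperYangian.Psi21 c Ω τ u v
            = SuperYangian.bra (τ Ω) (SuperYangian.dualA21 c (lam 1) u v) ∧
          SuperYangian.Psi21 c Ω τ u v
            = SuperYangian.bra (τ Ω) (SuperYangian.dualB21 c (lam 1) u v)) ∧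
    (∀ (M W : Type*) [AddCommGroup M] [Module (SuperYangian.Yang 1 2) M] [AddCommGroup W]
      [Module (SuperYangian.Yang 1 2)ᵐᵒᵖ W] (Ω : M) (lam : Fin (1 + 2) → ℕ → ℂ) (τ : M →+ W),
      SuperYangian.IsSingular 1 2 Ω lam → SuperYangian.IsTransposition 1 2 Ω τ →
        SuperYangian.Psi12 c Ω τ u v
            = SuperYangian.bra (τ Ω) (SuperYangian.dualA12 c (lam 1) u v) ∧
          SuperYangian.Psi12 c Ω τ u v
            = SuperYangian.bra (τ Ω) (SuperYangian.dualB12 c (lam 1) u v)) :=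
  ⟨fun _ _ _ _ _ _ _ _ _ hΩ hτ => ⟨SuperYangian.Psi21_eq_dualA21 hc huv hΩ hτ,
      SuperYangian.Psi21_eq_dualB21 hc huv hΩ hτ⟩,
    fun _ _ _ _ _ _ _ _ _ hΩ hτ => ⟨SuperYangian.Psi12_eq_dualA12 hc huv hΩ hτ,
      SuperYangian.Psi12_eq_dualB12 hc huv hΩ hτ⟩⟩
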